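/- Fix integers $m,k\ge 1$, $d\ge 2$, $T\ge 1$, a real $\beta>-1$ and $p_1,\dots,p_T\in(0,1)$ with $\sum_i p_i=1$. Let $(G_n)_{n\ge 1}$ be the following random sequence of multigraphs, where $G_n$ has vertices $v_1,\dots,v_n$ and the types $X_1,X_2,\dots$ of $v_1,v_2,\dots$ are i.i.d. with $\Pr(X_1=i)=p_i$. The graph $G_1$ is the single vertex $v_1$ without edges. Given the whole construction of $G_n$, the graph $G_{n+1}$ is obtained by adding a vertex $v_{n+1}$ (of type $X_{n+1}$, independent of the past) and edges as follows. Vertex step: $m$ edges are drawn independently from $v_{n+1}$ to vertices of $G_n$, each end point being $v_j$ with probability proportional to $\deg_{G_n}(v_j)+\beta$. Edge step: independently of the vertex step, $k$ independent pairs $(w,u)$ are chosen and an edge is drawn from $w$ to $u$ for each. The vertex $w$ is uniform on $\{v_1,\dots,v_{n+1}\}$. Given $w$, let $E$ be the set of vertices among $v_1,\dots,v_{n+1}$ other than $w$ that have the type of $w$, or the set of all vertices other than $w$ if there are none of that type. One draws $d$ independent elements of $E$, each with probability proportional to the weight $\deg_{G_n}(v_j)+\beta$ for $j\le n$, the weight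 of $v_{n+1}$ being $0$, and $u$ is the sampled vertex with the highest degree in $G_n$ (ties are broken uniformly at random). In both steps, if only one vertex is available, it is chosen with probability $1$. Let $M_i(n)$ be the maximum degree in $G_n$ among the vertices of type $i$. Then for each type $i$ there is a random variable $R_i$ with values in the natural numbers such that, almost surely, there is a vertex $v$ of type $i$ such that for all $n\ge R_i$ the vertex $v$ belongs to $G_n$ and is the unique vertex of type $i$ with $\deg_{G_n}(v)=M_i(n)$. -/

import Mathlib

open MeasureTheory

noncomputable section

namespace EdgeChoice

/-- A finite multigraph with typed vertices. The vertices are `1, …, size`, the type of the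
vertex `v` is `type v`, and `edges` lists the edges with multiplicity. The values of `type`
outside `1, …, size` carry no meaning. -/
structure TypedGraph (T : ℕ) where
  size : ℕ
  type : ℕ → Fin T
  edges : Multiset (ℕ × ℕ)

/-- All random choices made when one vertex is added. -/
@[ext] structure Step (T m k d : ℕ) where
  /-- type of the new vertex -/
  type : Fin T
  /-- end points of the `m` edges drawn from the new vertex in the vertex step -/
  target : Fin m → ℕ
  /-- the uniformly chosen first vertices of the `k` pairs of the edge step -/
  w : Fin k → ℕ
  /-- the `k` samples of size `d` of the edge step -/
  y : Fin k → Fin d → ℕ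
  /-- the second vertices of the `k` pairs, selected from the samples -/
  u : Fin k → ℕ

/-- `Step` is countable; it carries the discrete sigma-algebra. -/
instance (T m k d : ℕ) : MeasurableSpace (Step T m k d) := ⊤

namespace TypedGraph

variable {T : ℕ}

/-- The set of vertices. -/
def vertices (g : TypedGraph T) : Finset ℕ := Finset.Icc 1 g.size

/-- Degree, with multiplicity; it is `0` for labels that are not vertices of the graphs below. -/
def deg (g : TypedGraph T) (v : ℕ) : ℕ :=
  g.edges.countP (fun e => e.1 = v) + g.edges.countP (fun e => e.2 = v)

/-- The weight `deg v + β` of a vertex; labels that are not vertices (in particular the vertex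
that is about to be added) have weight `0`. -/
def weight (g : TypedGraph T) (β : ℝ) (v : ℕ) : ℝ :=
  if v ∈ g.vertices then (g.deg v : ℝ) + β else 0

/-- The initial graph: a single vertex `1` of type `x` and no edges. -/
def initial (x : Fin T) : TypedGraph T where
  size := 1
  type := fun _ => x
  edges := 0

/-- The graph after the choices `c`: a new vertex `size + 1` of type `c.type`, the `m` edges from
it to the vertices `c.target l`, and the `k` edges from `c.w i` to `c.u i`. -/
def extend {m k d : ℕ} (g : TypedGraph T) (c : Step T m k d) : TypedGraph T where
  size := g.size + 1
  type := Function.update g.type (g.size + 1) c.type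
  edges := g.edges
    + (Finset.univ : Finset (Fin m)).val.map (fun l => (g.size + 1, c.target l))
    + (Finset.univ : Finset (Fin k)).val.map (fun i => (c.w i, c.u i))

/-- The vertices of type `i`. -/
def verticesOfType (g : TypedGraph T) (i : Fin T) : Finset ℕ :=
  g.vertices.filter (fun v => g.type v = i)

/-- The maximum degree among the vertices of type `i` (`0` if there are none). -/
def maxDeg (g : TypedGraph T) (i : Fin T) : ℕ := (g.verticesOfType i).sup g.deg

/-- Vertices of `g` and the new vertex `size + 1`, which gets type `x`, from which the edge step
may sample when the first vertex of the pair is `w`: those other than `w` with the type of `w`,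
or all vertices other than `w` if there are none of that type. -/
def candidates (g : TypedGraph T) (x : Fin T) (w : ℕ) : Finset ℕ :=
  let type' : ℕ → Fin T := Function.update g.type (g.size + 1) x
  let others : Finset ℕ := (Finset.Icc 1 (g.size + 1)).erase w
  let same : Finset ℕ := others.filter (fun v => type' v = type' w)
  if same.Nonempty then same else others

end TypedGraph

/-- Probability of choosing `v` from the finite set `E` with probabilities proportional to the
weights `W`. The only element of a one-element set is chosen with probability `1`, whatever its
weight is. -/
def choiceProb (W : ℕ → ℝ) (E : Finset ℕ) (v : ℕ) : ℝ :=
  if E = {v} then 1 else if v ∈ E then W v / ∑ a ∈ E, W a else 0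

/-- Probability of choosing `v` uniformly from the finite set `E`. -/
def uniformProb (E : Finset ℕ) (v : ℕ) : ℝ :=
  if v ∈ E then 1 / (E.card : ℝ) else 0

/-- The vertices of the sample `y` that have the highest degree in `g` within the sample. -/
def topOfSample {T d : ℕ} (g : TypedGraph T) (y : Fin d → ℕ) : Finset ℕ :=
  (Finset.univ.image y).filter (fun v => ∀ l, g.deg (y l) ≤ g.deg v)

/-- Conditional probability, given that the current graph is `g`, that the choices made in the
next step are `c`: the type of the new vertex has law `p`; the `m` edges of the vertex step go
independently to old vertices, chosen with probability proportional to degree plus `β`; and the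
`k` pairs `(w, u)` are chosen independently, `w` uniformly from all vertices, the new one
included, and `u` as a vertex of highest degree in `g` (ties broken uniformly) in a sample of `d`
independent candidates, chosen with probability proportional to degree in `g` plus `β`. -/
def stepProb {T m k d : ℕ} (β : ℝ) (p : Fin T → ℝ) (g : TypedGraph T) (c : Step T m k d) : ℝ :=
  p c.type
  * (∏ l, choiceProb (g.weight β) g.vertices (c.target l))
  * ∏ i, (uniformProb (Finset.Icc 1 (g.size + 1)) (c.w i)
      * (∏ l, choiceProb (g.weight β) (g.candidates c.type (c.w i)) (c.y i l))
      * uniformProb (topOfSample g (c.y i)) (c.u i))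

/-- The graph with `n + 1` vertices obtained from a first vertex of type `x` after the first `n`
of the steps `s 0, s 1, …`. -/
def graphAfter {T m k d : ℕ} (x : Fin T) (s : ℕ → Step T m k d) : ℕ → TypedGraph T
  | 0 => TypedGraph.initial x
  | n + 1 => (graphAfter x s n).extend (s n)

/-- `X` (the type of the first vertex) and `S 0, S 1, …` (the successive steps) are the random
variables of a preferential attachment process with choice-based edge step: `X` has law `p`, and
the conditional probability of each step given all the previous choices is `stepProb`. -/
structure IsProcess {T m k d : ℕ} {Ω : Type*} [MeasurableSpace Ω] (μ : Measure Ω)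
    (β : ℝ) (p : Fin T → ℝ) (X : Ω → Fin T) (S : ℕ → Ω → Step T m k d) : Prop where
  measurable_type : Measurable X
  measurable_step : ∀ n, Measurable (S n)
  law_type : ∀ x, μ {ω | X ω = x} = ENNReal.ofReal (p x)
  law_step : ∀ (n : ℕ) (x : Fin T) (s : ℕ → Step T m k d),
    μ {ω | X ω = x ∧ ∀ j < n + 1, S j ω = s j}
      = μ {ω | X ω = x ∧ ∀ j < n, S j ω = s j}
        * ENNReal.ofReal (stepProb β p (graphAfter x s n) (s n))

/-- `h` is a vertex of type `i`, its degree is the maximum degree among the vertices of type `i`,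
and no other vertex of type `i` has that degree. -/
def IsUniqueLeader {T : ℕ} (g : TypedGraph T) (i : Fin T) (h : ℕ) : Prop :=
  h ∈ g.verticesOfType i ∧ g.deg h = g.maxDeg i ∧
    ∀ v ∈ g.verticesOfType i, g.deg v = g.maxDeg i → v = h

end EdgeChoice

end

/-!
Why a persistent leader exists. In both steps a vertex is chosen with probability proportional to
its weight `deg + β`, or, in the second choice of the edge step, with a probability per unit of
weight that increases with the degree; being the first vertex of a pair only adds the same amount
to the rate of every vertex. So, after a shift of the weights by a constant, of two vertices of the
same type the one of larger degree has the larger relative growth rate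
(`stepMean_incr_mul_le`). The comparison of the second choices comes from exchanging the two
vertices in a sample (`pickProb_swap_le`). Given this, everything follows from nonnegative
supermartingales of the form `f (graph n)` and the maximal inequality `mul_measure_hit_le`.

* The number of vertices of type `i` is at least a constant times the number of all vertices
  (`exists_ae_card_verticesOfType`, exponential martingale `typePotential`).
* The weight of a fixed vertex is eventually at least a constant times `size ^ ε`
  (`exists_ae_le_weight`, supermartingale `size ^ ε / weight`).
* Fix `v`. For a vertex `u` of the same type and `q` arbitrary, the `q`-th power of
  `(weight u + s) / (weight v + s)` is a supermartingale as long as the ratio is below `1 / 2`, if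
  the shift `s` is large in terms of `q`. As a new vertex has bounded degree, the vertex born when
  the size is `u` reaches the degree of `v` with probability at most of order `u ^ (-ε * q)`. For
  large `q` this is summable, and by the Borel-Cantelli lemma only finitely many vertices ever
  reach the degree of `v` (`ae_exists_forall_deg_lt`).
* For a pair of vertices with difference `D` and shifted sum `Z` of the weights consider
  `1 / (K + D ^ 2 / Z)`. The drift does not decrease `|D| / Z`, and one edge of the vertex step
  alone gives `D` a variance that is comparable with the growth of `Z`; together they make the
  potential contract by a factor `1 - ε / size` on average (`exists_pairPotential_contract`). So it
  tends to `0`, `|D|` eventually exceeds the largest possible step, and the sign of `D` is constant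
  from then on (`ae_exists_forall_deg_lt_or`).

A vertex of type `i` exists, the vertices that ever catch up with it form a finite set, and in this
set the order of the degrees is eventually constant and strict.
-/

noncomputable section

namespace EdgeChoice

/-! ### Degrees and regular graphs -/

namespace TypedGraph

variable {T m k d : ℕ}

/-- The number of end points at `v` among the edges added by the choices `c`. -/
def incr (g : TypedGraph T) (c : Step T m k d) (v : ℕ) : ℕ :=
  (∑ l, ((if g.size + 1 = v then 1 else 0) + if c.target l = v then 1 else 0))
    + ∑ i, ((if c.w i = v then 1 else 0) + if c.u i = v then 1 else 0)

theorem countP_map_univ {n : ℕ} (f : Fin n → ℕ × ℕ) (q : ℕ × ℕ → Prop) [DecidablePred q] :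
    ((Finset.univ : Finset (Fin n)).val.map f).countP q = ∑ i, if q (f i) then 1 else 0 := by
  rw [Multiset.countP_map, Finset.sum_ite, Finset.sum_const_zero, add_zero, Finset.sum_const,
    smul_eq_mul, mul_one]
  rfl

theorem deg_extend (g : TypedGraph T) (c : Step T m k d) (v : ℕ) :
    (g.extend c).deg v = g.deg v + g.incr c v := by
  unfold deg extend incr
  simp only [Multiset.countP_add, countP_map_univ, Finset.sum_add_distrib]
  omega

theorem incr_le (g : TypedGraph T) (c : Step T m k d) (v : ℕ) :
    g.incr c v ≤ 2 * (m + k) := by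
  unfold incr
  have h1 : (∑ l : Fin m, ((if g.size + 1 = v then 1 else 0) + if c.target l = v then 1 else 0))
      ≤ ∑ _l : Fin m, 2 := Finset.sum_le_sum fun l _ => by split_ifs <;> simp
  have h2 : (∑ i : Fin k, ((if c.w i = v then 1 else 0) + if c.u i = v then 1 else 0))
      ≤ ∑ _i : Fin k, 2 := Finset.sum_le_sum fun l _ => by split_ifs <;> simp
  simp at h1 h2
  omega

theorem incr_eq_of_mem {g : TypedGraph T} (c : Step T m k d) {v : ℕ} (hv : v ∈ g.vertices) :
    (g.incr c v : ℝ) = (∑ l, if c.target l = v then (1 : ℝ) else 0)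
      + ∑ i, ((if c.w i = v then (1 : ℝ) else 0) + if c.u i = v then 1 else 0) := by
  have : ¬ g.size + 1 = v := by
    have := Finset.mem_Icc.1 hv
    omega
  simp [incr, this]

@[simp] theorem size_extend (g : TypedGraph T) (c : Step T m k d) :
    (g.extend c).size = g.size + 1 := rfl

theorem type_extend_of_mem {g : TypedGraph T} (c : Step T m k d) {v : ℕ} (hv : v ∈ g.vertices) :
    (g.extend c).type v = g.type v := by
  have := Finset.mem_Icc.1 hv
  exact Function.update_of_ne (by omega) _ _

theorem mem_vertices_extend {g : TypedGraph T} (c : Step T m k d) {v : ℕ}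
    (hv : v ∈ g.vertices) : v ∈ (g.extend c).vertices := by
  have := Finset.mem_Icc.1 hv
  exact Finset.mem_Icc.2 ⟨this.1, by simp; omega⟩

theorem vertices_extend (g : TypedGraph T) (c : Step T m k d) :
    (g.extend c).vertices = insert (g.size + 1) g.vertices := by
  ext v
  simp [vertices]
  omega

/-- The properties of the graphs of the process from the second one on that the estimates use:
the graph has at least two vertices, every vertex has an edge, edges join vertices, there are at
most `M` edges per vertex, and the vertex added last has degree at most `2 * M`. -/
structure Regular (M : ℕ) (g : TypedGraph T) : Prop where
  two_le_size : 2 ≤ g.size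
  one_le_deg : ∀ v ∈ g.vertices, 1 ≤ g.deg v
  edges_mem : ∀ e ∈ g.edges, e.1 ∈ g.vertices ∧ e.2 ∈ g.vertices
  card_edges_le : g.edges.card ≤ M * g.size
  deg_last_le : g.deg g.size ≤ 2 * M

theorem candidates_subset (g : TypedGraph T) (x : Fin T) (w : ℕ) :
    g.candidates x w ⊆ (Finset.Icc 1 (g.size + 1)).erase w := by
  unfold candidates
  simp only
  split_ifs
  · exact Finset.filter_subset _ _
  · exact subset_rfl

end TypedGraph

theorem mem_of_choiceProb_ne_zero {W : ℕ → ℝ} {E : Finset ℕ} {v : ℕ}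
    (h : choiceProb W E v ≠ 0) : v ∈ E := by
  unfold choiceProb at h
  split_ifs at h with h1 h2
  · simp [h1]
  · exact h2
  · exact absurd rfl h

theorem mem_of_uniformProb_ne_zero {E : Finset ℕ} {v : ℕ} (h : uniformProb E v ≠ 0) : v ∈ E := by
  unfold uniformProb at h
  split_ifs at h with h1
  · exact h1
  · exact absurd rfl h

theorem mem_image_of_mem_topOfSample {T d : ℕ} {g : TypedGraph T} {y : Fin d → ℕ} {v : ℕ}
    (h : v ∈ topOfSample g y) : ∃ l, y l = v := by
  simpa using (Finset.mem_filter.1 h).1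

section

variable {T m k d : ℕ} {β : ℝ} {p : Fin T → ℝ} {g : TypedGraph T} {c : Step T m k d}

theorem target_mem (h : stepProb β p g c ≠ 0) (l : Fin m) : c.target l ∈ g.vertices := by
  unfold stepProb at h
  have h1 := right_ne_zero_of_mul (left_ne_zero_of_mul h)
  exact mem_of_choiceProb_ne_zero (Finset.prod_ne_zero_iff.1 h1 l (Finset.mem_univ _))

theorem w_mem (h : stepProb β p g c ≠ 0) (i : Fin k) : c.w i ∈ Finset.Icc 1 (g.size + 1) := by
  unfold stepProb at h
  have h1 := Finset.prod_ne_zero_iff.1 (right_ne_zero_of_mul h) i (Finset.mem_univ _)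
  exact mem_of_uniformProb_ne_zero (left_ne_zero_of_mul (left_ne_zero_of_mul h1))

theorem u_mem (h : stepProb β p g c ≠ 0) (i : Fin k) : c.u i ∈ Finset.Icc 1 (g.size + 1) := by
  unfold stepProb at h
  have h1 := Finset.prod_ne_zero_iff.1 (right_ne_zero_of_mul h) i (Finset.mem_univ _)
  obtain ⟨l, hl⟩ := mem_image_of_mem_topOfSample
    (mem_of_uniformProb_ne_zero (right_ne_zero_of_mul h1))
  have h2 := Finset.prod_ne_zero_iff.1 (right_ne_zero_of_mul (left_ne_zero_of_mul h1)) l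
    (Finset.mem_univ _)
  rw [hl] at h2
  exact Finset.erase_subset _ _ (g.candidates_subset _ _ (mem_of_choiceProb_ne_zero h2))

theorem deg_eq_zero_of_notMem {g : TypedGraph T}
    (he : ∀ e ∈ g.edges, e.1 ∈ g.vertices ∧ e.2 ∈ g.vertices) {v : ℕ} (hv : v ∉ g.vertices) :
    g.deg v = 0 := by
  unfold TypedGraph.deg
  rw [Nat.add_eq_zero_iff, Multiset.countP_eq_zero, Multiset.countP_eq_zero]
  exact ⟨fun e h1 h2 => hv (h2 ▸ (he e h1).1), fun e h1 h2 => hv (h2 ▸ (he e h1).2)⟩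

/-- Extension preserves regularity. Isolated vertices are allowed in a graph with one vertex, since
the edges of the vertex step must end there. -/
theorem regular_extend_of_one_le_size (hm : 1 ≤ m) (h1 : 1 ≤ g.size)
    (hdeg : ∀ v ∈ g.vertices, 1 ≤ g.deg v ∨ g.size = 1)
    (he : ∀ e ∈ g.edges, e.1 ∈ g.vertices ∧ e.2 ∈ g.vertices)
    (hcard : g.edges.card ≤ (m + k) * g.size) (hc : stepProb β p g c ≠ 0) :
    (g.extend c).Regular (m + k) where
  two_le_size := by simp; omega
  one_le_deg v hv := by
    rw [TypedGraph.deg_extend]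
    rw [TypedGraph.vertices_extend, Finset.mem_insert] at hv
    have key : ∀ l₀ : Fin m, (g.size + 1 = v ∨ c.target l₀ = v) → 1 ≤ g.incr c v := by
      intro l₀ h
      unfold TypedGraph.incr
      refine le_trans ?_ (Nat.le_add_right _ _)
      refine le_trans ?_ (Finset.single_le_sum (fun _ _ => Nat.zero_le _) (Finset.mem_univ l₀))
      rcases h with h | h <;> simp [h]
    rcases hv with rfl | hv
    · have := key ⟨0, hm⟩ (Or.inl rfl)
      omega
    · rcases hdeg v hv with h | h
      · omega
      · have h2 : c.target ⟨0, hm⟩ = v := by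
          have a1 := Finset.mem_Icc.1 (target_mem hc ⟨0, hm⟩)
          have a2 := Finset.mem_Icc.1 hv
          omega
        have := key ⟨0, hm⟩ (Or.inr h2)
        omega
  edges_mem e h := by
    have hsub : ∀ v, v ∈ Finset.Icc 1 (g.size + 1) → v ∈ (g.extend c).vertices := fun v hv => hv
    simp only [TypedGraph.extend, Multiset.mem_add, Multiset.mem_map] at h
    rcases h with (h | ⟨l, -, rfl⟩) | ⟨i, -, rfl⟩
    · exact ⟨TypedGraph.mem_vertices_extend c (he e h).1,
        TypedGraph.mem_vertices_extend c (he e h).2⟩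
    · exact ⟨hsub _ (by simp), TypedGraph.mem_vertices_extend c (target_mem hc l)⟩
    · exact ⟨hsub _ (w_mem hc i), hsub _ (u_mem hc i)⟩
  card_edges_le := by
    have : (g.extend c).edges.card = g.edges.card + m + k := by simp [TypedGraph.extend]
    rw [this, TypedGraph.size_extend, mul_add]
    omega
  deg_last_le := by
    rw [TypedGraph.deg_extend, TypedGraph.size_extend, deg_eq_zero_of_notMem he]
    · rw [zero_add]
      exact g.incr_le c _
    · simp [TypedGraph.vertices]

theorem TypedGraph.Regular.extend (hm : 1 ≤ m) (hg : g.Regular (m + k))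
    (hc : stepProb β p g c ≠ 0) : (g.extend c).Regular (m + k) :=
  regular_extend_of_one_le_size hm (by have := hg.two_le_size; omega)
    (fun v hv => Or.inl (hg.one_le_deg v hv)) hg.edges_mem hg.card_edges_le hc

theorem regular_initial_extend (hm : 1 ≤ m) {x : Fin T}
    (hc : stepProb β p (TypedGraph.initial x) c ≠ 0) :
    ((TypedGraph.initial x).extend c).Regular (m + k) :=
  regular_extend_of_one_le_size hm le_rfl (fun _ _ => Or.inr rfl) (by simp [TypedGraph.initial])
    (by simp [TypedGraph.initial]) hc

namespace TypedGraph

theorem sum_countP_le (s : Multiset (ℕ × ℕ)) (f : ℕ × ℕ → ℕ) (V : Finset ℕ) :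
    ∑ v ∈ V, s.countP (fun e => f e = v) ≤ s.card := by
  induction s using Multiset.induction_on with
  | empty => simp
  | cons e s ih =>
    simp only [Multiset.countP_cons, Finset.sum_add_distrib, Multiset.card_cons]
    have : (∑ v ∈ V, if f e = v then 1 else 0) ≤ 1 := by
      rw [Finset.sum_ite_eq]
      split_ifs <;> simp
    omega

theorem sum_deg_le (g : TypedGraph T) : ∑ v ∈ g.vertices, g.deg v ≤ 2 * g.edges.card := by
  unfold deg
  rw [Finset.sum_add_distrib]
  have h1 := sum_countP_le g.edges Prod.fst g.vertices
  have h2 := sum_countP_le g.edges Prod.snd g.vertices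
  omega

variable {M : ℕ}

theorem weight_of_mem {v : ℕ} (hv : v ∈ g.vertices) : g.weight β v = g.deg v + β := if_pos hv

theorem Regular.one_add_le_weight (hg : g.Regular M) {v : ℕ} (hv : v ∈ g.vertices) :
    1 + β ≤ g.weight β v := by
  rw [weight_of_mem hv]
  have : (1 : ℝ) ≤ g.deg v := by exact_mod_cast hg.one_le_deg v hv
  linarith

theorem Regular.weight_pos (hβ : -1 < β) (hg : g.Regular M) {v : ℕ} (hv : v ∈ g.vertices) :
    0 < g.weight β v := by
  have := hg.one_add_le_weight (β := β) hv
  linarith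

theorem Regular.weight_nonneg (hβ : -1 < β) (hg : g.Regular M) (v : ℕ) : 0 ≤ g.weight β v := by
  by_cases hv : v ∈ g.vertices
  · exact (hg.weight_pos hβ hv).le
  · simp [weight, hv]

theorem Regular.sum_weight_le (hg : g.Regular M) :
    ∑ v ∈ g.vertices, g.weight β v ≤ (2 * M + |β|) * g.size := by
  have h1 : ∑ v ∈ g.vertices, g.weight β v = ∑ v ∈ g.vertices, ((g.deg v : ℝ) + β) :=
    Finset.sum_congr rfl fun v hv => weight_of_mem hv
  have h2 : ((∑ v ∈ g.vertices, g.deg v : ℕ) : ℝ) ≤ 2 * (M * g.size) := by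
    exact_mod_cast g.sum_deg_le.trans (Nat.mul_le_mul_left 2 hg.card_edges_le)
  have h3 : g.vertices.card = g.size := by simp [vertices]
  rw [h1, Finset.sum_add_distrib, Finset.sum_const, h3, nsmul_eq_mul]
  push_cast at h2
  nlinarith [le_abs_self β, (Nat.cast_nonneg g.size : (0 : ℝ) ≤ g.size)]

/-- A set of vertices has at least the weight that its size forces. -/
theorem Regular.card_mul_le_sum_weight (hg : g.Regular M) {E : Finset ℕ} (hE : E ⊆ g.vertices) :
    (E.card : ℝ) * (1 + β) ≤ ∑ v ∈ E, g.weight β v := by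
  have := Finset.card_nsmul_le_sum E (g.weight β) (1 + β)
    (fun v hv => hg.one_add_le_weight (hE hv))
  rwa [nsmul_eq_mul] at this

end TypedGraph

end

/-! ### Averages over the next step -/

/-- Replacing one coordinate of an independent sample by an independent copy does not change the
law of the sample. -/
theorem sum_piFinset_resample {ι α : Type*} [Fintype ι] [DecidableEq ι] [DecidableEq α]
    (s : Finset α) (q : α → ℝ) (hq : ∑ a ∈ s, q a = 1) (F : (ι → α) → ℝ) (j : ι) :
    ∑ t ∈ Fintype.piFinset (fun _ : ι => s), (∏ l, q (t l)) * F t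
      = ∑ t ∈ Fintype.piFinset (fun _ : ι => s), (∏ l, q (t l)) *
          ∑ a ∈ s, q a * F (Function.update t j a) := by
  have h1 : ∀ t : ι → α, (∏ l, q (t l)) * F t = ∑ a ∈ s, (∏ l, q (t l)) * q a * F t := by
    intro t
    rw [← Finset.sum_mul, ← Finset.mul_sum, hq, mul_one]
  simp_rw [h1, Finset.mul_sum]
  rw [← Finset.sum_product', ← Finset.sum_product']
  refine Finset.sum_nbij' (fun x => (Function.update x.1 j x.2, x.1 j))
    (fun x => (Function.update x.1 j x.2, x.1 j)) ?_ ?_ ?_ ?_ ?_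
  · rintro ⟨t, a⟩ h
    simp only [Finset.mem_product, Fintype.mem_piFinset] at h ⊢
    refine ⟨fun l => ?_, h.1 j⟩
    by_cases hl : l = j
    · subst hl; simpa using h.2
    · simpa [hl] using h.1 l
  · rintro ⟨t, a⟩ h
    simp only [Finset.mem_product, Fintype.mem_piFinset] at h ⊢
    refine ⟨fun l => ?_, h.1 j⟩
    by_cases hl : l = j
    · subst hl; simpa using h.2
    · simpa [hl] using h.1 l
  · rintro ⟨t, a⟩ _; simp
  · rintro ⟨t, a⟩ _; simp
  · rintro ⟨t, a⟩ _
    have key : (∏ l, q (t l)) * q a = (∏ l, q (Function.update t j a l)) * q (t j) := by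
      rw [← Finset.mul_prod_erase Finset.univ (fun l => q (t l)) (Finset.mem_univ j),
        ← Finset.mul_prod_erase Finset.univ (fun l => q (Function.update t j a l))
          (Finset.mem_univ j)]
      have : ∏ l ∈ Finset.univ.erase j, q (Function.update t j a l)
          = ∏ l ∈ Finset.univ.erase j, q (t l) :=
        Finset.prod_congr rfl fun l hl => by
          rw [Function.update_of_ne (Finset.ne_of_mem_erase hl)]
      rw [this, Function.update_self]
      ring
    simp only [Function.update_idem, Function.update_eq_self]
    rw [key, mul_assoc]

theorem sum_piFinset_one {ι α : Type*} [Fintype ι] [DecidableEq ι] [DecidableEq α]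
    (s : Finset α) (q : α → ℝ) (hq : ∑ a ∈ s, q a = 1) :
    ∑ t ∈ Fintype.piFinset (fun _ : ι => s), ∏ l, q (t l) = 1 := by
  rw [← Finset.prod_univ_sum]
  simp [hq]

theorem sum_piFinset_apply {ι α : Type*} [Fintype ι] [DecidableEq ι] [DecidableEq α]
    (s : Finset α) (q : α → ℝ) (hq : ∑ a ∈ s, q a = 1) (φ : α → ℝ) (j : ι) :
    ∑ t ∈ Fintype.piFinset (fun _ : ι => s), (∏ l, q (t l)) * φ (t j) = ∑ a ∈ s, q a * φ a := by
  rw [sum_piFinset_resample s q hq (fun t => φ (t j)) j]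
  simp only [Function.update_self]
  rw [← Finset.sum_mul, sum_piFinset_one s q hq, one_mul]

section

variable {T m k d : ℕ} {β : ℝ} {p : Fin T → ℝ} {g : TypedGraph T} {M : ℕ}

theorem choiceProb_nonneg {W : ℕ → ℝ} (hW : ∀ v, 0 ≤ W v) (E : Finset ℕ) (v : ℕ) :
    0 ≤ choiceProb W E v := by
  unfold choiceProb
  split_ifs
  · exact zero_le_one
  · exact div_nonneg (hW v) (Finset.sum_nonneg fun a _ => hW a)
  · exact le_rfl

theorem sum_choiceProb {W : ℕ → ℝ} {E : Finset ℕ} (hE : E.Nonempty)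
    (h : 2 ≤ E.card → ∑ a ∈ E, W a ≠ 0) : ∑ v ∈ E, choiceProb W E v = 1 := by
  by_cases h1 : 2 ≤ E.card
  · have h2 : ∀ v ∈ E, choiceProb W E v = W v / ∑ a ∈ E, W a := by
      intro v hv
      have : E ≠ {v} := by rintro rfl; simp at h1
      simp [choiceProb, this, hv]
    rw [Finset.sum_congr rfl h2, ← Finset.sum_div, div_self (h h1)]
  · have : E.card = 1 := by have := hE.card_pos; omega
    obtain ⟨v, rfl⟩ := Finset.card_eq_one.1 this
    simp [choiceProb]

theorem uniformProb_nonneg (E : Finset ℕ) (v : ℕ) : 0 ≤ uniformProb E v := by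
  unfold uniformProb
  split_ifs <;> positivity

theorem uniformProb_le_one (E : Finset ℕ) (v : ℕ) : uniformProb E v ≤ 1 := by
  unfold uniformProb
  split_ifs with h
  · have : (1 : ℝ) ≤ E.card := by exact_mod_cast Finset.card_pos.2 ⟨v, h⟩
    exact (div_le_one (by linarith)).2 this
  · exact zero_le_one

theorem sum_uniformProb {E s : Finset ℕ} (hE : E.Nonempty) (hs : E ⊆ s) :
    ∑ v ∈ s, uniformProb E v = 1 := by
  unfold uniformProb
  rw [Finset.sum_ite_mem, Finset.inter_eq_right.2 hs, Finset.sum_const, nsmul_eq_mul]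
  have : (E.card : ℝ) ≠ 0 := by exact_mod_cast hE.card_pos.ne'
  field_simp

theorem topOfSample_nonempty (hd : 0 < d) (g : TypedGraph T) (y : Fin d → ℕ) :
    (topOfSample g y).Nonempty := by
  have : Nonempty (Fin d) := ⟨⟨0, hd⟩⟩
  obtain ⟨l, hl⟩ := Finite.exists_max (fun l => g.deg (y l))
  exact ⟨y l, Finset.mem_filter.2 ⟨Finset.mem_image_of_mem y (Finset.mem_univ l), hl⟩⟩

theorem topOfSample_subset {E : Finset ℕ} {y : Fin d → ℕ}
    (hy : y ∈ Fintype.piFinset (fun _ => E)) : topOfSample g y ⊆ E := by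
  intro v hv
  obtain ⟨l, rfl⟩ := mem_image_of_mem_topOfSample hv
  exact Fintype.mem_piFinset.1 hy l

theorem candidates_nonempty (hg : g.Regular M) (x : Fin T) (w : ℕ) :
    (g.candidates x w).Nonempty := by
  unfold TypedGraph.candidates
  simp only
  split_ifs with h
  · exact h
  · rw [← Finset.card_pos]
    have := Finset.pred_card_le_card_erase (s := Finset.Icc 1 (g.size + 1)) (a := w)
    rw [Nat.card_Icc] at this
    have := hg.two_le_size
    omega

theorem subset_Icc_of_mem_candidates (g : TypedGraph T) (x : Fin T) (w : ℕ) :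
    g.candidates x w ⊆ Finset.Icc 1 (g.size + 1) :=
  (g.candidates_subset x w).trans (Finset.erase_subset _ _)

theorem sum_weight_pos (hβ : -1 < β) (hg : g.Regular M) {E : Finset ℕ} {v : ℕ} (hvE : v ∈ E)
    (hv : v ∈ g.vertices) : 0 < ∑ a ∈ E, g.weight β a :=
  lt_of_lt_of_le (hg.weight_pos hβ hv)
    (Finset.single_le_sum (f := g.weight β) (fun a _ => hg.weight_nonneg hβ a) hvE)

/-- The possible samples and their choice probabilities form a probability distribution. -/
theorem sum_choiceProb_candidates (hβ : -1 < β) (hg : g.Regular M) (x : Fin T) (w : ℕ) :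
    ∑ v ∈ g.candidates x w, choiceProb (g.weight β) (g.candidates x w) v = 1 := by
  refine sum_choiceProb (candidates_nonempty hg x w) fun h => ?_
  obtain ⟨v, hv, hne⟩ := Finset.exists_mem_ne h (g.size + 1)
  refine (sum_weight_pos hβ hg hv ?_).ne'
  have := Finset.mem_Icc.1 (subset_Icc_of_mem_candidates g x w hv)
  exact Finset.mem_Icc.2 (by omega)

theorem sum_choiceProb_vertices (hβ : -1 < β) (hg : g.Regular M) :
    ∑ v ∈ g.vertices, choiceProb (g.weight β) g.vertices v = 1 := by
  have h1 : 1 ∈ g.vertices := Finset.mem_Icc.2 ⟨le_rfl, by have := hg.two_le_size; omega⟩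
  exact sum_choiceProb ⟨1, h1⟩ fun _ => (sum_weight_pos hβ hg h1 h1).ne'

/-- Probability that a vertex of highest degree in a sample of size `d` from `E` is `v`. -/
def pickProb (β : ℝ) (d : ℕ) (g : TypedGraph T) (E : Finset ℕ) (v : ℕ) : ℝ :=
  ∑ y ∈ Fintype.piFinset (fun _ : Fin d => E),
    (∏ l, choiceProb (g.weight β) E (y l)) * uniformProb (topOfSample g y) v

/-- The law of one of the `k` pairs, together with its sample, when the new vertex has
type `x`. -/
def pairProb (β : ℝ) (g : TypedGraph T) (x : Fin T) (r : ℕ × (Fin d → ℕ) × ℕ) : ℝ :=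
  uniformProb (Finset.Icc 1 (g.size + 1)) r.1
    * (∏ l, choiceProb (g.weight β) (g.candidates x r.1) (r.2.1 l))
    * uniformProb (topOfSample g r.2.1) r.2.2

/-- A finite set that carries the law `pairProb`. -/
def pairSupport (d : ℕ) (g : TypedGraph T) : Finset (ℕ × (Fin d → ℕ) × ℕ) :=
  Finset.Icc 1 (g.size + 1) ×ˢ
    (Fintype.piFinset fun _ : Fin d => Finset.Icc 1 (g.size + 1)) ×ˢ Finset.Icc 1 (g.size + 1)

theorem pairProb_nonneg (hβ : -1 < β) (hg : g.Regular M) (x : Fin T)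
    (r : ℕ × (Fin d → ℕ) × ℕ) : 0 ≤ pairProb β g x r :=
  mul_nonneg (mul_nonneg (uniformProb_nonneg _ _)
    (Finset.prod_nonneg fun _ _ => choiceProb_nonneg (hg.weight_nonneg hβ) _ _))
    (uniformProb_nonneg _ _)

/-- The mean of a function of the two vertices of a pair, computed by choosing first `w`, then the
sample, then `u`. -/
theorem sum_pairProb_mul (x : Fin T) (φ : ℕ → ℕ → ℝ) :
    ∑ r ∈ pairSupport d g, pairProb β g x r * φ r.1 r.2.2
      = ∑ w ∈ Finset.Icc 1 (g.size + 1), uniformProb (Finset.Icc 1 (g.size + 1)) w *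
          ∑ y ∈ Fintype.piFinset (fun _ : Fin d => g.candidates x w),
            (∏ l, choiceProb (g.weight β) (g.candidates x w) (y l)) *
              ∑ u ∈ Finset.Icc 1 (g.size + 1), uniformProb (topOfSample g y) u * φ w u := by
  unfold pairSupport
  rw [Finset.sum_product]
  refine Finset.sum_congr rfl fun w _ => ?_
  rw [Finset.sum_product, Finset.mul_sum]
  symm
  refine Finset.sum_subset_zero_on_sdiff ?_ ?_ ?_
  · exact Fintype.piFinset_subset _ _ fun _ => subset_Icc_of_mem_candidates g x w
  · intro y hy
    rw [Finset.mem_sdiff] at hy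
    have : ∃ l, y l ∉ g.candidates x w := by
      by_contra! h
      exact hy.2 (Fintype.mem_piFinset.2 h)
    obtain ⟨l, hl⟩ := this
    have h0 : (∏ l, choiceProb (g.weight β) (g.candidates x w) (y l)) = 0 :=
      Finset.prod_eq_zero (Finset.mem_univ l)
        (by by_contra h; exact hl (mem_of_choiceProb_ne_zero h))
    simp [pairProb, h0]
  · intro y _
    rw [Finset.mul_sum, Finset.mul_sum]
    refine Finset.sum_congr rfl fun u _ => ?_
    unfold pairProb
    ring

theorem sum_uniformProb_topOfSample (hd : 0 < d) (x : Fin T) (w : ℕ) {y : Fin d → ℕ}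
    (hy : y ∈ Fintype.piFinset (fun _ : Fin d => g.candidates x w)) :
    ∑ u ∈ Finset.Icc 1 (g.size + 1), uniformProb (topOfSample g y) u = 1 :=
  sum_uniformProb (topOfSample_nonempty hd g y)
    ((topOfSample_subset hy).trans (subset_Icc_of_mem_candidates g x w))

theorem sum_pairProb_fst (hβ : -1 < β) (hd : 0 < d) (hg : g.Regular M) (x : Fin T) (φ : ℕ → ℝ) :
    ∑ r ∈ pairSupport d g, pairProb β g x r * φ r.1
      = ∑ w ∈ Finset.Icc 1 (g.size + 1), uniformProb (Finset.Icc 1 (g.size + 1)) w * φ w := by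
  rw [sum_pairProb_mul x (fun w _ => φ w)]
  refine Finset.sum_congr rfl fun w _ => ?_
  congr 1
  rw [Finset.sum_congr rfl (g := fun y =>
    (∏ l, choiceProb (g.weight β) (g.candidates x w) (y l)) * φ w)]
  · rw [← Finset.sum_mul, sum_piFinset_one _ _ (sum_choiceProb_candidates hβ hg x w), one_mul]
  · intro y hy
    rw [← Finset.sum_mul, sum_uniformProb_topOfSample hd x w hy, one_mul]

theorem sum_pairProb (hβ : -1 < β) (hd : 0 < d) (hg : g.Regular M) (x : Fin T) :
    ∑ r ∈ pairSupport d g, pairProb β g x r = 1 := by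
  have := sum_pairProb_fst (d := d) hβ hd hg x (fun _ => 1)
  simp only [mul_one] at this
  rw [this]
  exact sum_uniformProb ⟨1, by simp⟩ subset_rfl

theorem sum_pairProb_snd (x : Fin T) (v : ℕ) (hv : v ∈ Finset.Icc 1 (g.size + 1)) :
    ∑ r ∈ pairSupport d g, pairProb β g x r * (if r.2.2 = v then 1 else 0)
      = ∑ w ∈ Finset.Icc 1 (g.size + 1), uniformProb (Finset.Icc 1 (g.size + 1)) w *
          pickProb β d g (g.candidates x w) v := by
  rw [sum_pairProb_mul x (fun _ u => if u = v then 1 else 0)]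
  refine Finset.sum_congr rfl fun w _ => ?_
  congr 1
  unfold pickProb
  refine Finset.sum_congr rfl fun y _ => ?_
  congr 1
  simp only [mul_ite, mul_one, mul_zero]
  rw [Finset.sum_ite_eq', if_pos hv]

/-- A step as a tuple of its components. -/
def stepEquiv (T m k d : ℕ) :
    Step T m k d ≃ Fin T × (Fin m → ℕ) × (Fin k → ℕ × (Fin d → ℕ) × ℕ) where
  toFun c := (c.type, c.target, fun i => (c.w i, c.y i, c.u i))
  invFun x := ⟨x.1, x.2.1, fun i => (x.2.2 i).1, fun i => (x.2.2 i).2.1, fun i => (x.2.2 i).2.2⟩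
  left_inv _ := rfl
  right_inv _ := rfl

instance : Countable (Step T m k d) := (stepEquiv T m k d).injective.countable

/-- A finite set of steps, in coordinates, that carries the law `stepProb`. -/
def stepSupport (m k d : ℕ) (g : TypedGraph T) :
    Finset (Fin T × (Fin m → ℕ) × (Fin k → ℕ × (Fin d → ℕ) × ℕ)) :=
  Finset.univ ×ˢ (Fintype.piFinset fun _ => g.vertices) ×ˢ
    (Fintype.piFinset fun _ => pairSupport d g)

theorem stepProb_eq (c : Step T m k d) :
    stepProb β p g c = p c.type * (∏ l, choiceProb (g.weight β) g.vertices (c.target l))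
      * ∏ i, pairProb β g c.type (c.w i, c.y i, c.u i) := rfl

theorem y_mem {c : Step T m k d} (h : stepProb β p g c ≠ 0) (i : Fin k) (l : Fin d) :
    c.y i l ∈ Finset.Icc 1 (g.size + 1) := by
  unfold stepProb at h
  have h1 := Finset.prod_ne_zero_iff.1 (right_ne_zero_of_mul h) i (Finset.mem_univ _)
  have h2 := Finset.prod_ne_zero_iff.1 (right_ne_zero_of_mul (left_ne_zero_of_mul h1)) l
    (Finset.mem_univ _)
  exact subset_Icc_of_mem_candidates _ _ _ (mem_of_choiceProb_ne_zero h2)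

theorem mem_stepSupport {c : Step T m k d} (h : stepProb β p g c ≠ 0) :
    stepEquiv T m k d c ∈ stepSupport m k d g := by
  simp only [stepSupport, Finset.mem_product, Fintype.mem_piFinset, stepEquiv, Equiv.coe_fn_mk,
    pairSupport]
  exact ⟨Finset.mem_univ _, target_mem h, fun i => ⟨w_mem h i, y_mem h i, u_mem h i⟩⟩

/-- The mean of `f` over the choices made in the next step, given that the graph is `g`. -/
def stepMean (β : ℝ) (p : Fin T → ℝ) (g : TypedGraph T) (f : Step T m k d → ℝ) : ℝ :=
  ∑' c, stepProb β p g c * f c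

theorem finite_support_stepProb (β : ℝ) (p : Fin T → ℝ) (g : TypedGraph T) :
    (Function.support fun c : Step T m k d => stepProb β p g c).Finite := by
  refine Set.Finite.subset
    ((stepSupport m k d g).finite_toSet.preimage (stepEquiv T m k d).injective.injOn) ?_
  intro c hc
  exact mem_stepSupport hc

theorem summable_stepProb_mul (f : Step T m k d → ℝ) :
    Summable fun c => stepProb β p g c * f c := by
  refine summable_of_hasFiniteSupport ((finite_support_stepProb β p g).subset fun c hc => ?_)
  exact left_ne_zero_of_mul hc

theorem stepMean_add (f₁ f₂ : Step T m k d → ℝ) :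
    stepMean β p g (fun c => f₁ c + f₂ c) = stepMean β p g f₁ + stepMean β p g f₂ := by
  unfold stepMean
  rw [← (summable_stepProb_mul f₁).tsum_add (summable_stepProb_mul f₂)]
  simp only [mul_add]

theorem stepMean_const_mul (a : ℝ) (f : Step T m k d → ℝ) :
    stepMean β p g (fun c => a * f c) = a * stepMean β p g f := by
  unfold stepMean
  rw [← tsum_mul_left]
  congr 1
  ext c
  ring

theorem stepMean_sub (f₁ f₂ : Step T m k d → ℝ) :
    stepMean β p g (fun c => f₁ c - f₂ c) = stepMean β p g f₁ - stepMean β p g f₂ := by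
  unfold stepMean
  rw [← (summable_stepProb_mul f₁).tsum_sub (summable_stepProb_mul f₂)]
  simp only [mul_sub]

theorem stepMean_sum {ι : Type*} (s : Finset ι) (f : ι → Step T m k d → ℝ) :
    stepMean β p g (fun c => ∑ j ∈ s, f j c) = ∑ j ∈ s, stepMean β p g (f j) := by
  unfold stepMean
  rw [← Summable.tsum_finsetSum fun j _ => summable_stepProb_mul (f j)]
  simp only [Finset.mul_sum]

theorem stepProb_nonneg (hβ : -1 < β) (hp : ∀ i, 0 ≤ p i) (hg : g.Regular M)
    (c : Step T m k d) : 0 ≤ stepProb β p g c := by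
  rw [stepProb_eq]
  exact mul_nonneg (mul_nonneg (hp _)
    (Finset.prod_nonneg fun _ _ => choiceProb_nonneg (hg.weight_nonneg hβ) _ _))
    (Finset.prod_nonneg fun _ _ => pairProb_nonneg hβ hg _ _)

theorem stepMean_mono (hβ : -1 < β) (hp : ∀ i, 0 ≤ p i) (hg : g.Regular M)
    {f₁ f₂ : Step T m k d → ℝ} (h : ∀ c, f₁ c ≤ f₂ c) :
    stepMean β p g f₁ ≤ stepMean β p g f₂ :=
  (summable_stepProb_mul f₁).tsum_le_tsum
    (fun c => mul_le_mul_of_nonneg_left (h c) (stepProb_nonneg hβ hp hg c))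
    (summable_stepProb_mul f₂)

theorem stepMean_eq_sum (f : Step T m k d → ℝ) :
    stepMean β p g f = ∑ x, p x * ∑ t ∈ Fintype.piFinset (fun _ : Fin m => g.vertices),
      (∏ l, choiceProb (g.weight β) g.vertices (t l)) *
        ∑ r ∈ Fintype.piFinset (fun _ : Fin k => pairSupport d g), (∏ i, pairProb β g x (r i)) *
          f ((stepEquiv T m k d).symm (x, t, r)) := by
  unfold stepMean
  rw [← (stepEquiv T m k d).symm.tsum_eq, tsum_eq_sum (s := stepSupport m k d g)]
  · unfold stepSupport
    rw [Finset.sum_product]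
    refine Finset.sum_congr rfl fun x _ => ?_
    rw [Finset.sum_product, Finset.mul_sum]
    refine Finset.sum_congr rfl fun t _ => ?_
    rw [Finset.mul_sum, Finset.mul_sum]
    refine Finset.sum_congr rfl fun r _ => ?_
    rw [stepProb_eq]
    simp only [stepEquiv, Equiv.coe_fn_symm_mk]
    ring
  · intro b hb
    by_contra h
    refine hb ?_
    have := mem_stepSupport (left_ne_zero_of_mul h)
    rwa [Equiv.apply_symm_apply] at this

theorem stepMean_type (hβ : -1 < β) (hd : 0 < d) (hg : g.Regular M) (φ : Fin T → ℝ) :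
    stepMean β p g (fun c : Step T m k d => φ c.type) = ∑ x, p x * φ x := by
  rw [stepMean_eq_sum]
  refine Finset.sum_congr rfl fun x _ => ?_
  simp only [stepEquiv, Equiv.coe_fn_symm_mk]
  simp_rw [← Finset.sum_mul, sum_piFinset_one _ _ (sum_pairProb hβ hd hg x), one_mul]
  rw [sum_piFinset_one _ _ (sum_choiceProb_vertices hβ hg), one_mul]

theorem stepMean_const (hβ : -1 < β) (hd : 0 < d) (hp : ∑ x, p x = 1) (hg : g.Regular M)
    (a : ℝ) : stepMean β p g (fun _ : Step T m k d => a) = a := by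
  have := stepMean_type (m := m) (k := k) (p := p) hβ hd hg (fun _ => a)
  rw [this, ← Finset.sum_mul, hp, one_mul]

theorem stepMean_target (hβ : -1 < β) (hd : 0 < d) (hp : ∑ x, p x = 1) (hg : g.Regular M)
    (φ : ℕ → ℝ) (l : Fin m) :
    stepMean β p g (fun c : Step T m k d => φ (c.target l))
      = ∑ a ∈ g.vertices, choiceProb (g.weight β) g.vertices a * φ a := by
  rw [stepMean_eq_sum]
  simp only [stepEquiv, Equiv.coe_fn_symm_mk]
  simp_rw [← Finset.sum_mul, sum_piFinset_one _ _ (sum_pairProb hβ hd hg _), one_mul,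
    sum_piFinset_apply _ _ (sum_choiceProb_vertices hβ hg)]
  rw [← Finset.sum_mul, hp, one_mul]

theorem stepMean_pair (hβ : -1 < β) (hd : 0 < d) (hg : g.Regular M)
    (φ : ℕ × (Fin d → ℕ) × ℕ → ℝ) (i : Fin k) :
    stepMean β p g (fun c : Step T m k d => φ (c.w i, c.y i, c.u i))
      = ∑ x, p x * ∑ r ∈ pairSupport d g, pairProb β g x r * φ r := by
  rw [stepMean_eq_sum]
  simp only [stepEquiv, Equiv.coe_fn_symm_mk]
  refine Finset.sum_congr rfl fun x _ => ?_
  have h : ∀ r : Fin k → ℕ × (Fin d → ℕ) × ℕ,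
      φ ((r i).1, (r i).2.1, (r i).2.2) = φ (r i) := fun r => rfl
  simp_rw [h, sum_piFinset_apply _ _ (sum_pairProb hβ hd hg x)]
  rw [← Finset.sum_mul, sum_piFinset_one _ _ (sum_choiceProb_vertices hβ hg), one_mul]

/-- The end point of one edge of the vertex step may be averaged first. -/
theorem stepMean_resample_target (hβ : -1 < β) (hg : g.Regular M)
    (f : Step T m k d → ℝ) (l : Fin m) :
    stepMean β p g f = stepMean β p g fun c =>
      ∑ a ∈ g.vertices, choiceProb (g.weight β) g.vertices a *
        f { c with target := Function.update c.target l a } := by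
  rw [stepMean_eq_sum, stepMean_eq_sum]
  refine Finset.sum_congr rfl fun x _ => ?_
  rw [sum_piFinset_resample _ _ (sum_choiceProb_vertices hβ hg) _ l]
  congr 1
  refine Finset.sum_congr rfl fun t _ => ?_
  congr 1
  simp only [stepEquiv, Equiv.coe_fn_symm_mk, Finset.mul_sum]
  rw [Finset.sum_comm]
  refine Finset.sum_congr rfl fun r _ => Finset.sum_congr rfl fun a _ => ?_
  ring

end

/-! ### The choice of the second vertex of a pair -/

section

variable {T m k d : ℕ} {β : ℝ} {p : Fin T → ℝ} {g : TypedGraph T} {M : ℕ} {u v : ℕ}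

theorem pickProb_nonneg (hβ : -1 < β) (hg : g.Regular M) (E : Finset ℕ) (v : ℕ) :
    0 ≤ pickProb β d g E v :=
  Finset.sum_nonneg fun _ _ => mul_nonneg
    (Finset.prod_nonneg fun _ _ => choiceProb_nonneg (hg.weight_nonneg hβ) _ _)
    (uniformProb_nonneg _ _)

theorem pickProb_eq_zero {E : Finset ℕ} (hv : v ∉ E) : pickProb β d g E v = 0 := by
  refine Finset.sum_eq_zero fun y hy => ?_
  have : uniformProb (topOfSample g y) v = 0 := by
    by_contra h
    exact hv (topOfSample_subset hy (mem_of_uniformProb_ne_zero h))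
  rw [this, mul_zero]

theorem pickProb_candidates_le_one (hβ : -1 < β) (hg : g.Regular M) (x : Fin T) (w v : ℕ) :
    pickProb β d g (g.candidates x w) v ≤ 1 := by
  rw [← sum_piFinset_one (ι := Fin d) _ _ (sum_choiceProb_candidates hβ hg x w)]
  exact Finset.sum_le_sum fun y _ => mul_le_of_le_one_right
    (Finset.prod_nonneg fun _ _ => choiceProb_nonneg (hg.weight_nonneg hβ) _ _)
    (uniformProb_le_one _ _)

theorem choiceProb_eq_div {W : ℕ → ℝ} {E : Finset ℕ} (hE : 2 ≤ E.card) (hv : v ∈ E) :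
    choiceProb W E v = W v / ∑ a ∈ E, W a := by
  have : E ≠ {v} := by rintro rfl; simp at hE
  simp [choiceProb, this, hv]

theorem pow_mul_pickProb {E : Finset ℕ} (hE : 2 ≤ E.card) (hS : 0 < ∑ a ∈ E, g.weight β a) :
    (∑ a ∈ E, g.weight β a) ^ d * pickProb β d g E v
      = ∑ y ∈ Fintype.piFinset (fun _ : Fin d => E),
          (∏ l, g.weight β (y l)) * uniformProb (topOfSample g y) v := by
  unfold pickProb
  rw [Finset.mul_sum]
  refine Finset.sum_congr rfl fun y hy => ?_
  rw [Finset.prod_congr rfl fun l _ => choiceProb_eq_div hE (Fintype.mem_piFinset.1 hy l),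
    Finset.prod_div_distrib, Finset.prod_const, Finset.card_univ, Fintype.card_fin, ← mul_assoc,
    mul_div_cancel₀ _ (pow_ne_zero d hS.ne')]

theorem mem_topOfSample {y : Fin d → ℕ} :
    v ∈ topOfSample g y ↔ (∃ l, y l = v) ∧ ∀ l, g.deg (y l) ≤ g.deg v := by
  simp [topOfSample]

/-- Exchanging a vertex `u` that has the highest degree in a sample with a vertex `v` of at least
the same degree produces a sample of larger weight, in which `v` has the highest degree. -/
theorem sample_swap_le (hβ : -1 < β) (hg : g.Regular M) (hu : u ∈ g.vertices)
    (hv : v ∈ g.vertices) (huv : g.deg u ≤ g.deg v) (y : Fin d → ℕ) :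
    g.weight β v * ((∏ l, g.weight β (y l)) * uniformProb (topOfSample g y) u)
      ≤ g.weight β u * ((∏ l, g.weight β (Equiv.swap u v (y l))) *
          uniformProb (topOfSample g fun l => Equiv.swap u v (y l)) v) := by
  have hW := hg.weight_nonneg hβ
  by_cases htop : u ∈ topOfSample g y
  swap
  · have : uniformProb (topOfSample g y) u = 0 := if_neg htop
    rw [this, mul_zero, mul_zero]
    exact mul_nonneg (hW u) (mul_nonneg (Finset.prod_nonneg fun _ _ => hW _)
      (uniformProb_nonneg _ _))
  obtain ⟨⟨l₀, hl₀⟩, hmax⟩ := mem_topOfSample.1 htop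
  -- for equal degrees the exchange is a symmetry; otherwise the sample does not contain `v`
  rcases huv.eq_or_lt with heq | hlt
  · have hdeg : ∀ a, g.deg (Equiv.swap u v a) = g.deg a := by
      intro a
      by_cases h1 : a = u
      · rw [h1, Equiv.swap_apply_left, heq]
      · by_cases h2 : a = v
        · rw [h2, Equiv.swap_apply_right, heq]
        · rw [Equiv.swap_apply_of_ne_of_ne h1 h2]
    have hwt : ∀ a, g.weight β (Equiv.swap u v a) = g.weight β a := by
      intro a
      have : Equiv.swap u v a ∈ g.vertices ↔ a ∈ g.vertices := by
        by_cases h1 : a = u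
        · rw [h1, Equiv.swap_apply_left]; simp [hu, hv]
        · by_cases h2 : a = v
          · rw [h2, Equiv.swap_apply_right]; simp [hu, hv]
          · rw [Equiv.swap_apply_of_ne_of_ne h1 h2]
      simp [TypedGraph.weight, this, hdeg]
    have htop' : topOfSample g (fun l => Equiv.swap u v (y l))
        = (topOfSample g y).image (Equiv.swap u v) := by
      ext a
      rw [Finset.mem_image, mem_topOfSample]
      constructor
      · rintro ⟨⟨l, hl⟩, h⟩
        refine ⟨y l, mem_topOfSample.2 ⟨⟨l, rfl⟩, fun l' => ?_⟩, hl⟩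
        have := h l'
        rwa [hdeg, ← hl, hdeg] at this
      · rintro ⟨b, hb, rfl⟩
        obtain ⟨⟨l, rfl⟩, h⟩ := mem_topOfSample.1 hb
        refine ⟨⟨l, rfl⟩, fun l' => ?_⟩
        rw [hdeg, hdeg]
        exact h l'
    have hmem : v ∈ (topOfSample g y).image (Equiv.swap u v) :=
      Finset.mem_image.2 ⟨u, htop, Equiv.swap_apply_left u v⟩
    have hu' : g.weight β v = g.weight β u := by
      rw [← Equiv.swap_apply_left u v, hwt]
    rw [htop', uniformProb, uniformProb, if_pos htop, if_pos hmem,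
      Finset.card_image_of_injective _ (Equiv.swap u v).injective, hu']
    simp only [hwt]
    exact le_rfl
  · have hne : ∀ l, y l ≠ v := fun l h => by
      have := hmax l
      rw [h] at this
      omega
    have htop' : topOfSample g (fun l => Equiv.swap u v (y l)) = {v} := by
      ext a
      rw [Finset.mem_singleton, mem_topOfSample]
      constructor
      · rintro ⟨⟨l, hl⟩, h⟩
        by_contra hav
        have h1 := h l₀
        rw [hl₀, Equiv.swap_apply_left] at h1
        by_cases h2 : y l = u
        · rw [h2, Equiv.swap_apply_left] at hl
          exact hav hl.symm
        · rw [Equiv.swap_apply_of_ne_of_ne h2 (hne l)] at hl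
          have := hmax l
          rw [hl] at this
          omega
      · rintro rfl
        refine ⟨⟨l₀, by rw [hl₀, Equiv.swap_apply_left]⟩, fun l => ?_⟩
        by_cases h2 : y l = u
        · rw [h2, Equiv.swap_apply_left]
        · rw [Equiv.swap_apply_of_ne_of_ne h2 (hne l)]
          exact (hmax l).trans huv
    have hle : ∀ l, g.weight β (y l) ≤ g.weight β (Equiv.swap u v (y l)) := by
      intro l
      by_cases h2 : y l = u
      · rw [h2, Equiv.swap_apply_left, TypedGraph.weight_of_mem hu, TypedGraph.weight_of_mem hv]
        have : (g.deg u : ℝ) ≤ g.deg v := by exact_mod_cast huv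
        linarith
      · rw [Equiv.swap_apply_of_ne_of_ne h2 (hne l)]
    have h1 : uniformProb (topOfSample g fun l => Equiv.swap u v (y l)) v = 1 := by
      rw [htop']; simp [uniformProb]
    rw [h1, mul_one, ← Finset.mul_prod_erase Finset.univ _ (Finset.mem_univ l₀),
      ← Finset.mul_prod_erase Finset.univ (fun l => g.weight β (Equiv.swap u v (y l)))
        (Finset.mem_univ l₀), hl₀, Equiv.swap_apply_left]
    have h2 : ∏ l ∈ Finset.univ.erase l₀, g.weight β (y l)
        ≤ ∏ l ∈ Finset.univ.erase l₀, g.weight β (Equiv.swap u v (y l)) :=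
      Finset.prod_le_prod (fun _ _ => hW _) fun l _ => hle l
    calc g.weight β v * (g.weight β u * (∏ l ∈ Finset.univ.erase l₀, g.weight β (y l)) *
          uniformProb (topOfSample g y) u)
        ≤ g.weight β v * (g.weight β u * (∏ l ∈ Finset.univ.erase l₀, g.weight β (y l))) := by
          refine mul_le_mul_of_nonneg_left (mul_le_of_le_one_right ?_ (uniformProb_le_one _ _))
            (hW v)
          exact mul_nonneg (hW u) (Finset.prod_nonneg fun _ _ => hW _)
      _ = g.weight β u * (g.weight β v * ∏ l ∈ Finset.univ.erase l₀, g.weight β (y l)) := by ring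
      _ ≤ _ := mul_le_mul_of_nonneg_left (mul_le_mul_of_nonneg_left h2 (hW v)) (hW u)

/-- Of two vertices, the one of larger degree has the larger chance per unit of weight to be
picked, up to the normalisations of the two candidate sets. -/
theorem pickProb_swap_le (hβ : -1 < β) (hg : g.Regular M) (hu : u ∈ g.vertices)
    (hv : v ∈ g.vertices) (huv : g.deg u ≤ g.deg v) {E : Finset ℕ} (hE : 2 ≤ E.card)
    (huE : u ∈ E) :
    g.weight β v * ((∑ a ∈ E, g.weight β a) ^ d * pickProb β d g E u)
      ≤ g.weight β u * ((∑ a ∈ E.image (Equiv.swap u v), g.weight β a) ^ d *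
          pickProb β d g (E.image (Equiv.swap u v)) v) := by
  have hvF : v ∈ E.image (Equiv.swap u v) :=
    Finset.mem_image.2 ⟨u, huE, Equiv.swap_apply_left u v⟩
  have hF : 2 ≤ (E.image (Equiv.swap u v)).card := by
    rwa [Finset.card_image_of_injective _ (Equiv.swap u v).injective]
  rw [pow_mul_pickProb hE (sum_weight_pos hβ hg huE hu),
    pow_mul_pickProb hF (sum_weight_pos hβ hg hvF hv), Finset.mul_sum, Finset.mul_sum]
  have hre : ∀ f : (Fin d → ℕ) → ℝ,
      ∑ y ∈ Fintype.piFinset (fun _ : Fin d => E.image (Equiv.swap u v)), f y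
        = ∑ y ∈ Fintype.piFinset (fun _ : Fin d => E), f fun l => Equiv.swap u v (y l) := by
    intro f
    symm
    refine Finset.sum_nbij' (fun y l => Equiv.swap u v (y l)) (fun y l => Equiv.swap u v (y l))
      ?_ ?_ ?_ ?_ ?_
    · intro y hy
      exact Fintype.mem_piFinset.2 fun l =>
        Finset.mem_image_of_mem _ (Fintype.mem_piFinset.1 hy l)
    · intro y hy
      refine Fintype.mem_piFinset.2 fun l => ?_
      obtain ⟨a, ha, h⟩ := Finset.mem_image.1 (Fintype.mem_piFinset.1 hy l)
      rw [← h, Equiv.swap_apply_self]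
      exact ha
    · intro y _; simp
    · intro y _; simp
    · intro y _; rfl
  rw [hre]
  exact Finset.sum_le_sum fun y _ => sample_swap_le hβ hg hu hv huv y

/-- If both vertices are candidates, or neither is, then the one of larger degree has the larger
chance per unit of weight to be picked. -/
theorem weight_mul_pickProb_le (hβ : -1 < β) (hg : g.Regular M) (hu : u ∈ g.vertices)
    (hv : v ∈ g.vertices) (hne : u ≠ v) (huv : g.deg u ≤ g.deg v) {E : Finset ℕ}
    (hE : u ∈ E ↔ v ∈ E) :
    g.weight β v * pickProb β d g E u ≤ g.weight β u * pickProb β d g E v := by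
  by_cases huE : u ∈ E
  · have hvE := hE.1 huE
    have hcard : 2 ≤ E.card := by
      have : ({u, v} : Finset ℕ) ⊆ E := by
        intro a ha
        rcases Finset.mem_insert.1 ha with rfl | h
        · exact huE
        · rwa [Finset.mem_singleton.1 h]
      have := Finset.card_le_card this
      rwa [Finset.card_pair hne] at this
    have himg : E.image (Equiv.swap u v) = E := by
      refine Finset.eq_of_subset_of_card_le ?_
        (Finset.card_image_of_injective _ (Equiv.swap u v).injective).ge
      intro a ha
      obtain ⟨b, hb, rfl⟩ := Finset.mem_image.1 ha
      by_cases h1 : b = u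
      · rwa [h1, Equiv.swap_apply_left]
      · by_cases h2 : b = v
        · rwa [h2, Equiv.swap_apply_right]
        · rwa [Equiv.swap_apply_of_ne_of_ne h1 h2]
    have h := pickProb_swap_le (d := d) hβ hg hu hv huv hcard huE
    rw [himg] at h
    have hS : 0 < (∑ a ∈ E, g.weight β a) ^ d := pow_pos (sum_weight_pos hβ hg huE hu) d
    rw [mul_left_comm, mul_left_comm (g.weight β u)] at h
    exact le_of_mul_le_mul_left h hS
  · rw [pickProb_eq_zero huE, pickProb_eq_zero (fun h => huE (hE.2 h)), mul_zero, mul_zero]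

/-- A vertex is picked only if it occurs in the sample. -/
theorem pickProb_mul_sum_le (hβ : -1 < β) (hg : g.Regular M) {E : Finset ℕ}
    (hE : 2 ≤ E.card) (hS : 0 < ∑ a ∈ E, g.weight β a) (hv : v ∈ E) :
    pickProb β d g E v * ∑ a ∈ E, g.weight β a ≤ d * g.weight β v := by
  have hq : ∑ a ∈ E, choiceProb (g.weight β) E a = 1 :=
    sum_choiceProb ⟨v, hv⟩ fun _ => hS.ne'
  have h1 : pickProb β d g E v ≤ ∑ _l : Fin d, choiceProb (g.weight β) E v := by
    have h2 : ∀ l : Fin d, choiceProb (g.weight β) E v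
        = ∑ y ∈ Fintype.piFinset (fun _ : Fin d => E),
          (∏ l, choiceProb (g.weight β) E (y l)) * (if y l = v then 1 else 0) := by
      intro l
      rw [sum_piFinset_apply E _ hq (fun a => if a = v then 1 else 0) l]
      simp [hv]
    rw [Finset.sum_congr rfl fun l _ => h2 l, Finset.sum_comm]
    refine Finset.sum_le_sum fun y _ => ?_
    rw [← Finset.mul_sum]
    refine mul_le_mul_of_nonneg_left ?_
      (Finset.prod_nonneg fun _ _ => choiceProb_nonneg (hg.weight_nonneg hβ) _ _)
    by_cases h : v ∈ topOfSample g y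
    · obtain ⟨l, hl⟩ := mem_image_of_mem_topOfSample h
      refine (uniformProb_le_one _ _).trans ?_
      calc (1 : ℝ) = if y l = v then 1 else 0 := by simp [hl]
        _ ≤ _ := Finset.single_le_sum (f := fun l => if y l = v then (1 : ℝ) else 0)
            (fun l _ => by split_ifs <;> simp) (Finset.mem_univ l)
    · rw [uniformProb, if_neg h]
      exact Finset.sum_nonneg fun l _ => by split_ifs <;> simp
  rw [Finset.sum_const, Finset.card_univ, Fintype.card_fin, nsmul_eq_mul,
    choiceProb_eq_div hE hv] at h1
  calc _ ≤ (d * (g.weight β v / ∑ a ∈ E, g.weight β a)) * ∑ a ∈ E, g.weight β a :=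
        mul_le_mul_of_nonneg_right h1 hS.le
    _ = d * g.weight β v := by field_simp

theorem type_update_of_mem {x : Fin T} (hv : v ∈ g.vertices) :
    Function.update g.type (g.size + 1) x v = g.type v := by
  have := Finset.mem_Icc.1 hv
  exact Function.update_of_ne (by omega) _ _

theorem mem_Icc_of_mem_vertices (hv : v ∈ g.vertices) : v ∈ Finset.Icc 1 (g.size + 1) := by
  have := Finset.mem_Icc.1 hv
  exact Finset.mem_Icc.2 (by omega)

theorem mem_candidates_iff_of_type_eq (hu : u ∈ g.vertices) (hv : v ∈ g.vertices)
    (htype : g.type u = g.type v) (x : Fin T) {w : ℕ} (hwu : w ≠ u) (hwv : w ≠ v) :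
    u ∈ g.candidates x w ↔ v ∈ g.candidates x w := by
  have h1 := mem_Icc_of_mem_vertices hu
  have h2 := mem_Icc_of_mem_vertices hv
  unfold TypedGraph.candidates
  simp only
  split_ifs
  · simp only [Finset.mem_filter, Finset.mem_erase, type_update_of_mem hu, type_update_of_mem hv,
      htype, h1, h2, hwu.symm, hwv.symm, ne_eq, not_false_eq_true, true_and]
  · simp only [Finset.mem_erase, h1, h2, hwu.symm, hwv.symm, ne_eq, not_false_eq_true, true_and]

theorem candidates_eq_of_type_eq (hu : u ∈ g.vertices) (hv : v ∈ g.vertices)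
    (htype : g.type u = g.type v) (hne : u ≠ v) (x : Fin T) :
    g.candidates x v = ((Finset.Icc 1 (g.size + 1)).erase v).filter
      (fun a => Function.update g.type (g.size + 1) x a = g.type v) := by
  unfold TypedGraph.candidates
  simp only
  rw [type_update_of_mem hv, if_pos]
  exact ⟨u, by simp only [Finset.mem_filter, Finset.mem_erase, type_update_of_mem hu, htype,
    mem_Icc_of_mem_vertices hu, hne, ne_eq, not_false_eq_true, true_and]⟩

/-- The candidates for first vertex `u` arise from those for first vertex `v` by exchanging `u`
and `v`. -/
theorem image_swap_candidates (hu : u ∈ g.vertices) (hv : v ∈ g.vertices)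
    (htype : g.type u = g.type v) (hne : u ≠ v) (x : Fin T) :
    (g.candidates x v).image (Equiv.swap u v) = g.candidates x u := by
  have h1 := mem_Icc_of_mem_vertices hu
  have h2 := mem_Icc_of_mem_vertices hv
  rw [candidates_eq_of_type_eq hu hv htype hne, candidates_eq_of_type_eq hv hu htype.symm hne.symm]
  ext a
  simp only [Finset.mem_image, Finset.mem_filter, Finset.mem_erase]
  constructor
  · rintro ⟨b, ⟨⟨hbv, hb⟩, hbt⟩, rfl⟩
    by_cases h : b = u
    · rw [h, Equiv.swap_apply_left]
      exact ⟨⟨hne.symm, h2⟩, by rw [type_update_of_mem hv, htype]⟩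
    · rw [Equiv.swap_apply_of_ne_of_ne h hbv]
      exact ⟨⟨h, hb⟩, by rw [hbt, htype]⟩
  · rintro ⟨⟨hau, ha⟩, hat⟩
    refine ⟨Equiv.swap u v a, ?_, Equiv.swap_apply_self _ _ _⟩
    by_cases h : a = v
    · rw [h, Equiv.swap_apply_right]
      exact ⟨⟨hne, h1⟩, by rw [type_update_of_mem hu, htype]⟩
    · rw [Equiv.swap_apply_of_ne_of_ne hau h]
      exact ⟨⟨h, ha⟩, by rw [hat, htype]⟩

/-- A set of candidates that contains a vertex of type `i` contains all of them, except possibly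
the first vertex of the pair. -/
theorem verticesOfType_erase_subset {i : Fin T} (hv : v ∈ g.verticesOfType i) {x : Fin T} {w : ℕ}
    (h : v ∈ g.candidates x w) : (g.verticesOfType i).erase w ⊆ g.candidates x w := by
  intro a ha
  have hv' := Finset.mem_filter.1 hv
  have ha' := Finset.mem_filter.1 (Finset.mem_of_mem_erase ha)
  have haw := Finset.ne_of_mem_erase ha
  have h3 := mem_Icc_of_mem_vertices ha'.1
  unfold TypedGraph.candidates at h ⊢
  simp only at h ⊢
  split_ifs at h ⊢
  · simp only [Finset.mem_filter, Finset.mem_erase, type_update_of_mem hv'.1,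
      type_update_of_mem ha'.1, hv'.2, ha'.2] at h ⊢
    exact ⟨⟨haw, h3⟩, h.2⟩
  · exact Finset.mem_erase.2 ⟨haw, h3⟩

theorem card_mul_le_sum_candidates (hβ : -1 < β) (hg : g.Regular M) {i : Fin T}
    (hv : v ∈ g.verticesOfType i) {x : Fin T} {w : ℕ} (h : v ∈ g.candidates x w) :
    (((g.verticesOfType i).card : ℝ) - 1) * (1 + β) ≤ ∑ a ∈ g.candidates x w, g.weight β a := by
  have hsub : (g.verticesOfType i).erase w ⊆ g.vertices :=
    (Finset.erase_subset _ _).trans (Finset.filter_subset _ _)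
  have h1 := hg.card_mul_le_sum_weight (β := β) hsub
  have h2 : ∑ a ∈ (g.verticesOfType i).erase w, g.weight β a
      ≤ ∑ a ∈ g.candidates x w, g.weight β a :=
    Finset.sum_le_sum_of_subset_of_nonneg (verticesOfType_erase_subset hv h)
      fun a _ _ => hg.weight_nonneg hβ a
  have h3 : ((g.verticesOfType i).card : ℝ) - 1 ≤ ((g.verticesOfType i).erase w).card := by
    have := Finset.pred_card_le_card_erase (s := g.verticesOfType i) (a := w)
    have h4 : (g.verticesOfType i).card ≤ ((g.verticesOfType i).erase w).card + 1 := by omega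
    have : ((g.verticesOfType i).card : ℝ) ≤ ((g.verticesOfType i).erase w).card + 1 := by
      exact_mod_cast h4
    linarith
  exact (mul_le_mul_of_nonneg_right h3 (by linarith)).trans (h1.trans h2)

theorem two_le_card_candidates {i : Fin T} (hv : v ∈ g.verticesOfType i) {x : Fin T} {w : ℕ}
    (h : v ∈ g.candidates x w) (hcard : 3 ≤ (g.verticesOfType i).card) :
    2 ≤ (g.candidates x w).card := by
  have h1 := Finset.card_le_card (verticesOfType_erase_subset hv h)
  have h2 := Finset.pred_card_le_card_erase (s := g.verticesOfType i) (a := w)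
  omega

theorem pickProb_candidates_mul_le (hβ : -1 < β) (hg : g.Regular M) {i : Fin T}
    (hv : v ∈ g.verticesOfType i) (hcard : 3 ≤ (g.verticesOfType i).card) (x : Fin T) (w : ℕ) :
    pickProb β d g (g.candidates x w) v * ((((g.verticesOfType i).card : ℝ) - 1) * (1 + β))
      ≤ d * g.weight β v := by
  by_cases h : v ∈ g.candidates x w
  · have hv' := (Finset.mem_filter.1 hv).1
    exact (mul_le_mul_of_nonneg_left (card_mul_le_sum_candidates hβ hg hv h)
      (pickProb_nonneg hβ hg _ _)).trans (pickProb_mul_sum_le hβ hg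
        (two_le_card_candidates hv h hcard) (sum_weight_pos hβ hg h hv') h)
  · rw [pickProb_eq_zero h, zero_mul]
    exact mul_nonneg (Nat.cast_nonneg d) (hg.weight_nonneg hβ v)

/-- The arithmetic behind `pickProb_candidates_swap_le`: by Bernoulli's inequality the change of the
normalisation from `SE` to `SF` costs at most a multiple of `b - a`. -/
theorem add_mul_le_of_pow_mul_le {a b s SE SF PE PF : ℝ} (ha : 0 < a) (hab : a ≤ b)
    (hSE0 : 0 < SE) (hSF : SF = SE + (b - a)) (hbF : b ≤ SF) (hs0 : 0 ≤ s) (hsF : s ≤ SF)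
    (hPE0 : 0 ≤ PE) (hPE1 : PE ≤ 1)
    (h : b * (SE ^ d * PE) ≤ a * (SF ^ d * PF)) :
    (a + s) * PE ≤ (a + s) * PF + 2 * d * (b - a) := by
  have hSF0 : 0 < SF := by linarith
  have h1 : SE ^ d * PE ≤ SF ^ d * PF := by
    refine le_of_mul_le_mul_left ?_ ha
    exact (mul_le_mul_of_nonneg_right hab (by positivity)).trans h
  set t := (b - a) / SF with ht
  have ht0 : 0 ≤ t := div_nonneg (by linarith) hSF0.le
  have ht1 : t ≤ 1 := by
    rw [ht, div_le_one hSF0]; linarith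
  have htF : t * SF = b - a := div_mul_cancel₀ _ hSF0.ne'
  have h2 : 1 - d * t ≤ (SE / SF) ^ d := by
    have h3 : SE / SF = 1 + -t := by
      rw [div_eq_iff hSF0.ne']
      linarith
    rw [h3]
    have := one_add_mul_le_pow (a := -t) (by linarith) d
    linarith
  have h5 : (1 - d * t) * PE ≤ PF := by
    refine (mul_le_mul_of_nonneg_right h2 hPE0).trans ?_
    rw [div_pow, div_mul_eq_mul_div, div_le_iff₀ (pow_pos hSF0 d)]
    linarith
  have h6 : (a + s) * t ≤ 2 * (b - a) := by
    rw [← htF]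
    have := mul_le_mul_of_nonneg_right (show a + s ≤ 2 * SF by linarith) ht0
    linarith
  have hd0 : (0 : ℝ) ≤ d := Nat.cast_nonneg d
  have h7 := mul_le_mul_of_nonneg_left h5 (show 0 ≤ a + s by linarith)
  have h8 : PE * ((a + s) * t) ≤ (a + s) * t :=
    mul_le_of_le_one_left (mul_nonneg (by linarith) ht0) hPE1
  have h10 := mul_le_mul_of_nonneg_left (h8.trans h6) hd0
  have h11 : (a + s) * ((1 - d * t) * PE) = (a + s) * PE - d * (PE * ((a + s) * t)) := by ring
  linarith

/-- The probability that `v` is picked when `u` is the first vertex of the pair is, up to a small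
error, at least the probability that `u` is picked when `v` is the first vertex. -/
theorem pickProb_candidates_swap_le (hβ : -1 < β) (hg : g.Regular M) {i : Fin T}
    (hu : u ∈ g.verticesOfType i) (hv : v ∈ g.verticesOfType i) (hne : u ≠ v)
    (huv : g.deg u ≤ g.deg v) (hcard : 3 ≤ (g.verticesOfType i).card) (x : Fin T) {s : ℝ}
    (hs0 : 0 ≤ s) (hs : s ≤ ((g.verticesOfType i).card - 1 : ℝ) * (1 + β)) :
    (g.weight β u + s) * pickProb β d g (g.candidates x v) u
      ≤ (g.weight β u + s) * pickProb β d g (g.candidates x u) v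
        + 2 * d * (g.weight β v - g.weight β u) := by
  have hu' := Finset.mem_filter.1 hu
  have hv' := Finset.mem_filter.1 hv
  have htype : g.type u = g.type v := hu'.2.trans hv'.2.symm
  have huE : u ∈ g.candidates x v := by
    rw [candidates_eq_of_type_eq hu'.1 hv'.1 htype hne]
    simp only [Finset.mem_filter, Finset.mem_erase, type_update_of_mem hu'.1, htype,
      mem_Icc_of_mem_vertices hu'.1, hne, ne_eq, not_false_eq_true, true_and]
  have hvF : v ∈ g.candidates x u := by
    rw [candidates_eq_of_type_eq hv'.1 hu'.1 htype.symm hne.symm]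
    simp only [Finset.mem_filter, Finset.mem_erase, type_update_of_mem hv'.1, htype,
      mem_Icc_of_mem_vertices hv'.1, hne.symm, ne_eq, not_false_eq_true, true_and]
  have h := pickProb_swap_le (d := d) hβ hg hu'.1 hv'.1 huv
    (two_le_card_candidates hu huE hcard) huE
  have hSF : ∑ a ∈ g.candidates x u, g.weight β a
      = ∑ a ∈ g.candidates x v, g.weight β a + (g.weight β v - g.weight β u) := by
    rw [← image_swap_candidates hu'.1 hv'.1 htype hne x,
      Finset.sum_image (Equiv.swap u v).injective.injOn,
      ← Finset.add_sum_erase _ _ huE, ← Finset.add_sum_erase _ (g.weight β) huE,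
      Equiv.swap_apply_left]
    have : ∑ a ∈ (g.candidates x v).erase u, g.weight β (Equiv.swap u v a)
        = ∑ a ∈ (g.candidates x v).erase u, g.weight β a := by
      refine Finset.sum_congr rfl fun a ha => ?_
      rw [Equiv.swap_apply_of_ne_of_ne (Finset.ne_of_mem_erase ha)]
      exact Finset.ne_of_mem_erase (g.candidates_subset x v (Finset.mem_of_mem_erase ha))
    rw [this]
    ring
  rw [image_swap_candidates hu'.1 hv'.1 htype hne x] at h
  have hSE0 := sum_weight_pos hβ hg huE hu'.1
  have hSF0 := sum_weight_pos hβ hg hvF hv'.1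
  have hsF : s ≤ ∑ a ∈ g.candidates x u, g.weight β a :=
    hs.trans (card_mul_le_sum_candidates hβ hg hv hvF)
  have hWvF : g.weight β v ≤ ∑ a ∈ g.candidates x u, g.weight β a :=
    Finset.single_le_sum (f := g.weight β) (fun a _ => hg.weight_nonneg hβ a) hvF
  have hWu := hg.weight_pos hβ hu'.1
  have hWuv : g.weight β u ≤ g.weight β v := by
    rw [TypedGraph.weight_of_mem hu'.1, TypedGraph.weight_of_mem hv'.1]
    have : (g.deg u : ℝ) ≤ g.deg v := by exact_mod_cast huv
    linarith
  exact add_mul_le_of_pow_mul_le hWu hWuv hSE0 hSF hWvF hs0 hsF (pickProb_nonneg hβ hg _ _)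
    (pickProb_candidates_le_one hβ hg _ _ _) h

end

/-! ### Mean growth of the degrees -/

section

variable {T m k d : ℕ} {β : ℝ} {p : Fin T → ℝ} {g : TypedGraph T} {M : ℕ} {u v : ℕ}

/-- The sum of the weights of all vertices. -/
def totalWeight (β : ℝ) (g : TypedGraph T) : ℝ := ∑ a ∈ g.vertices, g.weight β a

/-- Probability that a given one of the `k` pairs has second vertex `v`. -/
def secondProb (β : ℝ) (p : Fin T → ℝ) (d : ℕ) (g : TypedGraph T) (v : ℕ) : ℝ :=
  ∑ x, p x * ∑ w ∈ Finset.Icc 1 (g.size + 1), 1 / ((g.size : ℝ) + 1) *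
    pickProb β d g (g.candidates x w) v

/-- Probability that a given one of the `k` pairs has second vertex `a` and a first vertex other
than `u` and `v`. -/
def outerProb (β : ℝ) (p : Fin T → ℝ) (d : ℕ) (g : TypedGraph T) (u v a : ℕ) : ℝ :=
  ∑ x, p x * ∑ w ∈ ((Finset.Icc 1 (g.size + 1)).erase u).erase v, 1 / ((g.size : ℝ) + 1) *
    pickProb β d g (g.candidates x w) a

/-- Conditional probability that the second vertex of a pair is `v` if the first one is `u`. -/
def innerProb (β : ℝ) (p : Fin T → ℝ) (d : ℕ) (g : TypedGraph T) (u v : ℕ) : ℝ :=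
  ∑ x, p x * pickProb β d g (g.candidates x u) v

theorem uniformProb_Icc {w : ℕ} (hw : w ∈ Finset.Icc 1 (g.size + 1)) :
    uniformProb (Finset.Icc 1 (g.size + 1)) w = 1 / ((g.size : ℝ) + 1) := by
  rw [uniformProb, if_pos hw]
  simp

theorem totalWeight_pos (hβ : -1 < β) (hg : g.Regular M) : 0 < totalWeight β g := by
  have h1 : 1 ∈ g.vertices := Finset.mem_Icc.2 ⟨le_rfl, by have := hg.two_le_size; omega⟩
  exact sum_weight_pos hβ hg h1 h1

theorem two_le_card_vertices (hg : g.Regular M) : 2 ≤ g.vertices.card := by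
  simpa [TypedGraph.vertices] using hg.two_le_size

theorem stepMean_incr (hβ : -1 < β) (hd : 0 < d) (hp : ∑ x, p x = 1) (hg : g.Regular M)
    (hv : v ∈ g.vertices) :
    stepMean β p g (fun c : Step T m k d => (g.incr c v : ℝ))
      = m / totalWeight β g * g.weight β v + k / ((g.size : ℝ) + 1) + k * secondProb β p d g v := by
  simp_rw [TypedGraph.incr_eq_of_mem _ hv]
  have hv' := mem_Icc_of_mem_vertices hv
  rw [stepMean_add, stepMean_sum, stepMean_sum]
  have h1 : ∀ l : Fin m, stepMean β p g
      (fun c : Step T m k d => if c.target l = v then (1 : ℝ) else 0)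
        = g.weight β v / totalWeight β g := by
    intro l
    rw [stepMean_target hβ hd hp hg (fun a => if a = v then (1 : ℝ) else 0) l]
    simp only [mul_ite, mul_one, mul_zero]
    rw [Finset.sum_ite_eq', if_pos hv, choiceProb_eq_div (two_le_card_vertices hg) hv]
    rfl
  have h2 : ∀ i : Fin k, stepMean β p g
      (fun c : Step T m k d => (if c.w i = v then (1 : ℝ) else 0) + if c.u i = v then 1 else 0)
        = 1 / ((g.size : ℝ) + 1) + secondProb β p d g v := by
    intro i
    rw [stepMean_add, stepMean_pair hβ hd hg (fun r => if r.1 = v then (1 : ℝ) else 0) i,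
      stepMean_pair hβ hd hg (fun r => if r.2.2 = v then (1 : ℝ) else 0) i]
    congr 1
    · simp_rw [sum_pairProb_fst hβ hd hg _ (fun w => if w = v then (1 : ℝ) else 0)]
      simp only [mul_ite, mul_one, mul_zero]
      rw [Finset.sum_ite_eq', if_pos hv', ← Finset.sum_mul, hp, one_mul, uniformProb_Icc hv']
    · unfold secondProb
      refine Finset.sum_congr rfl fun x _ => ?_
      rw [sum_pairProb_snd x v hv']
      congr 1
      exact Finset.sum_congr rfl fun w hw => by rw [uniformProb_Icc hw]
  rw [Finset.sum_congr rfl fun l _ => h1 l, Finset.sum_congr rfl fun i _ => h2 i]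
  simp only [Finset.sum_const, Finset.card_univ, Fintype.card_fin, nsmul_eq_mul]
  ring

theorem secondProb_nonneg (hβ : -1 < β) (hp : ∀ i, 0 ≤ p i) (hg : g.Regular M) (v : ℕ) :
    0 ≤ secondProb β p d g v :=
  Finset.sum_nonneg fun x _ => mul_nonneg (hp x) (Finset.sum_nonneg fun w _ =>
    mul_nonneg (by positivity) (pickProb_nonneg hβ hg _ _))

theorem outerProb_nonneg (hβ : -1 < β) (hp : ∀ i, 0 ≤ p i) (hg : g.Regular M) (a : ℕ) :
    0 ≤ outerProb β p d g u v a :=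
  Finset.sum_nonneg fun x _ => mul_nonneg (hp x) (Finset.sum_nonneg fun w _ =>
    mul_nonneg (by positivity) (pickProb_nonneg hβ hg _ _))

theorem innerProb_nonneg (hβ : -1 < β) (hp : ∀ i, 0 ≤ p i) (hg : g.Regular M) :
    0 ≤ innerProb β p d g u v :=
  Finset.sum_nonneg fun x _ => mul_nonneg (hp x) (pickProb_nonneg hβ hg _ _)

theorem innerProb_le_one (hβ : -1 < β) (hp : ∀ i, 0 ≤ p i) (hp1 : ∑ x, p x = 1)
    (hg : g.Regular M) : innerProb β p d g u v ≤ 1 := by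
  rw [← hp1]
  exact Finset.sum_le_sum fun x _ =>
    mul_le_of_le_one_right (hp x) (pickProb_candidates_le_one hβ hg _ _ _)

/-- Splitting according to the first vertex of the pair, which cannot be `v` itself. -/
theorem secondProb_eq (hu : u ∈ g.vertices) (hv : v ∈ g.vertices) (hne : u ≠ v) :
    secondProb β p d g v
      = outerProb β p d g u v v + 1 / ((g.size : ℝ) + 1) * innerProb β p d g u v := by
  unfold secondProb outerProb innerProb
  rw [Finset.mul_sum, ← Finset.sum_add_distrib]
  refine Finset.sum_congr rfl fun x _ => ?_
  have h1 : v ∈ (Finset.Icc 1 (g.size + 1)).erase u :=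
    Finset.mem_erase.2 ⟨hne.symm, mem_Icc_of_mem_vertices hv⟩
  rw [← Finset.add_sum_erase _ _ (mem_Icc_of_mem_vertices hu), ← Finset.add_sum_erase _ _ h1]
  have h2 : pickProb β d g (g.candidates x v) v = 0 :=
    pickProb_eq_zero fun h => Finset.ne_of_mem_erase (g.candidates_subset x v h) rfl
  rw [h2]
  ring

theorem outerProb_comm (a : ℕ) : outerProb β p d g u v a = outerProb β p d g v u a := by
  unfold outerProb
  rw [Finset.erase_right_comm]

theorem weight_mul_outerProb_le (hβ : -1 < β) (hp : ∀ i, 0 ≤ p i) (hg : g.Regular M)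
    (hu : u ∈ g.vertices) (hv : v ∈ g.vertices) (htype : g.type u = g.type v) (hne : u ≠ v)
    (huv : g.deg u ≤ g.deg v) :
    g.weight β v * outerProb β p d g u v u ≤ g.weight β u * outerProb β p d g u v v := by
  unfold outerProb
  simp only [Finset.mul_sum]
  refine Finset.sum_le_sum fun x _ => Finset.sum_le_sum fun w hw => ?_
  have hwv := Finset.ne_of_mem_erase hw
  have hwu := Finset.ne_of_mem_erase (Finset.mem_of_mem_erase hw)
  have h := weight_mul_pickProb_le (d := d) hβ hg hu hv hne huv
    (mem_candidates_iff_of_type_eq hu hv htype x hwu hwv)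
  have h2 : 0 ≤ p x * (1 / ((g.size : ℝ) + 1)) := mul_nonneg (hp x) (by positivity)
  have := mul_le_mul_of_nonneg_left h h2
  linarith

theorem secondProb_mul_le (hβ : -1 < β) (hp : ∀ i, 0 ≤ p i) (hp1 : ∑ x, p x = 1)
    (hg : g.Regular M) {i : Fin T} (hv : v ∈ g.verticesOfType i)
    (hcard : 3 ≤ (g.verticesOfType i).card) :
    secondProb β p d g v * ((((g.verticesOfType i).card : ℝ) - 1) * (1 + β))
      ≤ d * g.weight β v := by
  have hN : (0 : ℝ) < (g.size : ℝ) + 1 := by positivity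
  have h : ∀ x, (∑ w ∈ Finset.Icc 1 (g.size + 1), 1 / ((g.size : ℝ) + 1) *
      pickProb β d g (g.candidates x w) v) * ((((g.verticesOfType i).card : ℝ) - 1) * (1 + β))
        ≤ d * g.weight β v := by
    intro x
    rw [Finset.sum_mul]
    calc _ ≤ ∑ _w ∈ Finset.Icc 1 (g.size + 1), 1 / ((g.size : ℝ) + 1) * (d * g.weight β v) :=
          Finset.sum_le_sum fun w _ => by
            rw [mul_assoc]
            exact mul_le_mul_of_nonneg_left (pickProb_candidates_mul_le hβ hg hv hcard x w)
              (by positivity)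
      _ = d * g.weight β v := by
          rw [Finset.sum_const, Nat.card_Icc, nsmul_eq_mul]
          push_cast
          field_simp
  unfold secondProb
  rw [Finset.sum_mul]
  calc _ ≤ ∑ x, p x * (d * g.weight β v) := Finset.sum_le_sum fun x _ => by
          rw [mul_assoc]
          exact mul_le_mul_of_nonneg_left (h x) (hp x)
    _ = d * g.weight β v := by rw [← Finset.sum_mul, hp1, one_mul]

theorem innerProb_swap_le (hβ : -1 < β) (hp : ∀ i, 0 ≤ p i) (hp1 : ∑ x, p x = 1)
    (hg : g.Regular M) {i : Fin T}
    (hu : u ∈ g.verticesOfType i) (hv : v ∈ g.verticesOfType i) (hne : u ≠ v)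
    (huv : g.deg u ≤ g.deg v) (hcard : 3 ≤ (g.verticesOfType i).card) {s : ℝ} (hs0 : 0 ≤ s)
    (hs : s ≤ ((g.verticesOfType i).card - 1 : ℝ) * (1 + β)) :
    (g.weight β u + s) * innerProb β p d g v u
      ≤ (g.weight β u + s) * innerProb β p d g u v
        + 2 * d * (g.weight β v - g.weight β u) := by
  have h : (2 * d * (g.weight β v - g.weight β u) : ℝ)
      = ∑ x, p x * (2 * d * (g.weight β v - g.weight β u)) := by
    rw [← Finset.sum_mul, hp1, one_mul]
  unfold innerProb
  rw [h, Finset.mul_sum, Finset.mul_sum, ← Finset.sum_add_distrib]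
  refine Finset.sum_le_sum fun x _ => ?_
  have := mul_le_mul_of_nonneg_left
    (pickProb_candidates_swap_le (d := d) hβ hg hu hv hne huv hcard x hs0 hs) (hp x)
  linarith

/-- The total weight of a regular graph is at most this constant times its number of vertices. -/
def weightBound (β : ℝ) (m k : ℕ) : ℝ := 2 * ((m + k : ℕ) : ℝ) + |β|

theorem weightBound_pos (hm : 1 ≤ m) : 0 < weightBound β m k := by
  have : (1 : ℝ) ≤ ((m + k : ℕ) : ℝ) := by exact_mod_cast (by omega : 1 ≤ m + k)
  have := abs_nonneg β
  unfold weightBound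
  linarith

theorem totalWeight_le (hg : g.Regular (m + k)) :
    totalWeight β g ≤ weightBound β m k * g.size := hg.sum_weight_le

theorem size_pos (hg : g.Regular M) : (0 : ℝ) < g.size := by
  exact_mod_cast (by have := hg.two_le_size; omega : 0 < g.size)

theorem le_totalWeight (hg : g.Regular M) : g.size * (1 + β) ≤ totalWeight β g := by
  have := hg.card_mul_le_sum_weight (β := β) (Finset.Subset.refl g.vertices)
  simpa [TypedGraph.vertices, totalWeight] using this

theorem div_weightBound_le (hβ : -1 < β) (hg : g.Regular (m + k)) :
    1 / (weightBound β m k * g.size) ≤ 1 / totalWeight β g :=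
  one_div_le_one_div_of_le (totalWeight_pos hβ hg) (totalWeight_le hg)

/-- The rate at which a vertex is the first vertex of a pair, relative to the rate per unit of
weight at which it is chosen in the vertex step. -/
theorem pair_rate_le (hβ : -1 < β) (hm : 1 ≤ m) (hg : g.Regular (m + k)) :
    k / ((g.size : ℝ) + 1) ≤ k * weightBound β m k / m * (m / totalWeight β g) := by
  have hN := size_pos hg
  have hW := totalWeight_pos hβ hg
  have hm' : (0 : ℝ) < m := by exact_mod_cast hm
  have h1 : k * weightBound β m k / m * (m / totalWeight β g)
      = k * (weightBound β m k / totalWeight β g) := by field_simp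
  rw [h1, div_eq_mul_one_div]
  refine mul_le_mul_of_nonneg_left ?_ (Nat.cast_nonneg k)
  rw [div_le_div_iff₀ (by linarith) hW, one_mul]
  have := totalWeight_le (β := β) hg
  have := (weightBound_pos (β := β) (k := k) hm).le
  nlinarith

theorem le_stepMean_incr (hβ : -1 < β) (hd : 0 < d) (hp : ∀ i, 0 ≤ p i)
    (hp1 : ∑ x, p x = 1) (hg : g.Regular (m + k)) (hv : v ∈ g.vertices) :
    m * g.weight β v / (weightBound β m k * g.size)
      ≤ stepMean β p g (fun c : Step T m k d => (g.incr c v : ℝ)) := by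
  rw [stepMean_incr hβ hd hp1 hg hv]
  have h1 := mul_le_mul_of_nonneg_left (div_weightBound_le hβ hg)
    (mul_nonneg (Nat.cast_nonneg m) (hg.weight_nonneg hβ v))
  have h2 := mul_nonneg (Nat.cast_nonneg k : (0 : ℝ) ≤ k)
    (secondProb_nonneg (d := d) hβ hp hg v)
  have h3 : (0 : ℝ) ≤ k / ((g.size : ℝ) + 1) := by positivity
  have e1 : m * g.weight β v * (1 / totalWeight β g)
      = m / totalWeight β g * g.weight β v := by ring
  have e2 : m * g.weight β v * (1 / (weightBound β m k * g.size))
      = m * g.weight β v / (weightBound β m k * g.size) := by ring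
  linarith

/-- If the degree of `v` is much larger than that of `u`, then the relative growth rate of `v` is
larger than that of `u`, even with a margin `r` in the shifts. -/
theorem stepMean_incr_mul_le_of_two_mul_le (hβ : -1 < β) (hm : 1 ≤ m) (hd : 0 < d)
    (hp : ∀ i, 0 ≤ p i) (hp1 : ∑ x, p x = 1) (hg : g.Regular (m + k))
    (hu : u ∈ g.vertices) (hv : v ∈ g.vertices) (htype : g.type u = g.type v) (hne : u ≠ v)
    {s r : ℝ} (hr : 0 ≤ r) (hs : 3 * r + 4 * (k * weightBound β m k / m) ≤ s)
    (h2 : 2 * (g.weight β u + s) ≤ g.weight β v + s) :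
    stepMean β p g (fun c : Step T m k d => (g.incr c u : ℝ)) * (g.weight β v + s + r)
      ≤ stepMean β p g (fun c : Step T m k d => (g.incr c v : ℝ)) * (g.weight β u + s - r) := by
  have ha := hg.weight_pos hβ hv
  have hb := hg.weight_pos hβ hu
  have hm' : (0 : ℝ) < m := by exact_mod_cast hm
  have hC := weightBound_pos (β := β) (k := k) hm
  have hk' : (0 : ℝ) ≤ k := Nat.cast_nonneg k
  have hc0 : 0 ≤ k * weightBound β m k / m := by positivity
  have huv : g.deg u ≤ g.deg v := by
    have h : g.weight β u ≤ g.weight β v := by linarith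
    rw [TypedGraph.weight_of_mem hu, TypedGraph.weight_of_mem hv] at h
    exact_mod_cast (by linarith : (g.deg u : ℝ) ≤ g.deg v)
  have hO := weight_mul_outerProb_le (d := d) hβ hp hg hu hv htype hne huv
  have hOv := outerProb_nonneg (d := d) (u := u) (v := v) hβ hp hg v
  have hYu := innerProb_le_one (d := d) (u := v) (v := u) hβ hp hp1 hg
  have hYv := innerProb_nonneg (d := d) (u := u) (v := v) hβ hp hg
  have hγ := pair_rate_le hβ hm hg
  have hρ : 0 < m / totalWeight β g := div_pos hm' (totalWeight_pos hβ hg)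
  have hγ0 : (0 : ℝ) ≤ k / ((g.size : ℝ) + 1) := by positivity
  rw [stepMean_incr hβ hd hp1 hg hu, stepMean_incr hβ hd hp1 hg hv, secondProb_eq hu hv hne,
    secondProb_eq hv hu hne.symm, outerProb_comm (u := v) (v := u)]
  set a := g.weight β v
  set b := g.weight β u
  set ρ := m / totalWeight β g
  set c₀ := k * weightBound β m k / m
  set Ou := outerProb β p d g u v u
  set Ov := outerProb β p d g u v v
  have e : ∀ O Y : ℝ, (k : ℝ) * (O + 1 / ((g.size : ℝ) + 1) * Y)
      = k * O + k / ((g.size : ℝ) + 1) * Y := fun O Y => by ring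
  rw [e, e]
  set γ := (k : ℝ) / ((g.size : ℝ) + 1)
  have t1 : γ + γ * innerProb β p d g v u ≤ 2 * c₀ * ρ := by
    have := mul_le_mul_of_nonneg_left hYu hγ0
    linarith
  have t2 : 0 ≤ γ + γ * innerProb β p d g u v := by positivity
  have t3 : Ou * (a + s + r) ≤ Ov * (b + s - r) := by
    refine le_of_mul_le_mul_left ?_ ha
    have q1 : b * (a + s + r) ≤ a * (b + s - r) := by nlinarith
    have q2 := mul_le_mul_of_nonneg_right hO (by linarith : 0 ≤ a + s + r)
    have q3 := mul_le_mul_of_nonneg_left q1 hOv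
    linarith
  have t4 : (b + 2 * c₀) * (a + s + r) ≤ a * (b + s - r) := by
    have q1 : (2 * b + s) * (s - r - 2 * c₀) ≤ a * (s - r - 2 * c₀) :=
      mul_le_mul_of_nonneg_right (by linarith) (by linarith)
    have q2 : b * (s + r) ≤ 2 * b * (s - r - 2 * c₀) := by nlinarith
    have q3 : 2 * c₀ * (s + r) ≤ s * (s - r - 2 * c₀) := by nlinarith
    nlinarith
  have t5 := mul_le_mul_of_nonneg_left t4 hρ.le
  have t6 := mul_le_mul_of_nonneg_right t1 (by linarith : 0 ≤ a + s + r)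
  have t7 := mul_nonneg t2 (by linarith : 0 ≤ b + s - r)
  have t8 := mul_le_mul_of_nonneg_left t3 hk'
  linarith

/-- Of two vertices of the same type, the one of larger degree has the larger relative growth
rate, once degrees are shifted by a suitable constant and there are enough vertices of that
type. -/
theorem stepMean_incr_mul_le (hβ : -1 < β) (hm : 1 ≤ m) (hd : 0 < d)
    (hp : ∀ i, 0 ≤ p i) (hp1 : ∑ x, p x = 1) (hg : g.Regular (m + k)) {i : Fin T}
    (hu : u ∈ g.verticesOfType i) (hv : v ∈ g.verticesOfType i) (hne : u ≠ v)
    (huv : g.deg u ≤ g.deg v) (hcard : 3 ≤ (g.verticesOfType i).card) {s : ℝ}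
    (hs0 : (2 * d + 2) * (k * weightBound β m k / m) ≤ s)
    (hs : s ≤ ((g.verticesOfType i).card - 1 : ℝ) * (1 + β)) :
    stepMean β p g (fun c : Step T m k d => (g.incr c u : ℝ)) * (g.weight β v + s)
      ≤ stepMean β p g (fun c : Step T m k d => (g.incr c v : ℝ)) * (g.weight β u + s) := by
  have hu' := Finset.mem_filter.1 hu
  have hv' := Finset.mem_filter.1 hv
  have ha := hg.weight_pos hβ hv'.1
  have hb := hg.weight_pos hβ hu'.1
  have hm' : (0 : ℝ) < m := by exact_mod_cast hm
  have hC := weightBound_pos (β := β) (k := k) hm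
  have hk' : (0 : ℝ) ≤ k := Nat.cast_nonneg k
  have hc0 : 0 ≤ k * weightBound β m k / m := by positivity
  have hs1 : 0 ≤ s := le_trans (by positivity) hs0
  have hab : g.weight β u ≤ g.weight β v := by
    rw [TypedGraph.weight_of_mem hu'.1, TypedGraph.weight_of_mem hv'.1]
    have : (g.deg u : ℝ) ≤ g.deg v := by exact_mod_cast huv
    linarith
  have hO := weight_mul_outerProb_le (d := d) hβ hp hg hu'.1 hv'.1 (hu'.2.trans hv'.2.symm) hne huv
  have hOv := outerProb_nonneg (d := d) (u := u) (v := v) hβ hp hg v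
  have hYu := innerProb_le_one (d := d) (u := v) (v := u) hβ hp hp1 hg
  have hY := innerProb_swap_le (d := d) hβ hp hp1 hg hu hv hne huv hcard hs1 hs
  have hγ := pair_rate_le hβ hm hg
  have hρ : 0 < m / totalWeight β g := div_pos hm' (totalWeight_pos hβ hg)
  have hγ0 : (0 : ℝ) ≤ k / ((g.size : ℝ) + 1) := by positivity
  have hu1 := hu'.1
  have hv1 := hv'.1
  rw [stepMean_incr hβ hd hp1 hg hu1, stepMean_incr hβ hd hp1 hg hv1,
    secondProb_eq hu1 hv1 hne, secondProb_eq hv1 hu1 hne.symm, outerProb_comm (u := v) (v := u)]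
  set a := g.weight β v
  set b := g.weight β u
  set ρ := m / totalWeight β g
  set c₀ := k * weightBound β m k / m
  set Ou := outerProb β p d g u v u
  set Ov := outerProb β p d g u v v
  set Yu := innerProb β p d g v u
  set Yv := innerProb β p d g u v
  have e : ∀ O Y : ℝ, (k : ℝ) * (O + 1 / ((g.size : ℝ) + 1) * Y)
      = k * O + k / ((g.size : ℝ) + 1) * Y := fun O Y => by ring
  rw [e, e]
  set γ := (k : ℝ) / ((g.size : ℝ) + 1)
  have t3 : Ou * (a + s) ≤ Ov * (b + s) := by
    refine le_of_mul_le_mul_left ?_ ha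
    have q1 : b * (a + s) ≤ a * (b + s) := by nlinarith
    have q2 := mul_le_mul_of_nonneg_right hO (by linarith : 0 ≤ a + s)
    have q3 := mul_le_mul_of_nonneg_left q1 hOv
    linarith
  have t4 : Yu * (a + s) ≤ Yv * (b + s) + (2 * d + 1) * (a - b) := by
    have := mul_le_mul_of_nonneg_right hYu (by linarith : 0 ≤ a - b)
    linarith
  have t5 := mul_le_mul_of_nonneg_left t4 hγ0
  have t6 : (2 * d + 2) * γ * (a - b) ≤ ρ * s * (a - b) := by
    refine mul_le_mul_of_nonneg_right ?_ (by linarith)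
    calc (2 * d + 2) * γ ≤ (2 * d + 2) * (c₀ * ρ) := by gcongr
      _ = ρ * ((2 * d + 2) * c₀) := by ring
      _ ≤ ρ * s := by gcongr
  have t8 := mul_le_mul_of_nonneg_left t3 hk'
  linarith

theorem sum_ite_update {ι : Type*} [Fintype ι] [DecidableEq ι] (t : ι → ℕ) (j : ι) (a v : ℕ) :
    (∑ l, if Function.update t j a l = v then (1 : ℝ) else 0)
      = (∑ l, if t l = v then (1 : ℝ) else 0) - (if t j = v then 1 else 0)
        + if a = v then 1 else 0 := by
  rw [← Finset.add_sum_erase Finset.univ _ (Finset.mem_univ j),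
    ← Finset.add_sum_erase Finset.univ (fun l => if t l = v then (1 : ℝ) else 0)
      (Finset.mem_univ j), Function.update_self]
  have : ∑ l ∈ Finset.univ.erase j, (if Function.update t j a l = v then (1 : ℝ) else 0)
      = ∑ l ∈ Finset.univ.erase j, if t l = v then (1 : ℝ) else 0 :=
    Finset.sum_congr rfl fun l hl => by rw [Function.update_of_ne (Finset.ne_of_mem_erase hl)]
  rw [this]
  ring

/-- The difference of the degrees of two vertices moves: already the randomness of one edge of the
vertex step gives it the variance on the right. -/
theorem le_stepMean_sq_sub (hβ : -1 < β) (hm : 1 ≤ m) (hd : 0 < d)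
    (hp : ∀ i, 0 ≤ p i) (hp1 : ∑ x, p x = 1) (hg : g.Regular M)
    (hu : u ∈ g.vertices) (hv : v ∈ g.vertices) (hne : u ≠ v) :
    (g.weight β v + g.weight β u) / totalWeight β g
        * (1 - (g.weight β v + g.weight β u) / totalWeight β g)
      ≤ stepMean β p g (fun c : Step T m k d => ((g.incr c v : ℝ) - g.incr c u) ^ 2) := by
  set q := choiceProb (g.weight β) g.vertices with hq
  have hqs : ∑ a ∈ g.vertices, q a = 1 := sum_choiceProb_vertices hβ hg
  have hqv : q v = g.weight β v / totalWeight β g :=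
    choiceProb_eq_div (two_le_card_vertices hg) hv
  have hqu : q u = g.weight β u / totalWeight β g :=
    choiceProb_eq_div (two_le_card_vertices hg) hu
  have hqv0 : 0 ≤ q v := choiceProb_nonneg (hg.weight_nonneg hβ) _ _
  have hqu0 : 0 ≤ q u := choiceProb_nonneg (hg.weight_nonneg hβ) _ _
  rw [add_div, ← hqv, ← hqu, stepMean_resample_target hβ hg _ ⟨0, hm⟩]
  have hconst := stepMean_const (m := m) (k := k) (p := p) hβ hd hp1 hg
    ((q v + q u) * (1 - (q v + q u)))
  rw [← hconst]
  refine stepMean_mono hβ hp hg fun c => ?_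
  rw [← hq]
  -- given all other choices, the difference is a constant `X` plus the contribution `ξ` of the edge
  set ξ : ℕ → ℝ := fun a => (if a = v then 1 else 0) - if a = u then 1 else 0 with hξ
  obtain ⟨X, hX⟩ : ∃ X : ℝ, ∀ a, ((g.incr
      ({ c with target := Function.update c.target ⟨0, hm⟩ a } : Step T m k d) v : ℝ)
      - g.incr ({ c with target := Function.update c.target ⟨0, hm⟩ a } : Step T m k d) u)
        = X + ξ a := by
    refine ⟨(g.incr c v : ℝ) - g.incr c u - ξ (c.target ⟨0, hm⟩), fun a => ?_⟩
    simp only [TypedGraph.incr_eq_of_mem _ hv, TypedGraph.incr_eq_of_mem _ hu, hξ, sum_ite_update]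
    ring
  simp_rw [hX]
  have e1 : ∑ a ∈ g.vertices, q a * ξ a = q v - q u := by
    simp only [hξ, mul_sub, mul_ite, mul_one, mul_zero, Finset.sum_sub_distrib,
      Finset.sum_ite_eq', hv, hu, if_true]
  have e2 : ∑ a ∈ g.vertices, q a * ξ a ^ 2 = q v + q u := by
    have : ∀ a, q a * ξ a ^ 2 = q a * (if a = v then 1 else 0) + q a * if a = u then 1 else 0 := by
      intro a
      simp only [hξ]
      by_cases h1 : a = v
      · have : a ≠ u := fun h => hne (h ▸ h1)
        have : v ≠ u := hne.symm
        simp [h1, this]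
      · simp [h1]
    simp only [this, Finset.sum_add_distrib, mul_ite, mul_one, mul_zero, Finset.sum_ite_eq', hv,
      hu, if_true]
  have e3 : ∑ a ∈ g.vertices, q a * (X + ξ a) ^ 2
      = X ^ 2 * ∑ a ∈ g.vertices, q a + 2 * X * ∑ a ∈ g.vertices, q a * ξ a
        + ∑ a ∈ g.vertices, q a * ξ a ^ 2 := by
    rw [Finset.mul_sum, Finset.mul_sum, ← Finset.sum_add_distrib, ← Finset.sum_add_distrib]
    exact Finset.sum_congr rfl fun a _ => by ring
  rw [e3, hqs, e1, e2]
  nlinarith [sq_nonneg (X + (q v - q u)), mul_nonneg hqv0 hqu0]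

end

/-! ### Real inequalities -/

/-- The estimate of the error term in `quotient_sub_le`, with `e` for `|D|`. -/
theorem quartic_le {K Z e J η : ℝ} (hJ : 1 ≤ J) (he0 : 0 ≤ e) (hD : e ≤ Z) (hη0 : 0 ≤ η)
    (hKη : 40 * J ≤ K * η) (hJK : J ≤ K) (hKZ : K ≤ Z) (hZ : K ^ 2 ≤ Z)
    (hJ2 : J ^ 2 ≤ Z) :
    4 * J * ((e ^ 2 + 2 * Z * e + J * Z) * (K + e))
      ≤ η * ((e ^ 2 + Z) * (K * Z + e ^ 2)) := by
  have hZ0 : 0 < Z := by linarith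
  have b1 : K * e ^ 2 ≤ Z * e ^ 2 := mul_le_mul_of_nonneg_right hKZ (sq_nonneg e)
  have b2 : e ^ 3 ≤ Z * e ^ 2 := by
    have := mul_le_mul_of_nonneg_right hD (sq_nonneg e)
    calc e ^ 3 = e * e ^ 2 := by ring
      _ ≤ _ := this
  have b3 : 2 * K * Z * e ≤ Z ^ 2 + Z * e ^ 2 := by
    have : 2 * K * e ≤ Z + e ^ 2 := by nlinarith [sq_nonneg (K - e)]
    nlinarith
  have b4 : J * K * Z ≤ Z ^ 2 := by
    have : J * K ≤ Z := by nlinarith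
    nlinarith
  have b5 : J * Z * e ≤ Z ^ 2 + Z * e ^ 2 := by
    have : J * e ≤ Z + e ^ 2 := by nlinarith [sq_nonneg (J - e)]
    nlinarith
  have hsum : (e ^ 2 + 2 * Z * e + J * Z) * (K + e) ≤ 10 * (Z * e ^ 2 + Z ^ 2) := by
    have : 0 ≤ Z * e ^ 2 := by positivity
    nlinarith
  calc 4 * J * ((e ^ 2 + 2 * Z * e + J * Z) * (K + e))
      ≤ 4 * J * (10 * (Z * e ^ 2 + Z ^ 2)) :=
        mul_le_mul_of_nonneg_left hsum (by linarith)
    _ = 40 * J * (Z * e ^ 2 + Z ^ 2) := by ring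
    _ ≤ K * η * (Z * e ^ 2 + Z ^ 2) := mul_le_mul_of_nonneg_right hKη (by positivity)
    _ ≤ η * ((e ^ 2 + Z) * (K * Z + e ^ 2)) := by
        have : 0 ≤ η * (e ^ 2 * (e ^ 2 + Z)) := by positivity
        linarith

/-- Expansion of the quotient `Z / (K * Z + D ^ 2)` to second order, with an error that is a small
multiple of `z * (D ^ 2 + Z)` when `K` and `Z` are large. -/
theorem quotient_sub_le {K Z D δ z J η : ℝ} (hJ : 1 ≤ J) (hδ : |δ| ≤ z) (hz : z ≤ J)
    (hD : |D| ≤ Z) (hη1 : η ≤ 1) (hKη : 40 * J ≤ K * η) (hK0 : 0 < K) (hZ : K ^ 2 ≤ Z) :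
    (Z + z) / (K * (Z + z) + (D + δ) ^ 2) - Z / (K * Z + D ^ 2)
      ≤ (z * D ^ 2 - 2 * Z * D * δ - Z * δ ^ 2 + η * z * (D ^ 2 + Z)) / (K * Z + D ^ 2) ^ 2 := by
  have hK40 : 40 * J ≤ K := by nlinarith
  have hz0 : 0 ≤ z := (abs_nonneg δ).trans hδ
  have hη0 : 0 ≤ η := by
    by_contra h
    push Not at h
    nlinarith
  have hKZ : K ≤ Z := by nlinarith
  have hZ0 : 0 < Z := by linarith
  have hQ : 0 < K * Z + D ^ 2 := by positivity
  have hJ2 : J ^ 2 ≤ Z := by nlinarith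
  have he : D ^ 2 = |D| ^ 2 := (sq_abs D).symm
  have hδ2 : δ ^ 2 ≤ z * J := by
    rw [← sq_abs δ]; nlinarith [abs_nonneg δ]
  have hDδ : |D * δ| ≤ |D| * z := by
    rw [abs_mul]; exact mul_le_mul_of_nonneg_left hδ (abs_nonneg D)
  have hQ' : (K * Z + D ^ 2) / 2 ≤ K * (Z + z) + (D + δ) ^ 2 := by
    have h1 : D ^ 2 / 2 - δ ^ 2 ≤ (D + δ) ^ 2 := by nlinarith [sq_nonneg (D + 2 * δ)]
    have h2 : δ ^ 2 ≤ J ^ 2 := by nlinarith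
    nlinarith
  have hQ'0 : 0 < K * (Z + z) + (D + δ) ^ 2 := by linarith
  set e := |D|
  have he0 : 0 ≤ e := abs_nonneg D
  have hpoly := quartic_le hJ he0 hD hη0 hKη (by linarith) hKZ hZ hJ2
  have hN : |z * D ^ 2 - 2 * Z * D * δ - Z * δ ^ 2| ≤ z * (e ^ 2 + 2 * Z * e + J * Z) := by
    have h1 := abs_le.1 hDδ
    rw [he, abs_le]
    have h2 := mul_le_mul_of_nonneg_left h1.1 hZ0.le
    have h3 := mul_le_mul_of_nonneg_left h1.2 hZ0.le
    have h4 := mul_le_mul_of_nonneg_left hδ2 hZ0.le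
    have h5 : 0 ≤ z * e ^ 2 := by positivity
    have h6 : 0 ≤ Z * δ ^ 2 := by positivity
    have h7 : 0 ≤ z * (J * Z) := by positivity
    constructor <;> linarith
  have hR : |K * z + 2 * D * δ + δ ^ 2| ≤ 2 * J * (K + e) := by
    have h1 := abs_le.1 hDδ
    have h2 : e * z ≤ e * J := mul_le_mul_of_nonneg_left hz he0
    have h3 : K * z ≤ K * J := mul_le_mul_of_nonneg_left hz hK0.le
    have h4 : z * J ≤ J * K := mul_le_mul hz (by linarith) (by linarith) (by linarith)
    have h5 : 0 ≤ K * z := by positivity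
    have h6 : 0 ≤ K * J := by positivity
    have h7 := sq_nonneg δ
    rw [abs_le]
    constructor <;> linarith
  have hNR : -((z * D ^ 2 - 2 * Z * D * δ - Z * δ ^ 2) * (K * z + 2 * D * δ + δ ^ 2))
      ≤ η * z * (D ^ 2 + Z) * (K * (Z + z) + (D + δ) ^ 2) := by
    calc _ ≤ |(z * D ^ 2 - 2 * Z * D * δ - Z * δ ^ 2) * (K * z + 2 * D * δ + δ ^ 2)| :=
          neg_le_abs _
      _ ≤ z * (e ^ 2 + 2 * Z * e + J * Z) * (2 * J * (K + e)) := by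
          rw [abs_mul]
          exact mul_le_mul hN hR (abs_nonneg _) (by positivity)
      _ = z / 2 * (4 * J * ((e ^ 2 + 2 * Z * e + J * Z) * (K + e))) := by ring
      _ ≤ z / 2 * (η * ((e ^ 2 + Z) * (K * Z + e ^ 2))) :=
          mul_le_mul_of_nonneg_left hpoly (by linarith)
      _ = η * z * (D ^ 2 + Z) * ((K * Z + D ^ 2) / 2) := by rw [he]; ring
      _ ≤ _ := mul_le_mul_of_nonneg_left hQ' (by positivity)
  rw [div_sub_div _ _ hQ'0.ne' hQ.ne', div_le_div_iff₀ (mul_pos hQ'0 hQ) (pow_pos hQ 2)]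
  have hfin := mul_le_mul_of_nonneg_right hNR hQ.le
  have e1 : ((Z + z) * (K * Z + D ^ 2) - (K * (Z + z) + (D + δ) ^ 2) * Z)
      = z * D ^ 2 - 2 * Z * D * δ - Z * δ ^ 2 := by ring
  rw [e1]
  have e2 : K * (Z + z) + (D + δ) ^ 2 = K * Z + D ^ 2 + (K * z + 2 * D * δ + δ ^ 2) := by ring
  generalize z * D ^ 2 - 2 * Z * D * δ - Z * δ ^ 2 = N at *
  generalize K * z + 2 * D * δ + δ ^ 2 = R at *
  rw [e2] at hfin ⊢
  linarith

/-- Bernoulli's inequality for powers of a ratio whose numerator and denominator grow by at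
most `J`. -/
theorem div_pow_add_le {a b x y J : ℝ} (q : ℕ) (hx : 0 ≤ x) (hxJ : x ≤ J) (hy : 0 ≤ y)
    (hyJ : y ≤ J) (ha : 0 < a) (hb : q * J < b) :
    ((b + y) / (a + x)) ^ q
      ≤ (b / a) ^ q * (1 + q * (y / (b - q * J) - x / (a + q * J))) := by
  have hJ : 0 ≤ J := hx.trans hxJ
  have hq : (0 : ℝ) ≤ q := Nat.cast_nonneg q
  have hb0 : 0 < b := lt_of_le_of_lt (by positivity) hb
  have hqy : q * y ≤ q * J := mul_le_mul_of_nonneg_left hyJ hq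
  have hqx : q * x ≤ q * J := mul_le_mul_of_nonneg_left hxJ hq
  have h1 : ((b + y) / b) ^ q ≤ 1 + q * y / (b - q * J) := by
    have h2 : 1 + q * (-(y / (b + y))) ≤ (b / (b + y)) ^ q := by
      have e1 : b / (b + y) = 1 + -(y / (b + y)) := by field_simp; ring
      have : y / (b + y) ≤ 1 := (div_le_one (by linarith)).2 (by linarith)
      rw [e1]
      exact one_add_mul_le_pow (by linarith) q
    have h5 : (1 - q * y / b) ≤ (b / (b + y)) ^ q := by
      refine le_trans ?_ h2
      have h4 : q * (y / (b + y)) ≤ q * y / b := by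
        rw [mul_div_assoc', div_le_div_iff₀ (by linarith) hb0]
        nlinarith [mul_nonneg (mul_nonneg hq hy) hy]
      linarith
    have h6 : ((b + y) / b) ^ q * (b / (b + y)) ^ q = 1 := by
      rw [← mul_pow, div_mul_div_cancel₀ hb0.ne', div_self (by linarith), one_pow]
    have h7 : (1 + q * y / (b - q * J)) * (1 - q * y / b) ≥ 1 := by
      have hbJ : 0 < b - q * J := by linarith
      have : q * y / b * (b - q * J + q * y) ≤ q * y := by
        rw [div_mul_eq_mul_div, div_le_iff₀ hb0]
        exact mul_le_mul_of_nonneg_left (by linarith) (by positivity)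
      have e1 : (1 + q * y / (b - q * J)) * (1 - q * y / b)
          = 1 + (q * y - q * y / b * (b - q * J + q * y)) / (b - q * J) := by
        field_simp
        ring
      rw [e1]
      have := div_nonneg (sub_nonneg.2 this) hbJ.le
      linarith
    have h8 : 0 ≤ ((b + y) / b) ^ q := by positivity
    have h9 : 0 ≤ 1 + q * y / (b - q * J) := by
      have : 0 ≤ q * y / (b - q * J) := div_nonneg (by positivity) (by linarith)
      linarith
    calc ((b + y) / b) ^ q ≤ ((b + y) / b) ^ q * ((1 + q * y / (b - q * J)) * (1 - q * y / b)) :=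
          le_mul_of_one_le_right h8 h7
      _ = (1 + q * y / (b - q * J)) * (((b + y) / b) ^ q * (1 - q * y / b)) := by ring
      _ ≤ (1 + q * y / (b - q * J)) * (((b + y) / b) ^ q * (b / (b + y)) ^ q) := by gcongr
      _ = _ := by rw [h6, mul_one]
  have h2 : (a / (a + x)) ^ q ≤ 1 - q * x / (a + q * J) := by
    have h3 : 1 + q * (x / a) ≤ ((a + x) / a) ^ q := by
      have e1 : (a + x) / a = 1 + x / a := by field_simp
      have : 0 ≤ x / a := by positivity
      rw [e1]
      exact one_add_mul_le_pow (by linarith) q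
    have h6 : (a / (a + x)) ^ q * ((a + x) / a) ^ q = 1 := by
      rw [← mul_pow, div_mul_div_cancel₀ (by linarith), div_self ha.ne', one_pow]
    have haJ : 0 < a + q * J := by positivity
    have h7 : 1 ≤ (1 - q * x / (a + q * J)) * (1 + q * (x / a)) := by
      have e1 : (1 - q * x / (a + q * J)) * (1 + q * (x / a))
          = 1 + q * x * (q * J - q * x) / ((a + q * J) * a) := by
        field_simp
        ring
      rw [e1]
      have : 0 ≤ q * x * (q * J - q * x) / ((a + q * J) * a) :=
        div_nonneg (mul_nonneg (by positivity) (by linarith)) (by positivity)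
      linarith
    have h8 : 0 ≤ (a / (a + x)) ^ q := by positivity
    have h9 : 0 ≤ 1 - q * x / (a + q * J) := by
      have : q * x / (a + q * J) ≤ 1 := (div_le_one haJ).2 (by linarith)
      linarith
    calc (a / (a + x)) ^ q
        ≤ (a / (a + x)) ^ q * ((1 - q * x / (a + q * J)) * (1 + q * (x / a))) :=
          le_mul_of_one_le_right h8 h7
      _ = (1 - q * x / (a + q * J)) * ((a / (a + x)) ^ q * (1 + q * (x / a))) := by ring
      _ ≤ (1 - q * x / (a + q * J)) * ((a / (a + x)) ^ q * ((a + x) / a) ^ q) := by gcongr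
      _ = _ := by rw [h6, mul_one]
  have e : ((b + y) / (a + x)) ^ q
      = (b / a) ^ q * (((b + y) / b) ^ q * (a / (a + x)) ^ q) := by
    rw [← mul_pow, ← mul_pow]
    congr 1
    field_simp
  rw [e]
  refine mul_le_mul_of_nonneg_left ?_ (by positivity)
  have hP : 0 ≤ q * y / (b - q * J) := div_nonneg (by positivity) (by linarith)
  have hQ : 0 ≤ q * x / (a + q * J) := by positivity
  calc _ ≤ (1 + q * y / (b - q * J)) * (1 - q * x / (a + q * J)) :=
        mul_le_mul h1 h2 (by positivity) (by linarith)
    _ ≤ 1 + q * y / (b - q * J) - q * x / (a + q * J) := by nlinarith [mul_nonneg hP hQ]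
    _ = _ := by rw [mul_sub, mul_div_assoc, mul_div_assoc]; ring

/-! ### The potential of a pair of vertices -/

section

variable {T m k d : ℕ} {β : ℝ} {p : Fin T → ℝ} {g : TypedGraph T} {M : ℕ} {u v : ℕ}

theorem weight_extend (c : Step T m k d) (hv : v ∈ g.vertices) :
    (g.extend c).weight β v = g.weight β v + g.incr c v := by
  rw [TypedGraph.weight_of_mem hv, TypedGraph.weight_of_mem (TypedGraph.mem_vertices_extend c hv),
    TypedGraph.deg_extend]
  push_cast
  ring

/-- A bound for the number of end points that a vertex gains in one step. -/
def jump (m k : ℕ) : ℝ := 2 * ((m + k : ℕ) : ℝ)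

theorem incr_le_jump (g : TypedGraph T) (c : Step T m k d) (v : ℕ) :
    (g.incr c v : ℝ) ≤ jump m k := by
  unfold jump
  exact_mod_cast g.incr_le c v

theorem one_le_jump (hm : 1 ≤ m) : 1 ≤ jump m k := by
  unfold jump
  have : (1 : ℝ) ≤ ((m + k : ℕ) : ℝ) := by exact_mod_cast (by omega : 1 ≤ m + k)
  linarith

/-- The potential that measures how close two vertices are: with `D` the difference and `Z` the
shifted sum of the weights, it is `1 / (K + D ^ 2 / Z)`. -/
def pairPotential (β K s : ℝ) (u v : ℕ) (g : TypedGraph T) : ℝ :=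
  (g.weight β u + g.weight β v + 2 * s) /
    (K * (g.weight β u + g.weight β v + 2 * s) + (g.weight β v - g.weight β u) ^ 2)

theorem stepMean_incr_le (hβ : -1 < β) (hd : 0 < d) (hp : ∀ i, 0 ≤ p i)
    (hp1 : ∑ x, p x = 1) (hg : g.Regular M) {i : Fin T} (hv : v ∈ g.verticesOfType i)
    (hcard : 3 ≤ (g.verticesOfType i).card) {κ : ℝ} (hκ : 0 < κ)
    (hκg : κ * g.size ≤ (((g.verticesOfType i).card : ℝ) - 1) * (1 + β)) :
    stepMean β p g (fun c : Step T m k d => (g.incr c v : ℝ))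
      ≤ ((m + k) / (1 + β) + k * d / κ) * (g.weight β v / g.size) := by
  have hv' := (Finset.mem_filter.1 hv).1
  have hN := size_pos hg
  have hb : 0 < 1 + β := by linarith
  have hW := le_totalWeight (β := β) hg
  have hW0 := totalWeight_pos hβ hg
  have ha := hg.one_add_le_weight (β := β) hv'
  have ha0 := hg.weight_pos hβ hv'
  have hk : (0 : ℝ) ≤ k := Nat.cast_nonneg k
  have hm : (0 : ℝ) ≤ m := Nat.cast_nonneg m
  rw [stepMean_incr hβ hd hp1 hg hv']
  have h1 : m / totalWeight β g * g.weight β v ≤ m / (1 + β) * (g.weight β v / g.size) := by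
    have : m / totalWeight β g ≤ m / (g.size * (1 + β)) :=
      div_le_div_of_nonneg_left hm (by positivity) hW
    calc _ ≤ m / (g.size * (1 + β)) * g.weight β v := mul_le_mul_of_nonneg_right this ha0.le
      _ = _ := by field_simp
  have h2 : k / ((g.size : ℝ) + 1) ≤ k / (1 + β) * (g.weight β v / g.size) := by
    have : (k : ℝ) / ((g.size : ℝ) + 1) ≤ k / g.size :=
      div_le_div_of_nonneg_left hk hN (by linarith)
    refine this.trans ?_
    rw [div_mul_div_comm, div_le_div_iff₀ hN (by positivity)]
    have := mul_le_mul_of_nonneg_left ha (mul_nonneg hk hN.le)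
    linarith
  have h3 : secondProb β p d g v ≤ d / κ * (g.weight β v / g.size) := by
    have h4 := (mul_le_mul_of_nonneg_left hκg (secondProb_nonneg (d := d) hβ hp hg v)).trans
      (secondProb_mul_le hβ hp hp1 hg hv hcard)
    rw [div_mul_div_comm, le_div_iff₀ (by positivity)]
    exact h4
  have h5 := mul_le_mul_of_nonneg_left h3 hk
  calc _ ≤ m / (1 + β) * (g.weight β v / g.size) + k / (1 + β) * (g.weight β v / g.size)
        + k * (d / κ * (g.weight β v / g.size)) := by linarith
    _ = _ := by ring

theorem le_stepMean_sq_sub_of_three_le (hβ : -1 < β) (hm : 1 ≤ m) (hd : 0 < d)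
    (hp : ∀ i, 0 ≤ p i) (hp1 : ∑ x, p x = 1) (hg : g.Regular (m + k)) (hsize : 3 ≤ g.size)
    (hu : u ∈ g.vertices) (hv : v ∈ g.vertices) (hne : u ≠ v) :
    (1 + β) / (3 * weightBound β m k ^ 2) * ((g.weight β v + g.weight β u) / g.size)
      ≤ stepMean β p g (fun c : Step T m k d => ((g.incr c v : ℝ) - g.incr c u) ^ 2) := by
  refine le_trans ?_ (le_stepMean_sq_sub hβ hm hd hp hp1 hg hu hv hne)
  have hN := size_pos hg
  have hN3 : (3 : ℝ) ≤ g.size := by exact_mod_cast hsize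
  have hC := weightBound_pos (β := β) (k := k) hm
  have hW0 := totalWeight_pos hβ hg
  have hW := totalWeight_le (β := β) hg
  have ha := hg.weight_pos hβ hv
  have hb := hg.weight_pos hβ hu
  have h1 : (g.weight β v + g.weight β u) / (weightBound β m k * g.size)
      ≤ (g.weight β v + g.weight β u) / totalWeight β g :=
    div_le_div_of_nonneg_left (by linarith) hW0 hW
  have h2 : (1 + β) / (3 * weightBound β m k)
      ≤ 1 - (g.weight β v + g.weight β u) / totalWeight β g := by
    have h3 : (g.size - 2) * (1 + β) ≤ totalWeight β g - (g.weight β v + g.weight β u) := by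
      have h4 := hg.card_mul_le_sum_weight (β := β)
        (((g.vertices.erase v).erase_subset u).trans (g.vertices.erase_subset v))
      have hu' : u ∈ g.vertices.erase v := Finset.mem_erase.2 ⟨hne, hu⟩
      have h5 : (((g.vertices.erase v).erase u).card : ℝ) = g.size - 2 := by
        rw [Finset.card_erase_of_mem hu', Finset.card_erase_of_mem hv]
        have : g.vertices.card = g.size := by simp [TypedGraph.vertices]
        rw [this, Nat.sub_sub, Nat.cast_sub (by omega)]
        norm_num
      have h6 : totalWeight β g = g.weight β v + (g.weight β u +
          ∑ a ∈ (g.vertices.erase v).erase u, g.weight β a) := by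
        rw [Finset.add_sum_erase _ _ hu', Finset.add_sum_erase _ _ hv]
        rfl
      rw [h5] at h4
      linarith
    have h7 : 1 - (g.weight β v + g.weight β u) / totalWeight β g
        = (totalWeight β g - (g.weight β v + g.weight β u)) / totalWeight β g := by
      field_simp
    rw [h7, div_le_div_iff₀ (by positivity) hW0]
    have hb1 : 0 < 1 + β := by linarith
    calc (1 + β) * totalWeight β g ≤ (1 + β) * (weightBound β m k * g.size) := by gcongr
      _ ≤ ((g.size - 2) * (1 + β)) * (3 * weightBound β m k) := by
          have : (g.size : ℝ) ≤ (g.size - 2) * 3 := by linarith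
          have := mul_le_mul_of_nonneg_left this (mul_pos hb1 hC).le
          linarith
      _ ≤ _ := mul_le_mul_of_nonneg_right h3 (by positivity)
  have h8 : 0 ≤ (g.weight β v + g.weight β u) / (weightBound β m k * g.size) := by positivity
  calc _ = (g.weight β v + g.weight β u) / (weightBound β m k * g.size)
        * ((1 + β) / (3 * weightBound β m k)) := by field_simp
    _ ≤ _ := mul_le_mul h1 h2 (div_nonneg (by linarith) (by positivity)) (h8.trans h1)

/-- The potential of a pair of vertices of the same type contracts at rate `ε / size`: their
difference is pushed apart by the drift, and the randomness moves it away from zero. -/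
theorem exists_pairPotential_contract (hβ : -1 < β) (hm : 1 ≤ m) (hd : 0 < d)
    (hp : ∀ i, 0 ≤ p i) (hp1 : ∑ x, p x = 1) {κ : ℝ} (hκ : 0 < κ) :
    ∃ K s ε : ℝ, 0 < K ∧ 0 < s ∧ 0 < ε ∧
      ∀ (g : TypedGraph T) (i : Fin T) (u v : ℕ), g.Regular (m + k) →
        u ∈ g.verticesOfType i → v ∈ g.verticesOfType i → u ≠ v →
        3 ≤ (g.verticesOfType i).card →
        κ * g.size ≤ (((g.verticesOfType i).card : ℝ) - 1) * (1 + β) → s ≤ κ * g.size →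
        stepMean β p g (fun c : Step T m k d => pairPotential β K s u v (g.extend c))
          ≤ (1 - ε / g.size) * pairPotential β K s u v g := by
  have hC := weightBound_pos (β := β) (k := k) hm
  have hb1 : 0 < 1 + β := by linarith
  have hm' : (0 : ℝ) < m := by exact_mod_cast hm
  have hd' : (0 : ℝ) < d := by exact_mod_cast hd
  have hk' : (0 : ℝ) ≤ k := Nat.cast_nonneg k
  have hJ := one_le_jump (k := k) hm
  -- `C₂` bounds the growth rate from above, and `η₀` compares the variance with it
  obtain ⟨C₂, hC₂⟩ : ∃ C₂ : ℝ, C₂ = (m + k) / (1 + β) + k * d / κ := ⟨_, rfl⟩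
  have hC₂0 : 0 < C₂ := by rw [hC₂]; positivity
  obtain ⟨η₀, hη₀, hη₀1, hη₀C⟩ : ∃ η₀ : ℝ, 0 < η₀ ∧ η₀ ≤ 1 ∧
      η₀ * C₂ ≤ (1 + β) / (3 * weightBound β m k ^ 2) := by
    refine ⟨min 1 ((1 + β) / (3 * weightBound β m k ^ 2) / C₂), by positivity, min_le_left _ _, ?_⟩
    calc _ ≤ (1 + β) / (3 * weightBound β m k ^ 2) / C₂ * C₂ :=
          mul_le_mul_of_nonneg_right (min_le_right _ _) hC₂0.le
      _ = _ := by field_simp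
  -- `K` makes the error term of `quotient_sub_le` at most half of the gain from the variance
  obtain ⟨J, hJdef⟩ : ∃ J : ℝ, J = 2 * jump m k := ⟨_, rfl⟩
  have hJ1 : 1 ≤ J := by linarith
  obtain ⟨K, hK⟩ : ∃ K : ℝ, K = 40 * J / (η₀ / 2) := ⟨_, rfl⟩
  have hKη : K * (η₀ / 2) = 40 * J := by rw [hK]; field_simp
  have hK0 : 0 < K := by rw [hK]; positivity
  have hK1 : 1 ≤ K := by nlinarith
  -- the shift `s` serves the drift inequality and keeps the shifted sum above `K ^ 2`
  obtain ⟨s, hs1, hs2, hs3⟩ : ∃ s : ℝ, (2 * d + 2) * (k * weightBound β m k / m) ≤ s ∧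
      K ^ 2 ≤ s ∧ 0 < s :=
    ⟨max ((2 * d + 2) * (k * weightBound β m k / m)) (K ^ 2), le_max_left _ _, le_max_right _ _,
      lt_of_lt_of_le (by positivity) (le_max_right _ _)⟩
  obtain ⟨c₃, hc₃⟩ : ∃ c₃ : ℝ, c₃ = m / weightBound β m k * ((1 + β) / (1 + β + s)) := ⟨_, rfl⟩
  have hc₃0 : 0 < c₃ := by rw [hc₃]; positivity
  refine ⟨K, s, η₀ / 2 / K * c₃, hK0, hs3, by positivity, ?_⟩
  intro g i u v hg hu hv hne hcard hκg hsκ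
  have hu' := (Finset.mem_filter.1 hu).1
  have hv' := (Finset.mem_filter.1 hv).1
  have hN := size_pos hg
  have hsize : 3 ≤ g.size := by
    have h1 := Finset.card_le_card (Finset.filter_subset (fun v => g.type v = i) g.vertices)
    have h2 : g.vertices.card = g.size := by simp [TypedGraph.vertices]
    exact hcard.trans (h1.trans h2.le)
  have ha := hg.one_add_le_weight (β := β) hv'
  have hb := hg.one_add_le_weight (β := β) hu'
  -- first moments
  have hEv := stepMean_incr_le (m := m) (k := k) hβ hd hp hp1 hg hv hcard hκ hκg
  have hEu := stepMean_incr_le (m := m) (k := k) hβ hd hp hp1 hg hu hcard hκ hκg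
  have hLv := le_stepMean_incr (m := m) (k := k) hβ hd hp hp1 hg hv'
  have hLu := le_stepMean_incr (m := m) (k := k) hβ hd hp hp1 hg hu'
  have hSq := le_stepMean_sq_sub_of_three_le hβ hm hd hp hp1 hg hsize hu' hv' hne
  have hdrift : g.deg u ≤ g.deg v →
      stepMean β p g (fun c : Step T m k d => (g.incr c u : ℝ)) * (g.weight β v + s)
      ≤ stepMean β p g (fun c : Step T m k d => (g.incr c v : ℝ)) * (g.weight β u + s) :=
    fun h => stepMean_incr_mul_le hβ hm hd hp hp1 hg hu hv hne h hcard hs1 (hsκ.trans hκg)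
  have hdrift' : g.deg v ≤ g.deg u →
      stepMean β p g (fun c : Step T m k d => (g.incr c v : ℝ)) * (g.weight β u + s)
      ≤ stepMean β p g (fun c : Step T m k d => (g.incr c u : ℝ)) * (g.weight β v + s) :=
    fun h => stepMean_incr_mul_le hβ hm hd hp hp1 hg hv hu hne.symm h hcard hs1 (hsκ.trans hκg)
  have hdeg : g.weight β v - g.weight β u = (g.deg v : ℝ) - g.deg u := by
    rw [TypedGraph.weight_of_mem hv', TypedGraph.weight_of_mem hu']; ring
  rw [← hC₂] at hEv hEu
  set a := g.weight β v with ha_def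
  set b := g.weight β u with hb_def
  set Av := stepMean β p g (fun c : Step T m k d => (g.incr c v : ℝ)) with hAv
  set Au := stepMean β p g (fun c : Step T m k d => (g.incr c u : ℝ)) with hAu
  set V := stepMean β p g (fun c : Step T m k d => ((g.incr c v : ℝ) - g.incr c u) ^ 2) with hV
  obtain ⟨Z, hZ⟩ : ∃ Z : ℝ, Z = b + a + 2 * s := ⟨_, rfl⟩
  obtain ⟨D, hD⟩ : ∃ D : ℝ, D = a - b := ⟨_, rfl⟩
  have hZ0 : 0 < Z := by linarith
  have hDZ : |D| ≤ Z := by rw [abs_le]; constructor <;> linarith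
  have hQ : 0 < K * Z + D ^ 2 := by positivity
  have hpt : ∀ c : Step T m k d, pairPotential β K s u v (g.extend c) ≤
      Z / (K * Z + D ^ 2) + 1 / (K * Z + D ^ 2) ^ 2 *
        ((D ^ 2 + η₀ / 2 * (D ^ 2 + Z)) * ((g.incr c v : ℝ) + g.incr c u)
          - 2 * Z * D * ((g.incr c v : ℝ) - g.incr c u)
          - Z * ((g.incr c v : ℝ) - g.incr c u) ^ 2) := by
    intro c
    have h1 := incr_le_jump g c v
    have h2 := incr_le_jump g c u
    have h3 : (0 : ℝ) ≤ g.incr c v := Nat.cast_nonneg _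
    have h4 : (0 : ℝ) ≤ g.incr c u := Nat.cast_nonneg _
    have h5 := quotient_sub_le (K := K) (Z := Z) (D := D) (J := J) (η := η₀ / 2)
      (δ := (g.incr c v : ℝ) - g.incr c u) (z := (g.incr c v : ℝ) + g.incr c u) hJ1
      (by rw [abs_le]; constructor <;> linarith) (by linarith) hDZ (by linarith) hKη.ge hK0
      (by linarith)
    unfold pairPotential
    rw [weight_extend c hu', weight_extend c hv', ← ha_def, ← hb_def]
    have e1 : b + (g.incr c u : ℝ) + (a + g.incr c v) + 2 * s
        = Z + ((g.incr c v : ℝ) + g.incr c u) := by rw [hZ]; ring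
    have e2 : a + (g.incr c v : ℝ) - (b + g.incr c u)
        = D + ((g.incr c v : ℝ) - g.incr c u) := by rw [hD]; ring
    rw [e1, e2]
    have e3 : ∀ z δ : ℝ, (z * D ^ 2 - 2 * Z * D * δ - Z * δ ^ 2 + η₀ / 2 * z * (D ^ 2 + Z))
        / (K * Z + D ^ 2) ^ 2 = 1 / (K * Z + D ^ 2) ^ 2 *
        ((D ^ 2 + η₀ / 2 * (D ^ 2 + Z)) * z - 2 * Z * D * δ - Z * δ ^ 2) := fun z δ => by ring
    rw [e3] at h5
    linarith
  have hmean := stepMean_mono hβ hp hg hpt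
  rw [stepMean_add, stepMean_const hβ hd hp1 hg, stepMean_const_mul, stepMean_sub, stepMean_sub,
    stepMean_const_mul, stepMean_const_mul, stepMean_const_mul, stepMean_add, stepMean_sub,
    ← hAv, ← hAu, ← hV] at hmean
  refine hmean.trans ?_
  have hpot : pairPotential β K s u v g = Z / (K * Z + D ^ 2) := by
    rw [hZ, hD]; rfl
  rw [hpot]
  -- the drift pushes the difference away from zero
  have hd1 : D ^ 2 * (Av + Au) ≤ D * Z * (Av - Au) := by
    have e : D * Z * (Av - Au) - D ^ 2 * (Av + Au)
        = 2 * (D * (Av * (b + s) - Au * (a + s))) := by rw [hZ, hD]; ring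
    have : 0 ≤ D * (Av * (b + s) - Au * (a + s)) := by
      rcases le_total (g.deg u) (g.deg v) with h | h
      · have h' : (g.deg u : ℝ) ≤ g.deg v := by exact_mod_cast h
        exact mul_nonneg (by linarith) (by linarith [hdrift h])
      · have h' : (g.deg v : ℝ) ≤ g.deg u := by exact_mod_cast h
        exact mul_nonneg_of_nonpos_of_nonpos (by linarith) (by linarith [hdrift' h])
    linarith
  have hV1 : η₀ * (Av + Au) ≤ V := by
    have h1 : Av + Au ≤ C₂ * ((a + b) / g.size) := by
      rw [add_div, mul_add]; linarith
    have h2 : 0 ≤ (a + b) / g.size := div_nonneg (by linarith) hN.le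
    calc η₀ * (Av + Au) ≤ η₀ * (C₂ * ((a + b) / g.size)) := by gcongr
      _ = η₀ * C₂ * ((a + b) / g.size) := by ring
      _ ≤ _ := mul_le_mul_of_nonneg_right hη₀C h2
      _ ≤ V := hSq
  have hE1 : c₃ * (Z / g.size) ≤ Av + Au := by
    have h1 : (1 + β) / (1 + β + s) * Z ≤ a + b := by
      rw [div_mul_eq_mul_div, div_le_iff₀ (by linarith), hZ]
      have := mul_nonneg hs3.le (by linarith : 0 ≤ a + b - 2 * (1 + β))
      linarith
    calc c₃ * (Z / g.size) = m / (weightBound β m k * g.size) * ((1 + β) / (1 + β + s) * Z) := by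
          rw [hc₃]; field_simp
      _ ≤ m / (weightBound β m k * g.size) * (a + b) := by gcongr
      _ = m * a / (weightBound β m k * g.size) + m * b / (weightBound β m k * g.size) := by ring
      _ ≤ Av + Au := add_le_add hLv hLu
  have hfin : (D ^ 2 + η₀ / 2 * (D ^ 2 + Z)) * (Av + Au) - 2 * Z * D * (Av - Au) - Z * V
      ≤ -(η₀ / 2 / K * c₃ / g.size * Z * (K * Z + D ^ 2)) := by
    have hE0 : 0 ≤ Av + Au := le_trans (by positivity) hE1
    have h1 := mul_le_mul_of_nonneg_left hV1 hZ0.le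
    have h2 : (D ^ 2 + η₀ / 2 * (D ^ 2 + Z)) * (Av + Au) - 2 * Z * D * (Av - Au) - Z * V
        ≤ -(η₀ / 2 * (D ^ 2 + Z) * (Av + Au)) := by
      have h3 : η₀ * (D ^ 2 * (Av + Au)) ≤ 1 * (D ^ 2 * (Av + Au)) :=
        mul_le_mul_of_nonneg_right hη₀1 (by positivity)
      linarith
    refine h2.trans (neg_le_neg ?_)
    have h4 : (K * Z + D ^ 2) / K ≤ D ^ 2 + Z := by
      rw [div_le_iff₀ hK0]
      have := mul_le_mul_of_nonneg_right hK1 (sq_nonneg D)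
      linarith
    calc η₀ / 2 / K * c₃ / g.size * Z * (K * Z + D ^ 2)
        = η₀ / 2 * ((K * Z + D ^ 2) / K) * (c₃ * (Z / g.size)) := by ring
      _ ≤ η₀ / 2 * (D ^ 2 + Z) * (Av + Au) := by gcongr
  have h9 := mul_le_mul_of_nonneg_left hfin (by positivity : 0 ≤ 1 / (K * Z + D ^ 2) ^ 2)
  have e9 : 1 / (K * Z + D ^ 2) ^ 2 * -(η₀ / 2 / K * c₃ / g.size * Z * (K * Z + D ^ 2))
      = -(η₀ / 2 / K * c₃ / g.size * (Z / (K * Z + D ^ 2))) := by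
    field_simp
  rw [e9] at h9
  linarith

end

/-! ### The other potentials -/

section

variable {T m k d : ℕ} {β : ℝ} {p : Fin T → ℝ} {g : TypedGraph T} {M : ℕ} {u v : ℕ}

/-- The potential that bounds the probability that `u` ever comes close to the degree of `v`. -/
def ratioPotential (β s : ℝ) (q : ℕ) (u v : ℕ) (g : TypedGraph T) : ℝ :=
  ((g.weight β u + s) / (g.weight β v + s)) ^ q

/-- The shift of the weights that `ratioPotential` needs. -/
def ratioShift (β : ℝ) (m k q : ℕ) : ℝ :=
  3 * (q * jump m k) + 4 * (k * weightBound β m k / m)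

theorem stepMean_ratioPotential_le (hβ : -1 < β) (hm : 1 ≤ m) (hd : 0 < d) (hp : ∀ i, 0 ≤ p i)
    (hp1 : ∑ x, p x = 1) (hg : g.Regular (m + k)) (q : ℕ)
    (hu : u ∈ g.vertices) (hv : v ∈ g.vertices) (htype : g.type u = g.type v) (hne : u ≠ v)
    (h2 : 2 * (g.weight β u + ratioShift β m k q) ≤ g.weight β v + ratioShift β m k q) :
    stepMean β p g (fun c : Step T m k d =>
        ratioPotential β (ratioShift β m k q) q u v (g.extend c))
      ≤ ratioPotential β (ratioShift β m k q) q u v g := by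
  have ha := hg.weight_pos hβ hv
  have hb := hg.weight_pos hβ hu
  have hJ := one_le_jump (k := k) hm
  have hq : (0 : ℝ) ≤ q := Nat.cast_nonneg q
  have hqJ : 0 ≤ q * jump m k := mul_nonneg hq (by linarith)
  have hC := weightBound_pos (β := β) (k := k) hm
  have hc0 : 0 ≤ k * weightBound β m k / m := by positivity
  obtain ⟨s, hs⟩ : ∃ s, s = ratioShift β m k q := ⟨_, rfl⟩
  have hs' : 3 * (q * jump m k) + 4 * (k * weightBound β m k / m) = s := hs.symm
  rw [← hs] at h2 ⊢
  have hdrift := stepMean_incr_mul_le_of_two_mul_le hβ hm hd hp hp1 hg hu hv htype hne hqJ hs'.le h2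
  set a := g.weight β v with ha_def
  set b := g.weight β u with hb_def
  have hA : 0 < a + s + q * jump m k := by linarith
  have hB : 0 < b + s - q * jump m k := by linarith
  have hpt : ∀ c : Step T m k d, ratioPotential β s q u v (g.extend c)
      ≤ ((b + s) / (a + s)) ^ q + ((b + s) / (a + s)) ^ q * q *
        ((1 / (b + s - q * jump m k)) * g.incr c u
          - (1 / (a + s + q * jump m k)) * g.incr c v) := by
    intro c
    have h := div_pow_add_le (a := a + s) (b := b + s) q (Nat.cast_nonneg (g.incr c v))
      (incr_le_jump g c v) (Nat.cast_nonneg (g.incr c u)) (incr_le_jump g c u) (by linarith)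
      (by linarith)
    unfold ratioPotential
    rw [weight_extend c hu, weight_extend c hv, ← ha_def, ← hb_def, add_right_comm b,
      add_right_comm a]
    refine h.trans (le_of_eq ?_)
    ring
  have hmean := stepMean_mono hβ hp hg hpt
  rw [stepMean_add, stepMean_const hβ hd hp1 hg, stepMean_const_mul, stepMean_sub,
    stepMean_const_mul, stepMean_const_mul] at hmean
  refine hmean.trans ?_
  have hpot : ratioPotential β s q u v g = ((b + s) / (a + s)) ^ q := rfl
  rw [hpot]
  have h3 : (1 / (b + s - q * jump m k)) *
        stepMean β p g (fun c : Step T m k d => (g.incr c u : ℝ))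
      - (1 / (a + s + q * jump m k)) *
        stepMean β p g (fun c : Step T m k d => (g.incr c v : ℝ)) ≤ 0 := by
    rw [sub_nonpos, one_div_mul_eq_div, one_div_mul_eq_div, div_le_div_iff₀ hB hA]
    exact hdrift
  have h4 : 0 ≤ ((b + s) / (a + s)) ^ q * q := by
    have : 0 ≤ (b + s) / (a + s) := div_nonneg (by linarith) (by linarith)
    positivity
  have := mul_nonpos_of_nonneg_of_nonpos h4 h3
  linarith

/-- The inverse weight of a vertex contracts at rate `ε / size`. -/
theorem exists_inv_weight_contract (hβ : -1 < β) (hm : 1 ≤ m) (hd : 0 < d)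
    (hp : ∀ i, 0 ≤ p i) (hp1 : ∑ x, p x = 1) :
    ∃ ε : ℝ, 0 < ε ∧ ∀ (g : TypedGraph T) (v : ℕ), g.Regular (m + k) → v ∈ g.vertices →
      stepMean β p g (fun c : Step T m k d => 1 / (g.extend c).weight β v)
        ≤ (1 - ε / g.size) * (1 / g.weight β v) := by
  have hC := weightBound_pos (β := β) (k := k) hm
  have hb1 : 0 < 1 + β := by linarith
  have hm' : (0 : ℝ) < m := by exact_mod_cast hm
  have hJ := one_le_jump (k := k) hm
  refine ⟨m / weightBound β m k * ((1 + β) / (1 + β + jump m k)), by positivity, ?_⟩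
  intro g v hg hv
  have hN := size_pos hg
  have ha1 := hg.one_add_le_weight (β := β) hv
  have hL := le_stepMean_incr (m := m) (k := k) hβ hd hp hp1 hg hv
  set a := g.weight β v with ha_def
  have ha : 0 < a := by linarith
  have haJ : 0 < a * (a + jump m k) := by positivity
  have hpt : ∀ c : Step T m k d, 1 / (g.extend c).weight β v
      ≤ 1 / a - 1 / (a * (a + jump m k)) * g.incr c v := by
    intro c
    rw [weight_extend c hv, ← ha_def]
    have h0 : (0 : ℝ) ≤ g.incr c v := Nat.cast_nonneg _
    have h1 := incr_le_jump g c v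
    set x : ℝ := (g.incr c v : ℝ)
    have h2 : 1 / (a * (a + jump m k)) * x ≤ 1 / (a * (a + x)) * x := by
      refine mul_le_mul_of_nonneg_right (one_div_le_one_div_of_le (by positivity) ?_) h0
      exact mul_le_mul_of_nonneg_left (by linarith) ha.le
    have h3 : 1 / (a + x) = 1 / a - 1 / (a * (a + x)) * x := by
      field_simp
      ring
    linarith
  have hmean := stepMean_mono hβ hp hg hpt
  rw [stepMean_sub, stepMean_const hβ hd hp1 hg, stepMean_const_mul] at hmean
  refine hmean.trans ?_
  have h1 : (1 + β) / (1 + β + jump m k) ≤ a / (a + jump m k) := by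
    rw [div_le_div_iff₀ (by linarith) (by linarith)]
    have := mul_le_mul_of_nonneg_right ha1 (by linarith : 0 ≤ jump m k)
    linarith
  have h2 := mul_le_mul_of_nonneg_left hL (by positivity : 0 ≤ 1 / (a * (a + jump m k)))
  have h3 : 1 / (a * (a + jump m k)) * (m * a / (weightBound β m k * g.size))
      = m / weightBound β m k * (a / (a + jump m k)) / g.size * (1 / a) := by
    field_simp
  have h4 : m / weightBound β m k * ((1 + β) / (1 + β + jump m k)) / g.size * (1 / a)
      ≤ m / weightBound β m k * (a / (a + jump m k)) / g.size * (1 / a) := by gcongr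
  linarith

/-- A potential that contracts at rate `ε / size` is still a supermartingale after multiplication
with `size ^ ε`. -/
theorem stepMean_rpow_mul_le {ε : ℝ} (hε0 : 0 ≤ ε) (hε1 : ε ≤ 1) (hg : g.Regular M)
    {f : TypedGraph T → ℝ} (hf : 0 ≤ f g)
    (h : stepMean β p g (fun c : Step T m k d => f (g.extend c)) ≤ (1 - ε / g.size) * f g) :
    stepMean β p g (fun c : Step T m k d => ((g.extend c).size : ℝ) ^ ε * f (g.extend c))
      ≤ (g.size : ℝ) ^ ε * f g := by
  have hN := size_pos hg
  simp only [TypedGraph.size_extend]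
  rw [stepMean_const_mul]
  push_cast
  have h1 : ((g.size : ℝ) + 1) ^ ε ≤ (g.size : ℝ) ^ ε * (1 + ε / g.size) := by
    have h2 : ((g.size : ℝ) + 1) = g.size * (1 + 1 / g.size) := by field_simp
    rw [h2, Real.mul_rpow hN.le (by positivity)]
    refine mul_le_mul_of_nonneg_left ?_ (by positivity)
    have := rpow_one_add_le_one_add_mul_self (s := 1 / (g.size : ℝ)) (p := ε)
      (by have : (0 : ℝ) ≤ 1 / g.size := by positivity
          linarith) hε0 hε1
    calc _ ≤ _ := this
      _ = _ := by ring
  have h3 : (1 + ε / g.size) * (1 - ε / g.size) ≤ 1 := by nlinarith [sq_nonneg (ε / g.size)]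
  have hN1 : (1 : ℝ) ≤ g.size := by
    exact_mod_cast (by have := hg.two_le_size; omega : 1 ≤ g.size)
  have h4 : 0 ≤ 1 - ε / g.size := by
    have : ε / g.size ≤ 1 := (div_le_one hN).2 (by linarith)
    linarith
  calc ((g.size : ℝ) + 1) ^ ε * stepMean β p g (fun c : Step T m k d => f (g.extend c))
      ≤ ((g.size : ℝ) + 1) ^ ε * ((1 - ε / g.size) * f g) := by gcongr
    _ ≤ (g.size : ℝ) ^ ε * (1 + ε / g.size) * ((1 - ε / g.size) * f g) := by
        have := mul_nonneg h4 hf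
        gcongr
    _ = (g.size : ℝ) ^ ε * f g * ((1 + ε / g.size) * (1 - ε / g.size)) := by ring
    _ ≤ (g.size : ℝ) ^ ε * f g * 1 := by gcongr
    _ = _ := mul_one _

/-- The exponential martingale of the number of vertices of type `i`. -/
def typePotential (p : Fin T → ℝ) (i : Fin T) (g : TypedGraph T) : ℝ :=
  (1 / 2) ^ (g.verticesOfType i).card / (1 - p i / 2) ^ g.size

theorem card_verticesOfType_extend (g : TypedGraph T) (c : Step T m k d) (i : Fin T) :
    ((g.extend c).verticesOfType i).card
      = (g.verticesOfType i).card + if c.type = i then 1 else 0 := by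
  have hnew : g.size + 1 ∉ g.vertices := by simp [TypedGraph.vertices]
  have h1 : (g.extend c).type (g.size + 1) = c.type := Function.update_self _ _ _
  have h2 : g.vertices.filter (fun v => (g.extend c).type v = i) = g.verticesOfType i :=
    Finset.filter_congr fun v hv => by rw [TypedGraph.type_extend_of_mem c hv]
  unfold TypedGraph.verticesOfType at h2 ⊢
  rw [TypedGraph.vertices_extend, Finset.filter_insert, h1, h2]
  split_ifs with h
  · rw [Finset.card_insert_of_notMem fun hmem => hnew (Finset.mem_filter.1 hmem).1]
  · simp

theorem stepMean_typePotential (hβ : -1 < β) (hd : 0 < d) (hp1 : ∑ x, p x = 1)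
    (hg : g.Regular M) (i : Fin T) (hi : p i < 1) :
    stepMean β p g (fun c : Step T m k d => typePotential p i (g.extend c))
      = typePotential p i g := by
  have hr : 0 < 1 - p i / 2 := by linarith
  have h1 : ∀ c : Step T m k d, typePotential p i (g.extend c)
      = typePotential p i g / (1 - p i / 2) * (1 - 1 / 2 * if c.type = i then 1 else 0) := by
    intro c
    unfold typePotential
    rw [card_verticesOfType_extend, TypedGraph.size_extend]
    split_ifs
    · rw [pow_succ, pow_succ]
      field_simp
      norm_num
    · rw [pow_succ]
      field_simp
      ring
  simp_rw [h1]
  rw [stepMean_const_mul, stepMean_sub, stepMean_const hβ hd hp1 hg, stepMean_const_mul,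
    stepMean_type hβ hd hg (fun x => if x = i then (1 : ℝ) else 0)]
  simp only [mul_ite, mul_one, mul_zero]
  rw [Finset.sum_ite_eq', if_pos (Finset.mem_univ i)]
  have h2 : 2 - p i ≠ 0 := by linarith
  field_simp

end

/-! ### Conditioning on the history and the maximal inequality -/

theorem graphAfter_congr {T m k d : ℕ} (x : Fin T) {s s' : ℕ → Step T m k d} {n : ℕ}
    (h : ∀ j < n, s j = s' j) : graphAfter x s n = graphAfter x s' n := by
  induction n with
  | zero => rfl
  | succ n ih =>
    rw [graphAfter, graphAfter, ih fun j hj => h j (by omega), h n (by omega)]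

theorem size_graphAfter {T m k d : ℕ} (x : Fin T) (s : ℕ → Step T m k d) (n : ℕ) :
    (graphAfter x s n).size = n + 1 := by
  induction n with
  | zero => rfl
  | succ n ih => rw [graphAfter, TypedGraph.size_extend, ih]

instance (T m k d : ℕ) : DiscreteMeasurableSpace (Step T m k d) := ⟨fun _ => trivial⟩

section

variable {T m k d : ℕ} {Ω : Type*} {X : Ω → Fin T} {S : ℕ → Ω → Step T m k d}

/-- The random graph with `n + 1` vertices. -/
def graph (X : Ω → Fin T) (S : ℕ → Ω → Step T m k d) (n : ℕ) (ω : Ω) : TypedGraph T :=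
  graphAfter (X ω) (fun j => S j ω) n

/-- The type of the first vertex together with the first `n` steps. -/
def history (X : Ω → Fin T) (S : ℕ → Ω → Step T m k d) (n : ℕ) (ω : Ω) :
    Fin T × (Fin n → Step T m k d) :=
  (X ω, fun j => S j ω)

theorem history_eq_iff {n : ℕ} {ω ω' : Ω} :
    history X S n ω = history X S n ω' ↔ X ω = X ω' ∧ ∀ j < n, S j ω = S j ω' := by
  simp only [history, Prod.mk.injEq, funext_iff]
  exact and_congr_right fun _ => ⟨fun h j hj => h ⟨j, hj⟩, fun h j => h j j.2⟩

theorem graph_eq_of_history_eq {n j : ℕ} {ω ω' : Ω} (hj : j ≤ n)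
    (h : history X S n ω = history X S n ω') : graph X S j ω = graph X S j ω' := by
  obtain ⟨h1, h2⟩ := history_eq_iff.1 h
  unfold graph
  rw [h1]
  exact graphAfter_congr _ fun i hi => h2 i (by omega)

theorem graph_factorsThrough {n j : ℕ} (hj : j ≤ n) :
    (graph X S j).FactorsThrough (history X S n) :=
  fun _ _ h => graph_eq_of_history_eq hj h

theorem graph_succ (n : ℕ) (ω : Ω) :
    graph X S (n + 1) ω = (graph X S n ω).extend (S n ω) := rfl

theorem size_graph (n : ℕ) (ω : Ω) : (graph X S n ω).size = n + 1 := size_graphAfter _ _ _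

/-- The property `P` holds from time `n₀` to time `n`. -/
def AliveUntil (X : Ω → Fin T) (S : ℕ → Ω → Step T m k d) (P : TypedGraph T → Prop)
    (n₀ n : ℕ) (ω : Ω) : Prop :=
  ∀ j, n₀ ≤ j → j ≤ n → P (graph X S j ω)

/-- The potential `f` reaches the level `a` between times `n₀` and `n`, while `P` holds. -/
def HitUntil (X : Ω → Fin T) (S : ℕ → Ω → Step T m k d) (P : TypedGraph T → Prop)
    (f : TypedGraph T → ℝ) (a : ℝ) (n₀ n : ℕ) (ω : Ω) : Prop :=
  ∃ j, n₀ ≤ j ∧ j ≤ n ∧ AliveUntil X S P n₀ j ω ∧ a ≤ f (graph X S j ω)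

open Classical in
/-- The potential stopped when it reaches `a`, and killed when `P` fails. -/
def stopped (X : Ω → Fin T) (S : ℕ → Ω → Step T m k d) (P : TypedGraph T → Prop)
    (f : TypedGraph T → ℝ) (a : ℝ) (n₀ n : ℕ) (ω : Ω) : ENNReal :=
  if HitUntil X S P f a n₀ n ω then ENNReal.ofReal a
  else if AliveUntil X S P n₀ n ω then ENNReal.ofReal (f (graph X S n ω)) else 0

variable {P : TypedGraph T → Prop} {f : TypedGraph T → ℝ} {a : ℝ} {n₀ : ℕ}

theorem aliveUntil_congr {n : ℕ} {ω ω' : Ω} (h : history X S n ω = history X S n ω') :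
    AliveUntil X S P n₀ n ω ↔ AliveUntil X S P n₀ n ω' :=
  forall_congr' fun j => forall₂_congr fun _ hj => by rw [graph_eq_of_history_eq hj h]

theorem hitUntil_congr {n : ℕ} {ω ω' : Ω} (h : history X S n ω = history X S n ω') :
    HitUntil X S P f a n₀ n ω ↔ HitUntil X S P f a n₀ n ω' := by
  refine exists_congr fun j => and_congr_right fun _ => and_congr_right fun hj => ?_
  have h' : history X S j ω = history X S j ω' := by
    rw [history_eq_iff] at h ⊢
    exact ⟨h.1, fun i hi => h.2 i (by omega)⟩
  rw [aliveUntil_congr h', graph_eq_of_history_eq hj h]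

variable [MeasurableSpace Ω] {μ : Measure Ω} {β : ℝ} {p : Fin T → ℝ}

theorem measurable_history (hS : IsProcess μ β p X S) (n : ℕ) : Measurable (history X S n) :=
  hS.measurable_type.prodMk (measurable_pi_lambda _ fun j => hS.measurable_step j)

/-- Functions of the history are measurable, since there are only countably many histories. -/
theorem measurable_of_factorsThrough (hS : IsProcess μ β p X S) {α : Type*} [MeasurableSpace α]
    {n : ℕ} {f : Ω → α} (hf : f.FactorsThrough (history X S n)) : Measurable f := by
  cases isEmpty_or_nonempty Ω
  · exact measurable_of_empty f
  · have : Nonempty α := ⟨f (Classical.arbitrary Ω)⟩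
    obtain ⟨e, rfl⟩ := (Function.factorsThrough_iff f).1 hf
    exact (measurable_of_countable e).comp (measurable_history hS n)

theorem measurableSet_of_graph (hS : IsProcess μ β p X S) (n : ℕ) (P : TypedGraph T → Prop) :
    MeasurableSet {ω | P (graph X S n ω)} := by
  have : Measurable fun ω => P (graph X S n ω) :=
    measurable_of_factorsThrough hS (n := n) fun ω ω' h => by
      rw [graph_eq_of_history_eq le_rfl h]
  exact measurableSet_setOfPred.2 this

theorem measure_history_step (hS : IsProcess μ β p X S) (n : ℕ) (ω₀ : Ω) (c : Step T m k d) :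
    μ {ω | history X S n ω = history X S n ω₀ ∧ S n ω = c}
      = μ {ω | history X S n ω = history X S n ω₀} *
        ENNReal.ofReal (stepProb β p (graph X S n ω₀) c) := by
  have h := hS.law_step n (X ω₀) (fun j => if j < n then S j ω₀ else c)
  have h1 : ∀ j < n, (if j < n then S j ω₀ else c) = S j ω₀ := fun j hj => if_pos hj
  have e1 : {ω | X ω = X ω₀ ∧ ∀ j < n + 1, S j ω = if j < n then S j ω₀ else c}
      = {ω | history X S n ω = history X S n ω₀ ∧ S n ω = c} := by
    ext ω
    simp only [Set.mem_ofPred_eq, history_eq_iff, and_assoc]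
    refine and_congr_right fun _ => ⟨fun h => ⟨fun j hj => ?_, ?_⟩, fun h j hj => ?_⟩
    · rw [h j (by omega), if_pos hj]
    · rw [h n (by omega), if_neg (lt_irrefl n)]
    · split_ifs with hjn
      · exact h.1 j hjn
      · rw [show j = n by omega]
        exact h.2
  have e2 : {ω | X ω = X ω₀ ∧ ∀ j < n, S j ω = if j < n then S j ω₀ else c}
      = {ω | history X S n ω = history X S n ω₀} := by
    ext ω
    simp only [Set.mem_ofPred_eq, history_eq_iff]
    exact and_congr_right fun _ => forall₂_congr fun j hj => by rw [if_pos hj]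
  rw [e1, e2, if_neg (lt_irrefl n), graphAfter_congr _ h1] at h
  exact h

/-- Given the history, the next step has the law `stepProb`. -/
theorem lintegral_step (hS : IsProcess μ β p X S) {n : ℕ} {Φ : Ω → Step T m k d → ENNReal}
    (hΦ : Φ.FactorsThrough (history X S n)) :
    ∫⁻ ω, Φ ω (S n ω) ∂μ
      = ∫⁻ ω, ∑' c, Φ ω c * ENNReal.ofReal (stepProb β p (graph X S n ω) c) ∂μ := by
  cases isEmpty_or_nonempty Ω
  · simp [Measure.eq_zero_of_isEmpty μ]
  have : Nonempty (TypedGraph T) := ⟨graph X S n (Classical.arbitrary Ω)⟩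
  obtain ⟨Ψ, rfl⟩ := (Function.factorsThrough_iff Φ).1 hΦ
  obtain ⟨G, hG⟩ := (Function.factorsThrough_iff (graph X S n)).1
    (graph_factorsThrough (X := X) (S := S) le_rfl)
  have hH := measurable_history hS n
  have hpair : Measurable fun ω => (history X S n ω, S n ω) := hH.prodMk (hS.measurable_step n)
  have e1 : ∫⁻ ω, (Ψ ∘ history X S n) ω (S n ω) ∂μ
      = ∫⁻ z : (Fin T × (Fin n → Step T m k d)) × Step T m k d, Ψ z.1 z.2
          ∂(μ.map fun ω => (history X S n ω, S n ω)) := by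
    rw [lintegral_map (measurable_of_countable _) hpair]
    rfl
  have e2 : ∫⁻ ω, ∑' c, (Ψ ∘ history X S n) ω c *
        ENNReal.ofReal (stepProb β p (graph X S n ω) c) ∂μ
      = ∫⁻ h, ∑' c, Ψ h c * ENNReal.ofReal (stepProb β p (G h) c) ∂(μ.map (history X S n)) := by
    rw [lintegral_map (measurable_of_countable _) hH, hG]
    rfl
  rw [e1, e2, lintegral_countable', lintegral_countable', ENNReal.tsum_prod']
  refine tsum_congr fun h => ?_
  rw [← ENNReal.tsum_mul_right]
  refine tsum_congr fun c => ?_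
  rw [Measure.map_apply hpair (measurableSet_singleton _),
    Measure.map_apply hH (measurableSet_singleton _)]
  by_cases hr : ∃ ω₀, history X S n ω₀ = h
  · obtain ⟨ω₀, rfl⟩ := hr
    have h1 := measure_history_step hS n ω₀ c
    have e3 : (fun ω => (history X S n ω, S n ω)) ⁻¹' {(history X S n ω₀, c)}
        = {ω | history X S n ω = history X S n ω₀ ∧ S n ω = c} := by
      ext ω; simp
    have e4 : history X S n ⁻¹' {history X S n ω₀}
        = {ω | history X S n ω = history X S n ω₀} := rfl
    have e5 : G (history X S n ω₀) = graph X S n ω₀ := by rw [hG]; rfl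
    rw [e3, e4, e5, h1]
    ring
  · push Not at hr
    have e3 : (fun ω => (history X S n ω, S n ω)) ⁻¹' {(h, c)} = ∅ := by
      ext ω; simp [hr ω]
    have e4 : history X S n ⁻¹' {h} = ∅ := by
      ext ω; simp [hr ω]
    rw [e3, e4]
    simp

theorem ae_stepProb_pos (hS : IsProcess μ β p X S) :
    ∀ᵐ ω ∂μ, ∀ n, 0 < stepProb β p (graph X S n ω) (S n ω) := by
  rw [ae_all_iff]
  intro n
  have hfac : (fun ω (c : Step T m k d) =>
      if stepProb β p (graph X S n ω) c ≤ 0 then (1 : ENNReal) else 0).FactorsThrough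
        (history X S n) := fun ω ω' h => by
    simp only [graph_eq_of_history_eq le_rfl h]
  have h := lintegral_step hS hfac
  have hz : ∀ ω, ∑' c : Step T m k d,
      (if stepProb β p (graph X S n ω) c ≤ 0 then (1 : ENNReal) else 0) *
      ENNReal.ofReal (stepProb β p (graph X S n ω) c) = 0 := by
    intro ω
    rw [ENNReal.tsum_eq_zero]
    intro c
    split_ifs with hc
    · rw [ENNReal.ofReal_of_nonpos hc, mul_zero]
    · rw [zero_mul]
  simp only [hz, lintegral_zero] at h
  have hmeas : Measurable fun ω =>
      if stepProb β p (graph X S n ω) (S n ω) ≤ 0 then (1 : ENNReal) else 0 := by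
    refine measurable_of_factorsThrough hS (n := n + 1) fun ω ω' h => ?_
    simp only [graph_eq_of_history_eq (Nat.le_succ n) h,
      (history_eq_iff.1 h).2 n (Nat.lt_succ_self n)]
  rw [lintegral_eq_zero_iff hmeas] at h
  filter_upwards [h] with ω hω
  by_contra hneg
  simp [not_lt.1 hneg] at hω

theorem ae_regular (hS : IsProcess μ β p X S) (hm : 1 ≤ m) :
    ∀ᵐ ω ∂μ, ∀ n, 1 ≤ n → (graph X S n ω).Regular (m + k) := by
  filter_upwards [ae_stepProb_pos hS] with ω hω n hn
  induction n, hn using Nat.le_induction with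
  | base => exact regular_initial_extend hm (hω 0).ne'
  | succ n _ ih => exact ih.extend hm (hω n).ne'

theorem tsum_ofReal_mul_stepProb (hβ : -1 < β) (hp : ∀ i, 0 ≤ p i) (hm : 1 ≤ m)
    {g : TypedGraph T} (hg : g.Regular (m + k))
    {f : TypedGraph T → ℝ} (hf : ∀ g : TypedGraph T, g.Regular (m + k) → 0 ≤ f g) :
    ∑' c : Step T m k d, ENNReal.ofReal (f (g.extend c)) * ENNReal.ofReal (stepProb β p g c)
      = ENNReal.ofReal (stepMean β p g fun c : Step T m k d => f (g.extend c)) := by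
  unfold stepMean
  rw [ENNReal.ofReal_tsum_of_nonneg _ (summable_stepProb_mul _)]
  · refine tsum_congr fun c => ?_
    rw [ENNReal.ofReal_mul (stepProb_nonneg hβ hp hg c), mul_comm]
  · intro c
    by_cases hc : stepProb β p g c = 0
    · simp [hc]
    · exact mul_nonneg (stepProb_nonneg hβ hp hg c) (hf _ (hg.extend hm hc))

open Classical in
theorem measurable_stopped (hS : IsProcess μ β p X S) (n : ℕ) :
    Measurable (stopped X S P f a n₀ n) :=
  measurable_of_factorsThrough hS (n := n) fun ω ω' h =>
    if_congr (hitUntil_congr h) rfl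
      (if_congr (aliveUntil_congr h) (by rw [graph_eq_of_history_eq le_rfl h]) rfl)

open Classical in
theorem lintegral_stopped_succ_le (hS : IsProcess μ β p X S) (hβ : -1 < β) (hm : 1 ≤ m)
    (hd : 0 < d) (hp : ∀ i, 0 ≤ p i) (hp1 : ∑ x, p x = 1) (hn₀ : 1 ≤ n₀)
    (hf : ∀ g : TypedGraph T, g.Regular (m + k) → 0 ≤ f g)
    (hstep : ∀ g : TypedGraph T, g.Regular (m + k) → n₀ < g.size → P g → f g < a →
      stepMean β p g (fun c : Step T m k d => f (g.extend c)) ≤ f g)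
    {n : ℕ} (hn : n₀ ≤ n) :
    ∫⁻ ω, stopped X S P f a n₀ (n + 1) ω ∂μ ≤ ∫⁻ ω, stopped X S P f a n₀ n ω ∂μ := by
  set Φ : Ω → Step T m k d → ENNReal := fun ω c =>
    if HitUntil X S P f a n₀ n ω then ENNReal.ofReal a
    else if AliveUntil X S P n₀ n ω then ENNReal.ofReal (f ((graph X S n ω).extend c)) else 0
    with hΦ
  have hfac : Φ.FactorsThrough (history X S n) := fun ω ω' h => by
    simp only [hΦ, hitUntil_congr h, aliveUntil_congr h, graph_eq_of_history_eq le_rfl h]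
  have h1 : ∀ ω, stopped X S P f a n₀ (n + 1) ω ≤ Φ ω (S n ω) := by
    intro ω
    have halive : AliveUntil X S P n₀ (n + 1) ω → AliveUntil X S P n₀ n ω :=
      fun h j h1 h2 => h j h1 (by omega)
    simp only [stopped, hΦ]
    by_cases hit : HitUntil X S P f a n₀ n ω
    · have : HitUntil X S P f a n₀ (n + 1) ω := by
        obtain ⟨j, a1, a2, a3⟩ := hit
        exact ⟨j, a1, by omega, a3⟩
      rw [if_pos this, if_pos hit]
    · rw [if_neg hit]
      by_cases hit' : HitUntil X S P f a n₀ (n + 1) ω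
      · rw [if_pos hit']
        obtain ⟨j, a1, a2, a3, a4⟩ := hit'
        have hj : j = n + 1 := by
          by_contra hne
          exact hit ⟨j, a1, by omega, a3, a4⟩
        subst hj
        rw [if_pos (halive a3)]
        exact ENNReal.ofReal_le_ofReal a4
      · rw [if_neg hit']
        by_cases hal : AliveUntil X S P n₀ (n + 1) ω
        · rw [if_pos hal, if_pos (halive hal)]
          exact le_rfl
        · rw [if_neg hal]
          exact zero_le
  refine (lintegral_mono h1).trans ?_
  rw [lintegral_step hS hfac]
  refine lintegral_mono_ae ?_
  filter_upwards [ae_regular hS hm] with ω hω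
  have hg := hω n (by omega)
  simp only [stopped, hΦ]
  split_ifs with hit hal
  · rw [ENNReal.tsum_mul_left]
    have h2 := tsum_ofReal_mul_stepProb (d := d) hβ hp hm hg (f := fun _ => 1)
      (fun _ _ => zero_le_one)
    rw [stepMean_const hβ hd hp1 hg] at h2
    simp only [ENNReal.ofReal_one, one_mul] at h2
    rw [h2, mul_one]
  · rw [tsum_ofReal_mul_stepProb hβ hp hm hg hf]
    refine ENNReal.ofReal_le_ofReal (hstep _ hg (by rw [size_graph]; omega) (hal n hn le_rfl) ?_)
    by_contra hlt
    exact hit ⟨n, hn, le_rfl, hal, not_lt.1 hlt⟩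
  · simp

/-- The maximal inequality for a nonnegative supermartingale, in the form needed here: `f` need
only be a supermartingale as long as it is below `a` and the property `P` has not failed. -/
theorem mul_measure_hit_le [IsProbabilityMeasure μ] (hS : IsProcess μ β p X S) (hβ : -1 < β)
    (hm : 1 ≤ m) (hd : 0 < d) (hp : ∀ i, 0 ≤ p i) (hp1 : ∑ x, p x = 1) (hn₀ : 1 ≤ n₀)
    (hf : ∀ g : TypedGraph T, g.Regular (m + k) → 0 ≤ f g)
    (hstep : ∀ g : TypedGraph T, g.Regular (m + k) → n₀ < g.size → P g → f g < a →
      stepMean β p g (fun c : Step T m k d => f (g.extend c)) ≤ f g)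
    {C : ℝ} (hC : ∀ g : TypedGraph T, g.Regular (m + k) → g.size = n₀ + 1 → P g → f g ≤ C) :
    ENNReal.ofReal a * μ {ω | ∃ n, HitUntil X S P f a n₀ n ω} ≤ ENNReal.ofReal C := by
  have hmono : ∀ n, n₀ ≤ n →
      ∫⁻ ω, stopped X S P f a n₀ n ω ∂μ ≤ ∫⁻ ω, stopped X S P f a n₀ n₀ ω ∂μ := by
    intro n hn
    induction n, hn using Nat.le_induction with
    | base => exact le_rfl
    | succ n hn ih =>
      exact (lintegral_stopped_succ_le hS hβ hm hd hp hp1 hn₀ hf hstep hn).trans ih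
  have h0 : ∫⁻ ω, stopped X S P f a n₀ n₀ ω ∂μ ≤ ENNReal.ofReal C := by
    calc ∫⁻ ω, stopped X S P f a n₀ n₀ ω ∂μ ≤ ∫⁻ _ω, ENNReal.ofReal C ∂μ := by
          refine lintegral_mono_ae ?_
          filter_upwards [ae_regular hS hm] with ω hω
          have hle : P (graph X S n₀ ω) → f (graph X S n₀ ω) ≤ C :=
            hC _ (hω n₀ hn₀) (size_graph _ _)
          unfold stopped
          split_ifs with hit hal
          · obtain ⟨j, a1, a2, a3, a4⟩ := hit
            have hj : j = n₀ := le_antisymm a2 a1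
            subst hj
            exact ENNReal.ofReal_le_ofReal (a4.trans (hle (a3 j le_rfl le_rfl)))
          · exact ENNReal.ofReal_le_ofReal (hle (hal n₀ le_rfl le_rfl))
          · exact zero_le
      _ = ENNReal.ofReal C := by simp
  have hhit : ∀ n, ENNReal.ofReal a * μ {ω | HitUntil X S P f a n₀ n ω} ≤ ENNReal.ofReal C := by
    intro n
    rcases le_or_gt n₀ n with hn | hn
    · refine le_trans ?_ ((hmono n hn).trans h0)
      refine le_trans ?_ (mul_meas_ge_le_lintegral (measurable_stopped hS n) (ENNReal.ofReal a))
      refine mul_le_mul' le_rfl (measure_mono fun ω hω => ?_)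
      exact (if_pos hω : stopped X S P f a n₀ n ω = ENNReal.ofReal a).ge
    · have : {ω | HitUntil X S P f a n₀ n ω} = ∅ := by
        ext ω
        simp only [Set.mem_ofPred_eq, Set.mem_empty_iff_false, iff_false]
        rintro ⟨j, a1, a2, -⟩
        omega
      rw [this, measure_empty, mul_zero]
      exact zero_le
  have hunion : {ω | ∃ n, HitUntil X S P f a n₀ n ω}
      = ⋃ n, {ω | HitUntil X S P f a n₀ n ω} := by ext; simp
  have hmonoset : Monotone fun n => {ω | HitUntil X S P f a n₀ n ω} := by
    rintro n n' h ω ⟨j, a1, a2, a3⟩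
    exact ⟨j, a1, a2.trans h, a3⟩
  rw [hunion, hmonoset.measure_iUnion, ENNReal.mul_iSup]
  exact iSup_le hhit

/-- A nonnegative supermartingale is almost surely bounded. -/
theorem ae_exists_forall_lt [IsProbabilityMeasure μ] (hS : IsProcess μ β p X S) (hβ : -1 < β)
    (hm : 1 ≤ m) (hd : 0 < d) (hp : ∀ i, 0 ≤ p i) (hp1 : ∑ x, p x = 1) (hn₀ : 1 ≤ n₀)
    (hf : ∀ g : TypedGraph T, g.Regular (m + k) → 0 ≤ f g)
    (hstep : ∀ g : TypedGraph T, g.Regular (m + k) → n₀ < g.size → P g →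
      stepMean β p g (fun c : Step T m k d => f (g.extend c)) ≤ f g)
    {C : ℝ} (hC : ∀ g : TypedGraph T, g.Regular (m + k) → g.size = n₀ + 1 → P g → f g ≤ C) :
    ∀ᵐ ω ∂μ, (∀ n, n₀ ≤ n → P (graph X S n ω)) →
      ∃ L : ℕ, ∀ n, n₀ ≤ n → f (graph X S n ω) < L := by
  rw [ae_iff]
  set B := {ω | ¬((∀ n, n₀ ≤ n → P (graph X S n ω)) →
      ∃ L : ℕ, ∀ n, n₀ ≤ n → f (graph X S n ω) < L)} with hB
  have h1 : ∀ L : ℕ, (L : ENNReal) * μ B ≤ ENNReal.ofReal C := by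
    intro L
    refine le_trans ?_ (mul_measure_hit_le (a := L) hS hβ hm hd hp hp1 hn₀ hf
      (fun g a1 a2 a3 _ => hstep g a1 a2 a3) hC)
    rw [ENNReal.ofReal_natCast]
    refine mul_le_mul' le_rfl (measure_mono fun ω hω => ?_)
    simp only [hB, Set.mem_ofPred_eq] at hω ⊢
    push Not at hω
    obtain ⟨n, hn, hL⟩ := hω.2 L
    exact ⟨n, n, hn, le_rfl, fun j hj _ => hω.1 j hj, hL⟩
  by_contra hne
  obtain ⟨L, hL⟩ := ENNReal.exists_nat_mul_gt hne (ENNReal.ofReal_ne_top (r := C))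
  exact absurd (h1 L) (not_le.2 hL)

end

/-! ### The leader -/

section

variable {T m k d : ℕ} {Ω : Type*} {X : Ω → Fin T} {S : ℕ → Ω → Step T m k d}

theorem mem_vertices_graph {n v : ℕ} {ω : Ω} :
    v ∈ (graph X S n ω).vertices ↔ 1 ≤ v ∧ v ≤ n + 1 := by
  rw [TypedGraph.vertices, size_graph, Finset.mem_Icc]

theorem type_graph_eq {n n' v : ℕ} {ω : Ω} (hv : v ∈ (graph X S n ω).vertices) (h : n ≤ n') :
    (graph X S n' ω).type v = (graph X S n ω).type v := by
  induction n', h using Nat.le_induction with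
  | base => rfl
  | succ n' h ih =>
    rw [graph_succ, TypedGraph.type_extend_of_mem, ih]
    rw [mem_vertices_graph] at hv ⊢
    omega

theorem mem_verticesOfType_graph_iff {n n' v : ℕ} {ω : Ω} {i : Fin T}
    (hv : v ∈ (graph X S n ω).vertices) (h : n ≤ n') :
    v ∈ (graph X S n' ω).verticesOfType i ↔ v ∈ (graph X S n ω).verticesOfType i := by
  have hv' : v ∈ (graph X S n' ω).vertices := by
    rw [mem_vertices_graph] at hv ⊢
    omega
  simp only [TypedGraph.verticesOfType, Finset.mem_filter, hv, hv', type_graph_eq hv h, true_and]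

theorem mem_verticesOfType_graph_mono {n n' v : ℕ} {ω : Ω} {i : Fin T}
    (hv : v ∈ (graph X S n ω).verticesOfType i) (h : n ≤ n') :
    v ∈ (graph X S n' ω).verticesOfType i :=
  (mem_verticesOfType_graph_iff (Finset.mem_filter.1 hv).1 h).2 hv

variable [MeasurableSpace Ω] {μ : Measure Ω} [IsProbabilityMeasure μ]
  {β : ℝ} {p : Fin T → ℝ}

/-- A positive fraction of the vertices has type `i`. -/
theorem exists_ae_card_verticesOfType (hS : IsProcess μ β p X S) (hβ : -1 < β) (hm : 1 ≤ m)
    (hd : 0 < d) (hp : ∀ i, p i ∈ Set.Ioo (0 : ℝ) 1) (hp1 : ∑ x, p x = 1) (i : Fin T) :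
    ∃ c : ℝ, 0 < c ∧ ∀ᵐ ω ∂μ, ∃ N : ℕ, ∀ n, N ≤ n →
      c * ((n : ℝ) + 1) ≤ ((graph X S n ω).verticesOfType i).card := by
  have hr0 : 0 < 1 - p i / 2 := by linarith [(hp i).2]
  have hr1 : 1 - p i / 2 < 1 := by linarith [(hp i).1]
  have hlog : 0 < -Real.log (1 - p i / 2) := neg_pos.2 (Real.log_neg hr0 hr1)
  have hlog2 : 0 < Real.log 2 := Real.log_pos one_lt_two
  set ℓ := -Real.log (1 - p i / 2) with hℓ
  -- half the exponential rate, so that the bound absorbs the constant of the martingale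
  refine ⟨ℓ / (2 * Real.log 2), by positivity, ?_⟩
  have hpot := ae_exists_forall_lt hS hβ hm hd (fun j => (hp j).1.le) hp1 (le_refl 1)
    (P := fun _ => True) (f := typePotential p i) (C := 1 / (1 - p i / 2) ^ 2)
    (fun g _ => by unfold typePotential; positivity)
    (fun g hg _ _ => (stepMean_typePotential hβ hd hp1 hg i (hp i).2).le)
    (fun g _ hsize _ => by
      unfold typePotential
      rw [hsize]
      exact div_le_div_of_nonneg_right (pow_le_one₀ (by norm_num) (by norm_num)) (by positivity))
  filter_upwards [hpot] with ω hω
  obtain ⟨L, hL⟩ := hω fun _ _ => trivial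
  obtain ⟨N, hN⟩ := exists_nat_ge (2 * Real.log (L + 1) / ℓ)
  refine ⟨max N 1, fun n hn => ?_⟩
  have h1 := hL n (le_trans (le_max_right _ _) hn)
  unfold typePotential at h1
  rw [size_graph, div_lt_iff₀ (by positivity)] at h1
  set D := ((graph X S n ω).verticesOfType i).card
  have hL1 : (0 : ℝ) < L + 1 := by positivity
  have h2 : ((1 : ℝ) / 2) ^ D < (L + 1) * (1 - p i / 2) ^ (n + 1) :=
    h1.trans_le (mul_le_mul_of_nonneg_right (by linarith) (by positivity))
  have h3 := Real.log_lt_log (by positivity) h2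
  rw [Real.log_pow, Real.log_mul hL1.ne' (by positivity), Real.log_pow, one_div, Real.log_inv] at h3
  push_cast at h3
  have h4 : (N : ℝ) ≤ n := by exact_mod_cast (le_trans (le_max_left _ _) hn)
  rw [div_le_iff₀ hlog] at hN
  have h5 : (N : ℝ) * ℓ ≤ ((n : ℝ) + 1) * ℓ := mul_le_mul_of_nonneg_right (by linarith) hlog.le
  rw [div_mul_eq_mul_div, div_le_iff₀ (by positivity)]
  have h6 : Real.log (1 - p i / 2) = -ℓ := by rw [hℓ, neg_neg]
  rw [h6] at h3
  linarith

/-- Every fixed vertex has a degree that grows at least like a fixed power of the size. -/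
theorem exists_ae_le_weight (hS : IsProcess μ β p X S) (hβ : -1 < β) (hm : 1 ≤ m)
    (hd : 0 < d) (hp : ∀ i, 0 ≤ p i) (hp1 : ∑ x, p x = 1) :
    ∃ ε : ℝ, 0 < ε ∧ ∀ v : ℕ, 1 ≤ v → ∀ᵐ ω ∂μ, ∃ L : ℕ, ∀ n : ℕ, v ≤ n →
      ((n : ℝ) + 1) ^ ε ≤ L * (graph X S n ω).weight β v := by
  obtain ⟨ε₀, hε₀, hcon⟩ := exists_inv_weight_contract (m := m) (k := k) hβ hm hd hp hp1
  refine ⟨min ε₀ 1, by positivity, fun v hv => ?_⟩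
  have hε : 0 ≤ min ε₀ 1 := by positivity
  have hb1 : 0 < 1 + β := by linarith
  have hpot := ae_exists_forall_lt hS hβ hm hd hp hp1 hv
    (P := fun g => v ∈ g.vertices) (f := fun g => (g.size : ℝ) ^ (min ε₀ 1) * (1 / g.weight β v))
    (C := ((v + 1 : ℕ) : ℝ) ^ (min ε₀ 1) * (1 / (1 + β)))
    (fun g hg => mul_nonneg (by positivity) (one_div_nonneg.2 (hg.weight_nonneg hβ v)))
    (fun g hg _ hgv => by
      refine stepMean_rpow_mul_le hε (min_le_right _ _) hg
        (f := fun g => 1 / g.weight β v) (one_div_nonneg.2 (hg.weight_nonneg hβ v)) ?_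
      refine (hcon g v hg hgv).trans ?_
      have h1 := hg.weight_pos hβ hgv
      have h2 := size_pos hg
      have h3 : min ε₀ 1 / g.size ≤ ε₀ / g.size := by
        gcongr
        exact min_le_left _ _
      exact mul_le_mul_of_nonneg_right (by linarith) (by positivity))
    (fun g hg hsize hgv => by
      simp only [hsize]
      have h1 := hg.one_add_le_weight (β := β) hgv
      gcongr)
  filter_upwards [hpot, ae_regular hS hm] with ω hω hreg
  obtain ⟨L, hL⟩ := hω fun n hn => mem_vertices_graph.2 ⟨hv, by omega⟩
  refine ⟨L, fun n hn => ?_⟩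
  have h1 := hL n hn
  have h2 := (hreg n (by omega)).weight_pos hβ (mem_vertices_graph.2 ⟨hv, by omega⟩ :
    v ∈ (graph X S n ω).vertices)
  rw [size_graph, mul_one_div, div_lt_iff₀ h2] at h1
  push_cast at h1
  exact h1.le

/-- Only finitely many vertices ever reach the degree of a fixed vertex of the same type. -/
theorem ae_exists_forall_deg_lt (hS : IsProcess μ β p X S) (hβ : -1 < β) (hm : 1 ≤ m)
    (hd : 0 < d) (hp : ∀ i, 0 ≤ p i) (hp1 : ∑ x, p x = 1) (i : Fin T) :
    ∀ᵐ ω ∂μ, ∀ v, ∃ U, ∀ u, U ≤ u → ∀ n, u ∈ (graph X S n ω).verticesOfType i →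
      v ∈ (graph X S n ω).verticesOfType i →
        (graph X S n ω).deg u < (graph X S n ω).deg v := by
  obtain ⟨ε, hε, hgrow⟩ := exists_ae_le_weight hS hβ hm hd hp hp1
  rw [ae_all_iff]
  intro v
  rcases Nat.eq_zero_or_pos v with rfl | hv
  · refine Filter.Eventually.of_forall fun ω => ⟨0, fun u _ n _ h0 => ?_⟩
    have := (mem_vertices_graph.1 (Finset.mem_filter.1 h0).1).1
    omega
  -- the exponent is chosen so that the bounds on the probabilities are summable
  obtain ⟨q, hq⟩ := exists_nat_ge (2 / ε)
  have hqε : 2 ≤ ε * q := by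
    rw [div_le_iff₀ hε] at hq
    linarith
  have hJ := one_le_jump (k := k) hm
  have hC := weightBound_pos (β := β) (k := k) hm
  obtain ⟨s, hs⟩ : ∃ s, s = ratioShift β m k q := ⟨_, rfl⟩
  have hs0 : 0 ≤ s := by
    rw [hs, ratioShift]
    have : 0 ≤ jump m k := by linarith
    positivity
  obtain ⟨B, hB⟩ : ∃ B, B = jump m k + |β| + s := ⟨_, rfl⟩
  have hB0 : 0 ≤ B := by
    have := abs_nonneg β
    linarith
  -- `u` is compared with `v` from its birth on; the growth of `v` is only required at that time
  set P : ℕ → ℕ → TypedGraph T → Prop := fun L u g =>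
    u ∈ g.verticesOfType i ∧ v ∈ g.verticesOfType i ∧
      (g.size = u → (u : ℝ) ^ ε ≤ L * g.weight β v) with hP
  have hcatch : ∀ L : ℕ, ∀ᵐ ω ∂μ, ∀ᶠ j in Filter.atTop, ¬ ∃ n,
      HitUntil X S (P L (j + (v + 2))) (ratioPotential β s q (j + (v + 2)) v) ((1 / 2) ^ q)
        (j + (v + 1)) n ω := by
    intro L
    have hbound : ∀ j : ℕ, μ {ω | ∃ n, HitUntil X S (P L (j + (v + 2)))
        (ratioPotential β s q (j + (v + 2)) v) ((1 / 2) ^ q) (j + (v + 1)) n ω}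
          ≤ ENNReal.ofReal (2 ^ q * ((B * L) ^ q * (1 / ((j : ℝ) + 1) ^ 2))) := by
      intro j
      have hu0 : (0 : ℝ) < ((j + (v + 2) : ℕ) : ℝ) := by positivity
      have hmain := mul_measure_hit_le (P := P L (j + (v + 2)))
        (f := ratioPotential β s q (j + (v + 2)) v) (a := (1 / 2) ^ q) (n₀ := j + (v + 1))
        (C := (B * L) ^ q * (1 / ((j : ℝ) + 1) ^ 2)) hS hβ hm hd hp hp1 (by omega)
        (fun g hg => by
          unfold ratioPotential
          have h1 := hg.weight_nonneg hβ (j + (v + 2))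
          have h2 := hg.weight_nonneg hβ v
          positivity)
        (fun g hg _ hPg hlt => by
          obtain ⟨hu, hv', -⟩ := hPg
          have hu1 := Finset.mem_filter.1 hu
          have hv1 := Finset.mem_filter.1 hv'
          have ha := hg.weight_pos hβ hv1.1
          unfold ratioPotential at hlt
          have h1 := lt_of_pow_lt_pow_left₀ q (by norm_num) hlt
          rw [div_lt_iff₀ (by linarith)] at h1
          rw [hs]
          refine stepMean_ratioPotential_le hβ hm hd hp hp1 hg q hu1.1 hv1.1
            (hu1.2.trans hv1.2.symm) (by omega) ?_
          rw [← hs]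
          linarith)
        (fun g hg hsize hPg => by
          obtain ⟨hu, hv', hgr⟩ := hPg
          have hu1 := Finset.mem_filter.1 hu
          have hv1 := Finset.mem_filter.1 hv'
          have hsz : g.size = j + (v + 2) := by omega
          have ha := hg.weight_pos hβ hv1.1
          have hb := hg.weight_pos hβ hu1.1
          have hgr' := hgr hsz
          have hpow : 0 < ((j + (v + 2) : ℕ) : ℝ) ^ ε := Real.rpow_pos_of_pos hu0 ε
          have hL0 : 0 ≤ (L : ℝ) := Nat.cast_nonneg L
          have hb' : g.weight β (j + (v + 2)) + s ≤ B := by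
            rw [TypedGraph.weight_of_mem hu1.1, hB]
            have h1 : (g.deg (j + (v + 2)) : ℝ) ≤ jump m k := by
              unfold jump
              have := hg.deg_last_le
              rw [hsz] at this
              exact_mod_cast this
            linarith [le_abs_self β]
          have h2 : (g.weight β (j + (v + 2)) + s) / (g.weight β v + s)
              ≤ B * L / ((j + (v + 2) : ℕ) : ℝ) ^ ε := by
            rw [div_le_div_iff₀ (by linarith) hpow]
            have h3 : ((j + (v + 2) : ℕ) : ℝ) ^ ε ≤ L * (g.weight β v + s) :=
              hgr'.trans (mul_le_mul_of_nonneg_left (by linarith) hL0)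
            calc _ ≤ B * ((j + (v + 2) : ℕ) : ℝ) ^ ε := mul_le_mul_of_nonneg_right hb' hpow.le
              _ ≤ B * (L * (g.weight β v + s)) := mul_le_mul_of_nonneg_left h3 hB0
              _ = _ := by ring
          unfold ratioPotential
          calc _ ≤ (B * L / ((j + (v + 2) : ℕ) : ℝ) ^ ε) ^ q :=
                pow_le_pow_left₀ (div_nonneg (by linarith) (by linarith)) h2 q
            _ = (B * L) ^ q * (1 / ((j + (v + 2) : ℕ) : ℝ) ^ (ε * q)) := by
                rw [div_pow, Real.rpow_mul hu0.le, Real.rpow_natCast]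
                ring
            _ ≤ (B * L) ^ q * (1 / ((j : ℝ) + 1) ^ 2) := by
                refine mul_le_mul_of_nonneg_left (one_div_le_one_div_of_le (by positivity) ?_)
                  (by positivity)
                have h5 : (1 : ℝ) ≤ ((j + (v + 2) : ℕ) : ℝ) := by
                  exact_mod_cast (by omega : 1 ≤ j + (v + 2))
                have h6 : (j : ℝ) + 1 ≤ ((j + (v + 2) : ℕ) : ℝ) := by
                  exact_mod_cast (by omega : j + 1 ≤ j + (v + 2))
                calc ((j : ℝ) + 1) ^ 2 ≤ ((j + (v + 2) : ℕ) : ℝ) ^ 2 := by gcongr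
                  _ = ((j + (v + 2) : ℕ) : ℝ) ^ (2 : ℝ) := by norm_cast
                  _ ≤ _ := Real.rpow_le_rpow_of_exponent_le h5 hqε)
      have h2 : ENNReal.ofReal (2 ^ q) * ENNReal.ofReal ((1 / 2 : ℝ) ^ q) = 1 := by
        rw [← ENNReal.ofReal_mul (by positivity), ← mul_pow]
        norm_num
      rw [ENNReal.ofReal_mul (by positivity)]
      refine le_trans (le_of_eq ?_) (mul_le_mul' le_rfl hmain)
      rw [← mul_assoc, h2, one_mul]
    have hsum : Summable fun j : ℕ => 2 ^ q * ((B * L) ^ q * (1 / ((j : ℝ) + 1) ^ 2)) := by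
      refine Summable.mul_left _ (Summable.mul_left _ ?_)
      have := (summable_nat_add_iff 1).2 (Real.summable_one_div_nat_pow.2 one_lt_two)
      simpa using this
    have hne : ∑' j : ℕ, μ {ω | ∃ n, HitUntil X S (P L (j + (v + 2)))
        (ratioPotential β s q (j + (v + 2)) v) ((1 / 2) ^ q) (j + (v + 1)) n ω} ≠ ⊤ :=
      ne_top_of_le_ne_top hsum.tsum_ofReal_ne_top (ENNReal.tsum_le_tsum hbound)
    exact ae_eventually_notMem hne
  filter_upwards [ae_all_iff.2 hcatch, hgrow v hv, ae_regular hS hm] with ω hω hL hreg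
  obtain ⟨L, hL⟩ := hL
  obtain ⟨j₀, hj₀⟩ := Filter.eventually_atTop.1 (hω L)
  refine ⟨j₀ + (v + 2), fun u hu n hun hvn => ?_⟩
  obtain ⟨j, rfl⟩ : ∃ j, u = j + (v + 2) := ⟨u - (v + 2), by omega⟩
  have hun' := mem_vertices_graph.1 (Finset.mem_filter.1 hun).1
  have hnot := hj₀ j (by omega)
  have hPall : ∀ n', j + (v + 1) ≤ n' → n' ≤ n → P L (j + (v + 2)) (graph X S n' ω) := by
    intro n' h1 h2
    refine ⟨?_, ?_, fun hsz => ?_⟩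
    · exact (mem_verticesOfType_graph_iff (mem_vertices_graph.2 ⟨by omega, by omega⟩) h2).1 hun
    · exact (mem_verticesOfType_graph_iff (mem_vertices_graph.2 ⟨by omega, by omega⟩) h2).1 hvn
    · have h3 := hL n' (by omega)
      rw [size_graph] at hsz
      rw [← hsz]
      push_cast
      exact h3
  have hlt : ratioPotential β s q (j + (v + 2)) v (graph X S n ω) < (1 / 2) ^ q := by
    by_contra hge
    exact hnot ⟨n, n, by omega, le_rfl, hPall, not_lt.1 hge⟩
  have hg := hreg n (by omega)
  have hu1 := (Finset.mem_filter.1 hun).1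
  have hv1 := (Finset.mem_filter.1 hvn).1
  have ha := hg.weight_pos hβ hv1
  have hb := hg.weight_pos hβ hu1
  unfold ratioPotential at hlt
  have h1 := lt_of_pow_lt_pow_left₀ q (by norm_num) hlt
  rw [div_lt_iff₀ (by linarith)] at h1
  have h2 : (graph X S n ω).weight β (j + (v + 2)) < (graph X S n ω).weight β v := by linarith
  rw [TypedGraph.weight_of_mem hu1, TypedGraph.weight_of_mem hv1] at h2
  exact_mod_cast (by linarith :
    ((graph X S n ω).deg (j + (v + 2)) : ℝ) < (graph X S n ω).deg v)

theorem pairPotential_nonneg {M : ℕ} {K s : ℝ} (hβ : -1 < β) (hK : 0 < K) (hs : 0 < s)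
    {g : TypedGraph T} (hg : g.Regular M) (u v : ℕ) : 0 ≤ pairPotential β K s u v g := by
  have h1 := hg.weight_nonneg hβ u
  have h2 := hg.weight_nonneg hβ v
  unfold pairPotential
  positivity

theorem pairPotential_le {M : ℕ} {K s : ℝ} (hβ : -1 < β) (hK : 0 < K) (hs : 0 < s)
    {g : TypedGraph T} (hg : g.Regular M) (u v : ℕ) : pairPotential β K s u v g ≤ 1 / K := by
  have h1 := hg.weight_nonneg hβ u
  have h2 := hg.weight_nonneg hβ v
  unfold pairPotential
  rw [div_le_div_iff₀ (by positivity) hK]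
  nlinarith [sq_nonneg (g.weight β v - g.weight β u)]

/-- A sequence of integers with steps of size at most `J` that stays away from `[-J, J]` has a
constant sign. -/
theorem forall_pos_or_forall_neg {D : ℕ → ℝ} {J : ℝ} {N : ℕ} (hJ : 0 ≤ J)
    (hstep : ∀ n, N ≤ n → |D (n + 1) - D n| ≤ J) (hD : ∀ n, N ≤ n → J < |D n|) :
    (∀ n, N ≤ n → 0 < D n) ∨ ∀ n, N ≤ n → D n < 0 := by
  have hsign : ∀ n, N ≤ n → (J < D n ↔ J < D (n + 1)) := by
    intro n hn
    have h1 := abs_le.1 (hstep n hn)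
    have h2 := lt_abs.1 (hD n hn)
    have h3 := lt_abs.1 (hD (n + 1) (by omega))
    constructor
    · intro h
      rcases h3 with h3 | h3 <;> linarith
    · intro h
      rcases h2 with h2 | h2 <;> linarith
  have hiff : ∀ n, N ≤ n → (J < D N ↔ J < D n) := by
    intro n hn
    induction n, hn using Nat.le_induction with
    | base => rfl
    | succ n hn ih => exact ih.trans (hsign n hn)
  by_cases h : J < D N
  · exact Or.inl fun n hn => lt_of_le_of_lt hJ ((hiff n hn).1 h)
  · refine Or.inr fun n hn => ?_
    have h1 := mt (hiff n hn).2 h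
    rcases lt_abs.1 (hD n hn) with h2 | h2
    · exact absurd h2 h1
    · linarith

/-- Of two vertices of the same type, eventually one always has the larger degree. -/
theorem ae_exists_forall_deg_lt_or (hS : IsProcess μ β p X S) (hβ : -1 < β) (hm : 1 ≤ m)
    (hd : 0 < d) (hp : ∀ i, p i ∈ Set.Ioo (0 : ℝ) 1) (hp1 : ∑ x, p x = 1) (i : Fin T) :
    ∀ᵐ ω ∂μ, ∀ u v n₀, u ≠ v → u ∈ (graph X S n₀ ω).verticesOfType i →
      v ∈ (graph X S n₀ ω).verticesOfType i → ∃ N,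
        (∀ n, N ≤ n → (graph X S n ω).deg u < (graph X S n ω).deg v) ∨
        ∀ n, N ≤ n → (graph X S n ω).deg v < (graph X S n ω).deg u := by
  obtain ⟨c, hc, hcard⟩ := exists_ae_card_verticesOfType hS hβ hm hd hp hp1 i
  have hb1 : 0 < 1 + β := by linarith
  obtain ⟨κ, hκ⟩ : ∃ κ, κ = c * (1 + β) / 2 := ⟨_, rfl⟩
  have hκ0 : 0 < κ := by rw [hκ]; positivity
  have hp0 : ∀ j, 0 ≤ p j := fun j => (hp j).1.le
  have hJ := one_le_jump (k := k) hm
  obtain ⟨K, s, ε₀, hK, hs, hε₀, hcon⟩ :=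
    exists_pairPotential_contract (m := m) (k := k) (d := d) hβ hm hd hp0 hp1 hκ0
  obtain ⟨ε, hε, hε1, hεε⟩ : ∃ ε : ℝ, 0 < ε ∧ ε ≤ 1 ∧ ε ≤ ε₀ :=
    ⟨min ε₀ 1, by positivity, min_le_right _ _, min_le_left _ _⟩
  set P : ℕ → ℕ → TypedGraph T → Prop := fun u v g =>
    u ∈ g.verticesOfType i ∧ v ∈ g.verticesOfType i ∧ 3 ≤ (g.verticesOfType i).card ∧
      κ * g.size ≤ (((g.verticesOfType i).card : ℝ) - 1) * (1 + β) ∧ s ≤ κ * g.size with hP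
  have hpot : ∀ᵐ ω ∂μ, ∀ u v n₀, u ≠ v → 1 ≤ n₀ → (∀ n, n₀ ≤ n → P u v (graph X S n ω)) →
      ∃ L : ℕ, ∀ n, n₀ ≤ n →
        ((graph X S n ω).size : ℝ) ^ ε * pairPotential β K s u v (graph X S n ω) < L := by
    simp only [ae_all_iff, Filter.eventually_imp_distrib_left]
    intro u v n₀ hne hn₀
    refine ae_exists_forall_lt hS hβ hm hd hp0 hp1 hn₀
      (f := fun g => (g.size : ℝ) ^ ε * pairPotential β K s u v g)
      (C := ((n₀ + 1 : ℕ) : ℝ) ^ ε * (1 / K))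
      (fun g hg => mul_nonneg (by positivity) (pairPotential_nonneg hβ hK hs hg u v)) ?_ ?_
    · rintro g hg - ⟨hu, hv, h3, hκg, hsg⟩
      have h0 := pairPotential_nonneg hβ hK hs hg u v
      refine stepMean_rpow_mul_le hε.le hε1 hg (f := pairPotential β K s u v) h0 ?_
      refine (hcon g i u v hg hu hv hne h3 hκg hsg).trans ?_
      have h1 := size_pos hg
      have h2 : ε / g.size ≤ ε₀ / g.size := by gcongr
      exact mul_le_mul_of_nonneg_right (by linarith) h0
    · intro g hg hsize _
      simp only [hsize]
      exact mul_le_mul_of_nonneg_left (pairPotential_le hβ hK hs hg u v) (by positivity)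
  filter_upwards [hpot, hcard, ae_regular hS hm] with ω hω hcardω hreg u v n₀ hne hu hv
  obtain ⟨N₀, hN₀⟩ := hcardω
  obtain ⟨N₁, hN₁⟩ := exists_nat_ge (max (3 / c) (s / κ))
  have hPall : ∀ n, max (max N₀ N₁) (max n₀ 1) ≤ n → P u v (graph X S n ω) := by
    intro n hn
    simp only [max_le_iff] at hn hN₁
    have h1 := hN₀ n hn.1.1
    have h2 : (N₁ : ℝ) ≤ n := by exact_mod_cast hn.1.2
    rw [div_le_iff₀ hc, div_le_iff₀ hκ0] at hN₁
    have h3 : (3 : ℝ) ≤ c * ((n : ℝ) + 1) := by nlinarith [hN₁.1]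
    refine ⟨mem_verticesOfType_graph_mono hu hn.2.1, mem_verticesOfType_graph_mono hv hn.2.1,
      ?_, ?_, ?_⟩
    · exact_mod_cast h3.trans h1
    · rw [size_graph, hκ]
      push_cast
      have h4 : c * ((n : ℝ) + 1) / 2 ≤ ((graph X S n ω).verticesOfType i).card - 1 := by linarith
      have := mul_le_mul_of_nonneg_right h4 hb1.le
      linarith
    · rw [size_graph]
      push_cast
      nlinarith [hN₁.2]
  obtain ⟨L, hL⟩ := hω u v _ hne (le_trans (le_max_right _ _) (le_max_right _ _)) hPall
  -- from here on the size is so large that the bound on the potential forces a large difference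
  obtain ⟨N₂, hN₂⟩ := Filter.eventually_atTop.1 ((tendsto_rpow_atTop hε).comp
    tendsto_natCast_atTop_atTop |>.eventually_ge_atTop (L * (K + jump m k ^ 2 / (2 * s))))
  set N := max (max (max N₀ N₁) (max n₀ 1)) N₂ with hN
  have hmem : ∀ n, N ≤ n → u ∈ (graph X S n ω).vertices ∧ v ∈ (graph X S n ω).vertices := by
    intro n hn
    have hPn := hPall n (le_trans (le_max_left _ _) hn)
    exact ⟨(Finset.mem_filter.1 hPn.1).1, (Finset.mem_filter.1 hPn.2.1).1⟩
  have hfin := forall_pos_or_forall_neg (N := N) (J := jump m k)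
    (D := fun n => ((graph X S n ω).deg v : ℝ) - (graph X S n ω).deg u) (by linarith) ?_ ?_
  · refine ⟨N, ?_⟩
    rcases hfin with h | h
    · refine Or.inl fun n hn => ?_
      have := h n hn
      exact_mod_cast (by linarith : ((graph X S n ω).deg u : ℝ) < (graph X S n ω).deg v)
    · refine Or.inr fun n hn => ?_
      have := h n hn
      exact_mod_cast (by linarith : ((graph X S n ω).deg v : ℝ) < (graph X S n ω).deg u)
  · intro n _
    simp only [graph_succ, TypedGraph.deg_extend]
    push_cast
    have h1 := incr_le_jump (graph X S n ω) (S n ω) v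
    have h2 := incr_le_jump (graph X S n ω) (S n ω) u
    have h3 : (0 : ℝ) ≤ (graph X S n ω).incr (S n ω) v := Nat.cast_nonneg _
    have h4 : (0 : ℝ) ≤ (graph X S n ω).incr (S n ω) u := Nat.cast_nonneg _
    rw [abs_le]
    constructor <;> linarith
  · intro n hn
    have hn1 := le_trans (le_max_left _ _) hn
    have h1 := hL n hn1
    have hg := hreg n (le_trans (le_trans (le_max_right _ _) (le_max_right _ _)) hn1)
    obtain ⟨hu', hv'⟩ := hmem n hn
    have ha := hg.weight_pos hβ hv'
    have hb := hg.weight_pos hβ hu'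
    have hdiff : (graph X S n ω).weight β v - (graph X S n ω).weight β u
        = ((graph X S n ω).deg v : ℝ) - (graph X S n ω).deg u := by
      rw [TypedGraph.weight_of_mem hv', TypedGraph.weight_of_mem hu']
      ring
    have h2 := hN₂ (n + 1) (by have := le_trans (le_max_right _ _) hn; omega)
    rw [← hdiff]
    unfold pairPotential at h1
    rw [size_graph] at h1
    simp only [Function.comp_apply] at h2
    set a := (graph X S n ω).weight β v
    set b := (graph X S n ω).weight β u
    have hZ : 0 < b + a + 2 * s := by linarith
    have hQ : 0 < K * (b + a + 2 * s) + (a - b) ^ 2 := by positivity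
    have h3 : L * (K + jump m k ^ 2 / (2 * s)) * (b + a + 2 * s)
        < L * (K * (b + a + 2 * s) + (a - b) ^ 2) := by
      rw [mul_div_assoc', div_lt_iff₀ hQ] at h1
      exact lt_of_le_of_lt (mul_le_mul_of_nonneg_right h2 hZ.le) h1
    rw [mul_assoc] at h3
    have h4 := lt_of_mul_lt_mul_left h3 (Nat.cast_nonneg L)
    have h5 : jump m k ^ 2 < (a - b) ^ 2 := by
      have h6 : jump m k ^ 2 ≤ jump m k ^ 2 / (2 * s) * (b + a + 2 * s) := by
        rw [div_mul_eq_mul_div, le_div_iff₀ (by linarith)]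
        exact mul_le_mul_of_nonneg_left (by linarith) (sq_nonneg _)
      linarith
    have h7 := sq_lt_sq.1 h5
    rwa [abs_of_nonneg (by linarith : 0 ≤ jump m k)] at h7

theorem isUniqueLeader_of_forall_lt {g : TypedGraph T} {i : Fin T} {h : ℕ}
    (hh : h ∈ g.verticesOfType i)
    (hlt : ∀ u ∈ g.verticesOfType i, u ≠ h → g.deg u < g.deg h) : IsUniqueLeader g i h := by
  have hle : ∀ u ∈ g.verticesOfType i, g.deg u ≤ g.deg h := fun u hu => by
    by_cases hne : u = h
    · rw [hne]
    · exact (hlt u hu hne).le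
  have hmax : g.deg h = g.maxDeg i := le_antisymm (Finset.le_sup hh) (Finset.sup_le hle)
  refine ⟨hh, hmax, fun v hv hdeg => ?_⟩
  by_contra hne
  have := hlt v hv hne
  omega

/-- Almost surely one vertex of type `i` is eventually always the unique leader of its type. -/
theorem ae_exists_isUniqueLeader (hS : IsProcess μ β p X S) (hβ : -1 < β) (hm : 1 ≤ m)
    (hd : 0 < d) (hp : ∀ i, p i ∈ Set.Ioo (0 : ℝ) 1) (hp1 : ∑ x, p x = 1) (i : Fin T) :
    ∀ᵐ ω ∂μ, ∃ N h, ∀ n, N ≤ n → IsUniqueLeader (graph X S n ω) i h := by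
  obtain ⟨c, hc, hcard⟩ := exists_ae_card_verticesOfType hS hβ hm hd hp hp1 i
  filter_upwards [hcard, ae_exists_forall_deg_lt hS hβ hm hd (fun j => (hp j).1.le) hp1 i,
    ae_exists_forall_deg_lt_or hS hβ hm hd hp hp1 i] with ω hcardω hfew hpair
  obtain ⟨N₀, hN₀⟩ := hcardω
  obtain ⟨v₀, hv₀⟩ : ((graph X S N₀ ω).verticesOfType i).Nonempty := by
    rw [← Finset.card_pos]
    have : (0 : ℝ) < ((graph X S N₀ ω).verticesOfType i).card :=
      lt_of_lt_of_le (by positivity) (hN₀ N₀ le_rfl)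
    exact_mod_cast this
  obtain ⟨U, hU⟩ := hfew v₀
  -- the vertices that can lead: from time `N₁` on this set does not change
  set N₁ := max N₀ (max U v₀) with hN₁
  set F := ((graph X S N₁ ω).verticesOfType i).filter (fun u => u < max U (v₀ + 1)) with hF
  have hFtype : ∀ u ∈ F, ∀ n, N₁ ≤ n → u ∈ (graph X S n ω).verticesOfType i := fun u hu n hn =>
    mem_verticesOfType_graph_mono (Finset.mem_filter.1 hu).1 hn
  have hv₀F : v₀ ∈ F := Finset.mem_filter.2
    ⟨mem_verticesOfType_graph_mono hv₀ (le_max_left _ _), lt_max_of_lt_right (Nat.lt_succ_self _)⟩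
  have hpairF : ∀ u v, ∃ N, u ∈ F → v ∈ F → u ≠ v →
      (∀ n, N ≤ n → (graph X S n ω).deg u < (graph X S n ω).deg v) ∨
        ∀ n, N ≤ n → (graph X S n ω).deg v < (graph X S n ω).deg u := by
    intro u v
    by_cases h : u ∈ F ∧ v ∈ F ∧ u ≠ v
    · obtain ⟨N, hN⟩ := hpair u v N₁ h.2.2 (hFtype u h.1 N₁ le_rfl) (hFtype v h.2.1 N₁ le_rfl)
      exact ⟨N, fun _ _ _ => hN⟩
    · exact ⟨0, fun h1 h2 h3 => absurd ⟨h1, h2, h3⟩ h⟩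
  choose τ hτ using hpairF
  set N := max N₁ ((F ×ˢ F).sup fun z => τ z.1 z.2) with hN
  have hτN : ∀ u ∈ F, ∀ v ∈ F, τ u v ≤ N := fun u hu v hv =>
    le_trans (Finset.le_sup (f := fun z : ℕ × ℕ => τ z.1 z.2)
      (Finset.mem_product.2 ⟨hu, hv⟩ : (u, v) ∈ F ×ˢ F)) (le_max_right _ _)
  obtain ⟨h, hhF, hhmax⟩ := Finset.exists_max_image F (graph X S N ω).deg ⟨v₀, hv₀F⟩
  have hlead : ∀ u ∈ F, u ≠ h → ∀ n, N ≤ n → (graph X S n ω).deg u < (graph X S n ω).deg h := by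
    intro u hu hne n hn
    rcases hτ u h hu hhF hne with h1 | h1
    · exact h1 n ((hτN u hu h hhF).trans hn)
    · exact absurd (h1 N (hτN u hu h hhF)) (not_lt.2 (hhmax u hu))
  refine ⟨N, h, fun n hn => ?_⟩
  have hn₁ : N₁ ≤ n := le_trans (le_max_left _ _) hn
  refine isUniqueLeader_of_forall_lt (hFtype h hhF n hn₁) fun u hu hne => ?_
  by_cases huF : u ∈ F
  · exact hlead u huF hne n hn
  · have hu1 := mem_vertices_graph.1 (Finset.mem_filter.1 hu).1
    have huU : max U (v₀ + 1) ≤ u := by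
      by_contra hlt
      have hlt' := not_le.1 hlt
      refine huF (Finset.mem_filter.2 ⟨?_, hlt'⟩)
      refine (mem_verticesOfType_graph_iff (mem_vertices_graph.2 ⟨hu1.1, ?_⟩) hn₁).1 hu
      have h1 : max U (v₀ + 1) ≤ N₁ + 1 := by
        rw [hN₁]
        omega
      omega
    have h1 := hU u (le_trans (le_max_left _ _) huU) n hu (hFtype v₀ hv₀F n hn₁)
    by_cases hvh : v₀ = h
    · rwa [hvh] at h1
    · exact h1.trans (hlead v₀ hv₀F hvh n hn)

end

end EdgeChoice

end

theorem lemma4 {T m k d : ℕ} (hm : 1 ≤ m) (hk : 1 ≤ k) (hd : 1 < d)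
    (β : ℝ) (hβ : -1 < β)
    (p : Fin T → ℝ) (hp : ∀ i, p i ∈ Set.Ioo (0 : ℝ) 1) (hp_sum : ∑ i, p i = 1)
    {Ω : Type*} [MeasurableSpace Ω] (μ : Measure Ω) [IsProbabilityMeasure μ]
    (X : Ω → Fin T) (S : ℕ → Ω → EdgeChoice.Step T m k d)
    (hS : EdgeChoice.IsProcess μ β p X S) (i : Fin T) :
    ∃ R : Ω → ℕ, Measurable R ∧
      ∀ᵐ ω ∂μ, ∃ h : ℕ, ∀ n, R ω ≤ n →
        EdgeChoice.IsUniqueLeader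
          (EdgeChoice.graphAfter (X ω) (fun j => S j ω) n) i h := by
  classical
  set A : ℕ → Set Ω := fun N =>
    {ω | ∃ h, ∀ n, N ≤ n → EdgeChoice.IsUniqueLeader (EdgeChoice.graph X S n ω) i h} with hA
  have hAmeas : ∀ N, MeasurableSet (A N) := by
    intro N
    have : A N = ⋃ h, ⋂ n, ⋂ _ : N ≤ n,
        {ω | EdgeChoice.IsUniqueLeader (EdgeChoice.graph X S n ω) i h} := by
      ext ω
      simp [hA]
    rw [this]
    exact MeasurableSet.iUnion fun h => MeasurableSet.iInter fun n => MeasurableSet.iInter fun _ =>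
      EdgeChoice.measurableSet_of_graph hS n fun g => EdgeChoice.IsUniqueLeader g i h
  -- `R` is the first time from which on there is a constant leader, and `0` if there is none
  have hex : ∀ ω, ∃ N, ω ∈ A N ∪ (⋃ N, A N)ᶜ := by
    intro ω
    by_cases h : ω ∈ ⋃ N, A N
    · obtain ⟨N, hN⟩ := Set.mem_iUnion.1 h
      exact ⟨N, Or.inl hN⟩
    · exact ⟨0, Or.inr h⟩
  refine ⟨fun ω => Nat.find (hex ω), measurable_find hex fun N =>
    (hAmeas N).union (MeasurableSet.iUnion hAmeas).compl, ?_⟩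
  filter_upwards [EdgeChoice.ae_exists_isUniqueLeader hS hβ hm (by omega) hp hp_sum i] with ω hω
  obtain ⟨N, hN⟩ := hω
  rcases Nat.find_spec (hex ω) with h | h
  · exact h
  · exact absurd (Set.mem_iUnion.2 ⟨N, hN⟩) h
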